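/- **Setting.** Manifolds are smooth, finite dimensional, Hausdorff and without boundary. In a Lie groupoid $X\rightrightarrows M$ with source $\mathbf s$ and target $\mathbf t$ the product $xy$ is defined when $\mathbf t(x)=\mathbf s(y)$. Let $X\xrightarrow{\phi}Y\rightrightarrows M$ be a Lie groupoid extension, i.e. a morphism of Lie groupoids $X\rightrightarrows M$, $Y\rightrightarrows M$ over $\mathrm{id}_M$ with $\phi$ a surjective submersion. Let $\mathcal K\to M$ be its kernel, a bundle of Lie groups, and $\mathfrak K\to M$ the bundle of Lie algebras of $\mathcal K$, with bracket $[\xi,\eta]=\frac{d}{d\tau}|_0\mathrm{Ad}_{\exp\tau\xi}\eta$; for $x\in X$ let $\mathrm{Ad}_x:\mathfrak K_{\mathbf t(x)}\to\mathfrak K_{\mathbf s(x)}$ be the differential of $k\mapsto xkx^{-1}$. For $\xi\in\mathfrak K_{\mathbf t(x)}$ put $\xi^{\triangleright}_x=\frac{d}{d\tau}|_0\,x\exp(\tau\xi)$; this identifies $\ker\phi_*$ with $\mathbf t^*\mathfrak K$. Let $H\subset TX$ be a connection on the extension, i.e. a smooth distribution with $T_xX=\ker\phi_{*x}\oplus H_x$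 for all $x$ which is a subgroupoid of the tangent groupoid $TX\rightrightarrows TM$ (closed under products and inverses). Let $\alpha\in\Omega^1(X,\mathbf t^*\mathfrak K)$ be its right connection form: $\alpha(\xi^{\triangleright})=\xi$ and $\alpha|_H=0$. Let $\omega\in\Omega^2(X,\mathbf t^*\mathfrak K)$ be its Ehresmann curvature, $\omega(u,v)=-\mathrm{Ver}[\mathrm{Hor}\,\tilde u,\mathrm{Hor}\,\tilde v]$ for vector fields $\tilde u,\tilde v$ extending $u,v$, where $\mathrm{Hor}$, $\mathrm{Ver}$ are the horizontal and vertical parts and vertical vectors are identified with elements of $\mathbf t^*\mathfrak K$ as above. Let $\nabla$ be the linear connection on $\mathfrak K\to M$ induced by the connection $T\mathcal K\cap H$ on $\mathcal K\to M$ through the fibrewise exponential map, i.e. $\nabla_v\xi=\frac{d}{d\tau}|_0\,\alpha\big((\exp\tau\xi)_*v\big)$ for sections $\xi$ of $\mathfrak K$ and $v\in TM$; let $\omega^{\mathfrak K}\in\Omega^2(M,\mathrm{End}\,\mathfrak K)$, $\omega^{\mathfrak K}(U,V)=[\nabla_U,\nabla_V]-\nabla_{[U,V]}$, be its curvature, $\nabla^{\mathbf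 t}$ its pull back to $\mathbf t^*\mathfrak K\to X$, and $d^{\nabla^{\mathbf t}}$ the exterior covariant derivative. The bracket of $\mathfrak K$-valued forms is normalized by $[\theta_1\otimes a_1,\theta_2\otimes a_2]=(\theta_1\wedge\theta_2)\otimes[a_1,a_2]$. **Theorem.** The Bianchi identities $$d^{\nabla^{\mathbf t}}\omega+[\alpha,\omega]=\mathbf t^*\omega^{\mathfrak K}(\alpha),\qquad \partial^{\triangleright}\omega=0$$ hold. Here $\mathbf t^*\omega^{\mathfrak K}(\alpha)\in\Omega^3(X,\mathbf t^*\mathfrak K)$ is obtained by pairing $\mathbf t^*\omega^{\mathfrak K}\in\Omega^2(X,\mathrm{End}(\mathbf t^*\mathfrak K))$ with $\alpha$, and the second identity means that $$\omega(u_2,v_2)-\omega(u_1\cdot u_2,v_1\cdot v_2)+\mathrm{Ad}_{x_2^{-1}}\omega(u_1,v_1)=0$$ for all $x_1,x_2\in X$ with $\mathbf t(x_1)=\mathbf s(x_2)$ and all $u_i,v_i\in T_{x_i}X$ with $\mathbf t_*u_1=\mathbf s_*u_2$, $\mathbf t_*v_1=\mathbf s_*v_2$, where $\cdot$ is the product of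 the tangent groupoid. -/

import Mathlib

open Set Filter Topology Manifold Bundle
open scoped Manifold ContDiff

/-!
# Lie groupoid extensions and their connections

All manifolds are smooth, finite dimensional, Hausdorff and without boundary; they are modelled on
`𝓘(ℝ, E)`.  Since `TangentSpace 𝓘(ℝ, E) p` is the type `E` (a tangent vector at `p` is recorded by
its coordinates in the preferred chart at `p`), tangent vectors at two points `p`, `q` that are
propositionally equal are identified without a cast.

Several maps below are only meaningful on a submanifold `S` of the manifold on which they are
written (composable pairs, the isotropy groups of the kernel, a fibre of the projection).  Their
differentials are written `mfderivWithin _ _ f S p`; every derivative within `S` has the same value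
on vectors tangent to `S`, and they are only evaluated on such vectors.
-/

noncomputable section

/-- A Lie groupoid `G ⇉ M`.  The product `mul x y` is meaningful when `tgt x = src y` (its other
values are irrelevant), and then runs from `src x` to `tgt y`. -/
structure LieGrpd
    {EG : Type*} [NormedAddCommGroup EG] [NormedSpace ℝ EG]
    {EM : Type*} [NormedAddCommGroup EM] [NormedSpace ℝ EM]
    (G : Type*) [TopologicalSpace G] [ChartedSpace EG G]
    (M : Type*) [TopologicalSpace M] [ChartedSpace EM M] where
  src : G → M
  tgt : G → M
  unit : M → G
  inv : G → G
  mul : G → G → G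
  src_unit : ∀ m, src (unit m) = m
  tgt_unit : ∀ m, tgt (unit m) = m
  src_mul : ∀ x y, tgt x = src y → src (mul x y) = src x
  tgt_mul : ∀ x y, tgt x = src y → tgt (mul x y) = tgt y
  mul_assoc : ∀ x y z, tgt x = src y → tgt y = src z → mul (mul x y) z = mul x (mul y z)
  unit_mul : ∀ x, mul (unit (src x)) x = x
  mul_unit : ∀ x, mul x (unit (tgt x)) = x
  src_inv : ∀ x, src (inv x) = tgt x
  tgt_inv : ∀ x, tgt (inv x) = src x
  mul_inv : ∀ x, mul x (inv x) = unit (src x)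
  inv_mul : ∀ x, mul (inv x) x = unit (tgt x)
  src_submersion : IsSubmersion 𝓘(ℝ, EG) 𝓘(ℝ, EM) ∞ src
  tgt_submersion : IsSubmersion 𝓘(ℝ, EG) 𝓘(ℝ, EM) ∞ tgt
  contMDiff_unit : ContMDiff 𝓘(ℝ, EM) 𝓘(ℝ, EG) ∞ unit
  contMDiff_inv : ContMDiff 𝓘(ℝ, EG) 𝓘(ℝ, EG) ∞ inv
  /-- The multiplication is smooth on the submanifold of composable pairs. -/
  contMDiffOn_mul : ContMDiffOn (𝓘(ℝ, EG).prod 𝓘(ℝ, EG)) 𝓘(ℝ, EG) ∞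
    (fun p : G × G => mul p.1 p.2) {p | tgt p.1 = src p.2}

namespace LieGrpd

variable {EG : Type*} [NormedAddCommGroup EG] [NormedSpace ℝ EG]
  {EM : Type*} [NormedAddCommGroup EM] [NormedSpace ℝ EM]
  {G : Type*} [TopologicalSpace G] [ChartedSpace EG G]
  {M : Type*} [TopologicalSpace M] [ChartedSpace EM M]

/-- The set of composable pairs. -/
def composable (Γ : LieGrpd (EG := EG) (EM := EM) G M) : Set (G × G) :=
  {p | Γ.tgt p.1 = Γ.src p.2}

/-- Two tangent vectors of `G` are composable in the tangent groupoid `TG ⇉ TM`.  For a composable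
pair `(x, y)` such pairs `(u, v)` are the tangent vectors at `(x, y)` to the space of composable
pairs. -/
def TComposable (Γ : LieGrpd (EG := EG) (EM := EM) G M) (x y : G)
    (u : TangentSpace 𝓘(ℝ, EG) x) (v : TangentSpace 𝓘(ℝ, EG) y) : Prop :=
  (mfderiv 𝓘(ℝ, EG) 𝓘(ℝ, EM) Γ.tgt x u : EM) = mfderiv 𝓘(ℝ, EG) 𝓘(ℝ, EM) Γ.src y v

/-- The product `u · v` in the tangent groupoid: the differential of the multiplication. -/
def tmul (Γ : LieGrpd (EG := EG) (EM := EM) G M) (x y : G)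
    (u : TangentSpace 𝓘(ℝ, EG) x) (v : TangentSpace 𝓘(ℝ, EG) y) :
    TangentSpace 𝓘(ℝ, EG) (Γ.mul x y) :=
  mfderivWithin (𝓘(ℝ, EG).prod 𝓘(ℝ, EG)) 𝓘(ℝ, EG) (fun p : G × G => Γ.mul p.1 p.2)
    Γ.composable (x, y) ((u, v) : EG × EG)

end LieGrpd

/-- A Lie groupoid extension `X → Y ⇉ M`: a morphism of Lie groupoids over the identity of `M`
which is a surjective submersion. -/
structure LieGrpdExt
    {EX : Type*} [NormedAddCommGroup EX] [NormedSpace ℝ EX]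
    {EY : Type*} [NormedAddCommGroup EY] [NormedSpace ℝ EY]
    {EM : Type*} [NormedAddCommGroup EM] [NormedSpace ℝ EM]
    (X : Type*) [TopologicalSpace X] [ChartedSpace EX X]
    (Y : Type*) [TopologicalSpace Y] [ChartedSpace EY Y]
    (M : Type*) [TopologicalSpace M] [ChartedSpace EM M] where
  /-- The total groupoid `X ⇉ M`. -/
  top : LieGrpd (EG := EX) (EM := EM) X M
  /-- The quotient groupoid `Y ⇉ M`. -/
  bot : LieGrpd (EG := EY) (EM := EM) Y M
  proj : X → Y
  src_proj : ∀ x, bot.src (proj x) = top.src x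
  tgt_proj : ∀ x, bot.tgt (proj x) = top.tgt x
  proj_unit : ∀ m, proj (top.unit m) = bot.unit m
  proj_mul : ∀ x y, top.tgt x = top.src y → proj (top.mul x y) = bot.mul (proj x) (proj y)
  proj_surjective : Function.Surjective proj
  proj_submersion : IsSubmersion 𝓘(ℝ, EX) 𝓘(ℝ, EY) ∞ proj

namespace LieGrpdExt

variable {EX : Type*} [NormedAddCommGroup EX] [NormedSpace ℝ EX]
  {EY : Type*} [NormedAddCommGroup EY] [NormedSpace ℝ EY]
  {EM : Type*} [NormedAddCommGroup EM] [NormedSpace ℝ EM]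
  {X : Type*} [TopologicalSpace X] [ChartedSpace EX X]
  {Y : Type*} [TopologicalSpace Y] [ChartedSpace EY Y]
  {M : Type*} [TopologicalSpace M] [ChartedSpace EM M]

/-- The fibre `𝒦_m` of the kernel of `X → Y` over `m`, a Lie group with unit `1_m` embedded
in `X`. -/
def ker (P : LieGrpdExt (EX := EX) (EY := EY) (EM := EM) X Y M) (m : M) : Set X :=
  {k | P.proj k = P.bot.unit m}

/-- The tangent space of `X` at the unit `1_m`.  The fibre at `m` of the Lie algebra bundle `𝔎` of
the kernel is the subspace `T_{1_m} 𝒦_m` of it, so that elements of `𝔎_m` are written as elements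
of this space. -/
abbrev unitTangent (P : LieGrpdExt (EX := EX) (EY := EY) (EM := EM) X Y M) (m : M) : Type _ :=
  TangentSpace 𝓘(ℝ, EX) (P.top.unit m)

/-- The vertical space at `x`: the kernel of the differential of `X → Y`.  At a unit `1_m` it is
the Lie algebra `𝔎_m = T_{1_m} 𝒦_m`. -/
def vert (P : LieGrpdExt (EX := EX) (EY := EY) (EM := EM) X Y M) (x : X) :
    Submodule ℝ (TangentSpace 𝓘(ℝ, EX) x) :=
  LinearMap.ker (mfderiv 𝓘(ℝ, EX) 𝓘(ℝ, EY) P.proj x).toLinearMap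

/-- The adjoint representation `Ad_x : 𝔎_{tgt x} → 𝔎_{src x}`: the differential at the unit of the
conjugation `𝒦_{tgt x} → 𝒦_{src x}`, `k ↦ x k x⁻¹`. -/
def Ad (P : LieGrpdExt (EX := EX) (EY := EY) (EM := EM) X Y M) (x : X)
    (ξ : P.unitTangent (P.top.tgt x)) : P.unitTangent (P.top.src x) :=
  mfderivWithin 𝓘(ℝ, EX) 𝓘(ℝ, EX) (fun k => P.top.mul (P.top.mul x k) (P.top.inv x))
    (P.ker (P.top.tgt x)) (P.top.unit (P.top.tgt x)) ξ

/-- The Lie bracket of the Lie algebra `𝔎_m` of `𝒦_m`: the differential at `1_m`, in the direction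
`ξ`, of `𝒦_m → 𝔎_m`, `k ↦ Ad_k η`. -/
def bracket (P : LieGrpdExt (EX := EX) (EY := EY) (EM := EM) X Y M) (m : M)
    (ξ η : P.unitTangent m) : P.unitTangent m :=
  mfderivWithin 𝓘(ℝ, EX) 𝓘(ℝ, EX) (fun k : X => (P.Ad k η : EX)) (P.ker m) (P.top.unit m) ξ

variable [IsManifold 𝓘(ℝ, EX) ∞ X]

/-- A connection on a Lie groupoid extension: a smooth horizontal distribution `H` on `X → Y`
(a complement of the vertical spaces; it is a smooth subbundle of `TX` when the projection of `TX`
onto the vertical vectors along it is smooth) which is a subgroupoid of the tangent groupoid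
`TX ⇉ TM`. -/
structure Connection (P : LieGrpdExt (EX := EX) (EY := EY) (EM := EM) X Y M) where
  hor : ∀ x : X, Submodule ℝ (TangentSpace 𝓘(ℝ, EX) x)
  isCompl : ∀ x, IsCompl (P.vert x) (hor x)
  contMDiff_projection : ContMDiff 𝓘(ℝ, EX).tangent 𝓘(ℝ, EX).tangent ∞
    (fun p : TangentBundle 𝓘(ℝ, EX) X =>
      (⟨p.1, (P.vert p.1).projection (hor p.1) (isCompl p.1) p.2⟩ : TangentBundle 𝓘(ℝ, EX) X))
  tmul_mem : ∀ x y, P.top.tgt x = P.top.src y → ∀ u ∈ hor x, ∀ v ∈ hor y,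
    P.top.TComposable x y u v → P.top.tmul x y u v ∈ hor (P.top.mul x y)
  tinv_mem : ∀ x, ∀ u ∈ hor x, mfderiv 𝓘(ℝ, EX) 𝓘(ℝ, EX) P.top.inv x u ∈ hor (P.top.inv x)

namespace Connection

variable {P : LieGrpdExt (EX := EX) (EY := EY) (EM := EM) X Y M}

/-- The vertical part of a tangent vector. -/
def ver (C : P.Connection) (x : X) (v : TangentSpace 𝓘(ℝ, EX) x) : TangentSpace 𝓘(ℝ, EX) x :=
  (P.vert x).projection (C.hor x) (C.isCompl x) v

/-- The horizontal part of a tangent vector. -/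
def horPart (C : P.Connection) (x : X) (v : TangentSpace 𝓘(ℝ, EX) x) :
    TangentSpace 𝓘(ℝ, EX) x :=
  v - C.ver x v

/-- The right connection 1-form `α`, with values in the pull back `tgt^* 𝔎`: `α_x v` is the element
`ξ ∈ 𝔎_{tgt x}` whose right fundamental vector `ξ^▷_x = d/dτ|₀ x exp(τ ξ)` is the vertical part of
`v`.  As `ξ ↦ ξ^▷_x` is the differential of `k ↦ x k` at the unit, `ξ` is obtained by applying to
the vertical part the differential of `z ↦ x⁻¹ z` from the fibre through `x` to `𝒦_{tgt x}`. -/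
def form (C : P.Connection) (x : X) (v : TangentSpace 𝓘(ℝ, EX) x) :
    P.unitTangent (P.top.tgt x) :=
  mfderivWithin 𝓘(ℝ, EX) 𝓘(ℝ, EX) (fun z => P.top.mul (P.top.inv x) z)
    {z | P.proj z = P.proj x} x (C.ver x v)

/-- The Ehresmann curvature `ω_x(u, v) = - Ver [Hor ũ, Hor ṽ]_x`, where `ũ`, `ṽ` are vector fields
extending `u`, `v`, as a 2-form with values in `tgt^* 𝔎` (a vertical vector being identified with
an element of `𝔎_{tgt x}` as in `Connection.form`).  The value does not depend on the extensions;
we take those with constant coordinates near `x`. -/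
def curv (C : P.Connection) (x : X) (u v : TangentSpace 𝓘(ℝ, EX) x) :
    P.unitTangent (P.top.tgt x) :=
  - C.form x (VectorField.mlieBracket 𝓘(ℝ, EX)
      (fun y => C.horPart y (FiberBundle.extend EX u y))
      (fun y => C.horPart y (FiberBundle.extend EX v y)) x)

section CovariantDerivative

variable {EN : Type*} [NormedAddCommGroup EN] [NormedSpace ℝ EN]
  {N : Type*} [TopologicalSpace N] [ChartedSpace EN N]

/-- `k` is, near `(0, n)`, a smooth family of maps `k s : N → 𝒦` covering `f : N → M` which starts
at the units with initial velocity the section `η` of `f^* 𝔎`.  The family `k s y = exp (s η_y)`,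
where `exp : 𝔎 → 𝒦` is the fibrewise exponential map, is an example. -/
structure IsFamily (P : LieGrpdExt (EX := EX) (EY := EY) (EM := EM) X Y M)
    (f : N → M) (η : ∀ y, P.unitTangent (f y)) (n : N) (k : ℝ → N → X) : Prop where
  contMDiffAt : ContMDiffAt (𝓘(ℝ, ℝ).prod 𝓘(ℝ, EN)) 𝓘(ℝ, EX) ∞
    (fun p : ℝ × N => k p.1 p.2) (0, n)
  mem_ker : ∀ᶠ p : ℝ × N in 𝓝 (0, n), k p.1 p.2 ∈ P.ker (f p.2)
  eq_unit : ∀ᶠ y in 𝓝 n, k 0 y = P.top.unit (f y)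
  velocity : ∀ᶠ y in 𝓝 n,
    (mfderiv 𝓘(ℝ, ℝ) 𝓘(ℝ, EX) (fun s => k s y) 0 (1 : ℝ) : EX) = η y

/-- The covariant derivative `∇_v η` of the connection induced on the Lie algebra bundle `𝔎 → M`,
for a section `η` of the pull back `f^* 𝔎` along a map `f : N → M`.

The horizontal distribution on `𝔎` is the one which the differential of `exp : 𝔎 → 𝒦` carries to
`T𝒦 ∩ H`: it is the linearization of `T𝒦 ∩ H` along the units.  Accordingly `∇_v η`, the vertical
part of the differential of `η : N → 𝔎` on `v`, is `d/ds|₀` of the vertical part `α (T (k s) v)` of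
the differential of `k s = exp (s η)`.  As `H` contains the vectors tangent to the units, this
derivative depends on the velocity of the family `k` at `s = 0` only, so that `∇_v η` is
characterized by this property for all families as in `IsFamily`. -/
def covDeriv (C : P.Connection) (f : N → M) (η : ∀ y, P.unitTangent (f y)) (n : N)
    (v : TangentSpace 𝓘(ℝ, EN) n) : P.unitTangent (f n) :=
  Classical.epsilon fun ζ : EX => ∀ k : ℝ → N → X, IsFamily (EN := EN) P f η n k →
    HasDerivAt
      (fun s : ℝ => (C.form (k s n) (mfderiv 𝓘(ℝ, EN) 𝓘(ℝ, EX) (k s) n v) : EX)) ζ 0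

end CovariantDerivative

/-- The covariant derivative `∇` on sections of `𝔎 → M`. -/
abbrev nabla (C : P.Connection) (ξ : ∀ m, P.unitTangent m) (m : M)
    (v : TangentSpace 𝓘(ℝ, EM) m) : P.unitTangent m :=
  C.covDeriv (N := M) (fun m => m) ξ m v

/-- The pull back covariant derivative `∇^t` on sections of `tgt^* 𝔎 → X`. -/
abbrev nablaT (C : P.Connection) (η : ∀ x, P.unitTangent (P.top.tgt x)) (x : X)
    (v : TangentSpace 𝓘(ℝ, EX) x) : P.unitTangent (P.top.tgt x) :=
  C.covDeriv P.top.tgt η x v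

/-- A section of `𝔎`, smooth near `m`, whose value at `m` is a given element of `𝔎_m`. -/
def extendLie (C : P.Connection) {m : M} (ξ : P.unitTangent m) (m' : M) : P.unitTangent m' :=
  C.ver (P.top.unit m')
    (FiberBundle.extend EX (E := (TangentSpace 𝓘(ℝ, EX) : X → Type _)) (x := P.top.unit m) ξ
      (P.top.unit m'))

/-- The curvature `ω^𝔎 ∈ Ω²(M, End 𝔎)` of the induced connection on `𝔎`:
`ω^𝔎(U, V) ξ = ∇_U ∇_V ξ - ∇_V ∇_U ξ - ∇_[U, V] ξ`.  The value at `m` depends only on the values of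
`U`, `V`, `ξ` at `m`; given these values we extend them to `U`, `V` with constant coordinates
near `m` and to a section `ξ` of `𝔎`. -/
def curvLie [IsManifold 𝓘(ℝ, EM) ∞ M] (C : P.Connection) (m : M)
    (u v : TangentSpace 𝓘(ℝ, EM) m) (ξ : P.unitTangent m) : P.unitTangent m :=
  C.nabla (fun m' => C.nabla (C.extendLie ξ) m' (FiberBundle.extend EM v m')) m u
    - C.nabla (fun m' => C.nabla (C.extendLie ξ) m' (FiberBundle.extend EM u m')) m v
    - C.nabla (C.extendLie ξ) m
        (VectorField.mlieBracket 𝓘(ℝ, EM) (FiberBundle.extend EM u) (FiberBundle.extend EM v) m)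

/-- The exterior covariant derivative `d^{∇^t} θ` of a 2-form `θ` on `X` with values in `tgt^* 𝔎`,
evaluated on three vector fields at a point. -/
def extCovDeriv (C : P.Connection)
    (θ : ∀ x : X, TangentSpace 𝓘(ℝ, EX) x → TangentSpace 𝓘(ℝ, EX) x →
      P.unitTangent (P.top.tgt x))
    (U V W : ∀ x : X, TangentSpace 𝓘(ℝ, EX) x) (x : X) : P.unitTangent (P.top.tgt x) :=
  C.nablaT (fun y => θ y (V y) (W y)) x (U x)
    - C.nablaT (fun y => θ y (U y) (W y)) x (V x)
    + C.nablaT (fun y => θ y (U y) (V y)) x (W x)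
    - θ x (VectorField.mlieBracket 𝓘(ℝ, EX) U V x) (W x)
    + θ x (VectorField.mlieBracket 𝓘(ℝ, EX) U W x) (V x)
    - θ x (VectorField.mlieBracket 𝓘(ℝ, EX) V W x) (U x)

/-- The graded bracket `[β, θ]` of a 1-form and a 2-form with values in `tgt^* 𝔎`, normalized by
`[β₁ ⊗ a₁, θ₂ ⊗ a₂] = (β₁ ∧ θ₂) ⊗ [a₁, a₂]`. -/
def gradedBracket (P : LieGrpdExt (EX := EX) (EY := EY) (EM := EM) X Y M)
    (β : ∀ x : X, TangentSpace 𝓘(ℝ, EX) x → P.unitTangent (P.top.tgt x))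
    (θ : ∀ x : X, TangentSpace 𝓘(ℝ, EX) x → TangentSpace 𝓘(ℝ, EX) x →
      P.unitTangent (P.top.tgt x))
    (x : X) (u v w : TangentSpace 𝓘(ℝ, EX) x) : P.unitTangent (P.top.tgt x) :=
  P.bracket (P.top.tgt x) (β x u) (θ x v w)
    - P.bracket (P.top.tgt x) (β x v) (θ x u w)
    + P.bracket (P.top.tgt x) (β x w) (θ x u v)

/-- The 3-form `tgt^* ω^𝔎 (β)`: the pairing of the pull back of the `End 𝔎`-valued 2-form `ω^𝔎`
with a 1-form `β` with values in `tgt^* 𝔎`. -/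
def curvPairing [IsManifold 𝓘(ℝ, EM) ∞ M] (C : P.Connection)
    (β : ∀ x : X, TangentSpace 𝓘(ℝ, EX) x → P.unitTangent (P.top.tgt x))
    (x : X) (u v w : TangentSpace 𝓘(ℝ, EX) x) : P.unitTangent (P.top.tgt x) :=
  let T := mfderiv 𝓘(ℝ, EX) 𝓘(ℝ, EM) P.top.tgt x
  C.curvLie (P.top.tgt x) (T u) (T v) (β x w)
    - C.curvLie (P.top.tgt x) (T u) (T w) (β x v)
    + C.curvLie (P.top.tgt x) (T v) (T w) (β x u)

/-- The value at a composable pair `(x₁, x₂)` of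
`∂^▷ θ = ε₀^* θ - ε₁^* θ + Ad_{x₂⁻¹} ε₂^* θ` for a 2-form `θ` on `X` with values in `tgt^* 𝔎`, where
`ε₀(x₁, x₂) = x₂`, `ε₁(x₁, x₂) = x₁ x₂`, `ε₂(x₁, x₂) = x₁`, evaluated on two tangent vectors
`(u₁, u₂)`, `(v₁, v₂)` to the space of composable pairs. -/
def deltaR (P : LieGrpdExt (EX := EX) (EY := EY) (EM := EM) X Y M)
    (θ : ∀ x : X, TangentSpace 𝓘(ℝ, EX) x → TangentSpace 𝓘(ℝ, EX) x →
      P.unitTangent (P.top.tgt x))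
    (x₁ x₂ : X) (u₁ v₁ : TangentSpace 𝓘(ℝ, EX) x₁) (u₂ v₂ : TangentSpace 𝓘(ℝ, EX) x₂) :
    P.unitTangent (P.top.tgt x₂) :=
  let e₀ : P.unitTangent (P.top.tgt x₂) := θ x₂ u₂ v₂
  let e₁ : P.unitTangent (P.top.tgt x₂) :=
    θ (P.top.mul x₁ x₂) (P.top.tmul x₁ x₂ u₁ u₂) (P.top.tmul x₁ x₂ v₁ v₂)
  let e₂ : P.unitTangent (P.top.tgt x₂) := P.Ad (P.top.inv x₂) (θ x₁ u₁ v₁)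
  e₀ - e₁ + e₂

end Connection

end LieGrpdExt

end

set_option linter.unusedSectionVars false

/-! Let A be the projection onto the vertical vectors along `H`, and α the connection form. Products
of composable horizontal vectors are horizontal and products of vertical vectors are vertical, so A
is compatible with the product of the tangent groupoid (`vr_tmL`). Hence α(u · v) = Ad_{y⁻¹} α(u) +
α(v) for u over x and v over y (`fm_tmL`), and vectors tangent to the units are horizontal
(`vr_md_unit`). The rest is calculus with A in charts. Its antisymmetrized derivative dA
(`chartCurvL`) carries both objects of interest. On horizontal vectors, α of it is the curvature ω
(`om`, `curv_eq`). Along the units it is the correction term of the induced connection: symmetry of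
second derivatives for a family k_s of maps into the kernel gives ∇_v η = dη(v) - dA(d(1 ∘ f) v, η)
(`exists_cov`). The curvature of such a connection (`chartRiem`) sees the map f only through the
differential of 1 ∘ f, so one computation (`cov_commutator`) covers both the bundle over `M` and its
pull back by the target.

The first identity rests on α([U, η^▷]) = ∇_U η - ∇_{η^▷} α(U) - [η, α(U)] (`fm_br_lam`), obtained
from the family y ↦ y k_s(y). For horizontal a it reads α([a, η^▷]) = ∇_a η. Together with ω(a, b) =
-α([a, b]) for horizontal a, b this gives ω(a, V) = -α([a, V]) + ∇_a α(V) for every V. On three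
horizontal fields, ∇_c ω(a, b) - ω([a, b], c) = -α([c, [a, b]]), and the signed sum is the Jacobi
identity (`bianchi_horizontal`). On horizontal a, b and vertical ξ^▷, the Jacobi identity produces
[∇_a, ∇_b] ξ - ∇_{[a, b]} ξ (`bianchi_vertical`). Two or more vertical arguments contribute nothing,
as ω kills vertical vectors and brackets of vertical fields are vertical.

For the second identity the tangent vectors are realized by two composable surfaces in `X`. Since A
respects products, dA on the product surface is the product of the values of dA on the factors, and
multiplicativity of α concludes (`om_tmL`).

The product is smooth only on composable pairs, so derivatives within that set are controlled only
on velocities of curves. Identities between them are therefore tested on curves, and smooth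
dependence is obtained from local extensions of the product (`exists_mul_extension`). -/

noncomputable section

/-! ### Differentials, velocities and preferred charts -/

namespace PlainDeriv

section General

variable {E : Type*} [NormedAddCommGroup E] [NormedSpace ℝ E] {H : Type*} [TopologicalSpace H]
  {I : ModelWithCorners ℝ E H} {M : Type*} [TopologicalSpace M] [ChartedSpace H M]
  {E' : Type*} [NormedAddCommGroup E'] [NormedSpace ℝ E'] {H' : Type*} [TopologicalSpace H']
  {I' : ModelWithCorners ℝ E' H'} {M' : Type*} [TopologicalSpace M'] [ChartedSpace H' M']
  {E'' : Type*} [NormedAddCommGroup E''] [NormedSpace ℝ E''] {H'' : Type*} [TopologicalSpace H'']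
  {I'' : ModelWithCorners ℝ E'' H''} {M'' : Type*} [TopologicalSpace M''] [ChartedSpace H'' M'']

/-- The manifold derivative as a continuous linear map between the model vector spaces. -/
def md (I : ModelWithCorners ℝ E H) (I' : ModelWithCorners ℝ E' H') (f : M → M') (x : M) :
    E →L[ℝ] E' :=
  mfderiv I I' f x

/-- The manifold derivative within a set as a continuous linear map between model spaces. -/
def mdWithin (I : ModelWithCorners ℝ E H) (I' : ModelWithCorners ℝ E' H') (f : M → M') (s : Set M)
    (x : M) : E →L[ℝ] E' :=
  mfderivWithin I I' f s x

/-- The velocity of a curve. -/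
def vel (I : ModelWithCorners ℝ E H) (c : ℝ → M) (t : ℝ) : E := md 𝓘(ℝ, ℝ) I c t 1

theorem md_comp {g : M' → M''} {f : M → M'} {x : M} (hg : MDifferentiableAt I' I'' g (f x))
    (hf : MDifferentiableAt I I' f x) :
    md I I'' (fun y => g (f y)) x = (md I' I'' g (f x)).comp (md I I' f x) :=
  mfderiv_comp x hg hf

theorem md_comp_apply {g : M' → M''} {f : M → M'} {x : M} (hg : MDifferentiableAt I' I'' g (f x))
    (hf : MDifferentiableAt I I' f x) (v : E) :
    md I I'' (fun y => g (f y)) x v = md I' I'' g (f x) (md I I' f x v) := by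
  rw [md_comp hg hf]; rfl

theorem vel_comp {g : M → M'} {c : ℝ → M} {t : ℝ} (hg : MDifferentiableAt I I' g (c t))
    (hc : MDifferentiableAt 𝓘(ℝ, ℝ) I c t) :
    vel I' (fun s => g (c s)) t = md I I' g (c t) (vel I c t) :=
  md_comp_apply hg hc 1

theorem md_congr {f g : M → M'} {x : M} (h : f =ᶠ[𝓝 x] g) : md I I' f x = md I I' g x := by
  unfold md
  exact h.mfderiv_eq

theorem vel_congr {c d : ℝ → M} {t : ℝ} (h : c =ᶠ[𝓝 t] d) : vel I c t = vel I d t := by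
  unfold vel; rw [md_congr h]

theorem md_const (y : M') (x : M) : md I I' (fun _ => y) x = 0 := mfderiv_const

theorem vel_const (y : M) (t : ℝ) : vel I (fun _ => y) t = 0 := by
  unfold vel; rw [md_const]; rfl

theorem md_id (x : M) : md I I (fun y => y) x = ContinuousLinearMap.id ℝ E := mfderiv_id

theorem md_prodMk {f : M → M'} {g : M → M''} {x : M} (hf : MDifferentiableAt I I' f x)
    (hg : MDifferentiableAt I I'' g x) :
    md I (I'.prod I'') (fun y => (f y, g y)) x = (md I I' f x).prod (md I I'' g x) :=
  (hf.hasMFDerivAt.prodMk hg.hasMFDerivAt).mfderiv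

theorem vel_prodMk {f : ℝ → M'} {g : ℝ → M''} {x : ℝ} (hf : MDifferentiableAt 𝓘(ℝ, ℝ) I' f x)
    (hg : MDifferentiableAt 𝓘(ℝ, ℝ) I'' g x) :
    vel (I'.prod I'') (fun y => (f y, g y)) x = (vel I' f x, vel I'' g x) := by
  unfold vel
  rw [md_prodMk hf hg]; rfl

/-- The velocity of a curve in a set, transported by a map differentiable within the set. -/
theorem vel_comp_within {g : M → M'} {S : Set M} {c : ℝ → M} {t : ℝ}
    (hg : MDifferentiableWithinAt I I' g S (c t))
    (hc : MDifferentiableAt 𝓘(ℝ, ℝ) I c t) (hS : ∀ᶠ s in 𝓝 t, c s ∈ S) :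
    MDifferentiableAt 𝓘(ℝ, ℝ) I' (fun s => g (c s)) t ∧
    vel I' (fun s => g (c s)) t = mdWithin I I' g S (c t) (vel I c t) := by
  have h1 : HasMFDerivWithinAt 𝓘(ℝ, ℝ) I' (g ∘ c) {s | c s ∈ S} t
      ((mfderivWithin I I' g S (c t)).comp (mfderiv 𝓘(ℝ, ℝ) I c t)) :=
    HasMFDerivWithinAt.comp t hg.hasMFDerivWithinAt hc.hasMFDerivAt.hasMFDerivWithinAt
      (fun s hs => hs)
  -- The preimage of `S` under the curve is a neighbourhood of `t`, so the derivative within it is a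
  -- full derivative. No unique differentiability of `S` is needed.
  have h2 := h1.hasMFDerivAt hS
  refine ⟨h2.mdifferentiableAt, ?_⟩
  have h3 := h2.mfderiv
  unfold vel md
  change (mfderiv 𝓘(ℝ, ℝ) I' (g ∘ c) t) (1 : ℝ) = _
  rw [h3]; rfl

end General

section Vector

variable {E : Type*} [NormedAddCommGroup E] [NormedSpace ℝ E] {H : Type*} [TopologicalSpace H]
  {I : ModelWithCorners ℝ E H} {M : Type*} [TopologicalSpace M] [ChartedSpace H M]
  {F : Type*} [NormedAddCommGroup F] [NormedSpace ℝ F]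
  {F' : Type*} [NormedAddCommGroup F'] [NormedSpace ℝ F']

theorem md_eq_fderiv (f : F → F') (x : F) : md 𝓘(ℝ, F) 𝓘(ℝ, F') f x = fderiv ℝ f x :=
  mfderiv_eq_fderiv

theorem vel_eq_deriv (c : ℝ → F) (t : ℝ) : vel 𝓘(ℝ, F) c t = deriv c t := by
  unfold vel; rw [md_eq_fderiv]; simp

theorem hasDerivAt_vel {c : ℝ → F} {t : ℝ} (h : MDifferentiableAt 𝓘(ℝ, ℝ) 𝓘(ℝ, F) c t) :
    HasDerivAt c (vel 𝓘(ℝ, F) c t) t := by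
  rw [vel_eq_deriv]
  exact (mdifferentiableAt_iff_differentiableAt.1 h).hasDerivAt

/-- The derivative of a vector valued function along a curve. -/
theorem hasDerivAt_comp_curve {φ : M → F} {c : ℝ → M} {t : ℝ}
    (hφ : MDifferentiableAt I 𝓘(ℝ, F) φ (c t)) (hc : MDifferentiableAt 𝓘(ℝ, ℝ) I c t) :
    HasDerivAt (fun s => φ (c s)) (md I 𝓘(ℝ, F) φ (c t) (vel I c t)) t := by
  rw [← vel_comp hφ hc]
  exact hasDerivAt_vel (hφ.comp t hc)

end Vector

section Chart

variable {E : Type*} [NormedAddCommGroup E] [NormedSpace ℝ E]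
  {N : Type*} [TopologicalSpace N] [ChartedSpace E N] [IsManifold 𝓘(ℝ, E) ∞ N]

/-- The differential at `y` of the preferred chart at `p`. -/
def tc (E : Type*) [NormedAddCommGroup E] [NormedSpace ℝ E]
    {N : Type*} [TopologicalSpace N] [ChartedSpace E N] (p y : N) : E →L[ℝ] E :=
  md 𝓘(ℝ, E) 𝓘(ℝ, E) (extChartAt 𝓘(ℝ, E) p) y

/-- The inverse of the differential at `y` of the preferred chart at `p`. -/
def tcInv (E : Type*) [NormedAddCommGroup E] [NormedSpace ℝ E]
    {N : Type*} [TopologicalSpace N] [ChartedSpace E N] (p y : N) : E →L[ℝ] E :=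
  md 𝓘(ℝ, E) 𝓘(ℝ, E) (extChartAt 𝓘(ℝ, E) p).symm (extChartAt 𝓘(ℝ, E) p y)

/-- Tangent vectors at `p` are recorded in the preferred chart at `p` itself. A vector therefore
equals its own coordinates as soon as the chart is centred at its base point. -/
theorem tc_self (p : N) : tc E p p = ContinuousLinearMap.id ℝ E :=
  mfderiv_extChartAt_self

theorem mdifferentiableAt_chart {p y : N} (h : y ∈ (extChartAt 𝓘(ℝ, E) p).source) :
    MDifferentiableAt 𝓘(ℝ, E) 𝓘(ℝ, E) (extChartAt 𝓘(ℝ, E) p) y :=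
  mdifferentiableAt_extChartAt (by simpa using h)

theorem contMDiffAt_chart {p y : N} (h : y ∈ (extChartAt 𝓘(ℝ, E) p).source) :
    ContMDiffAt 𝓘(ℝ, E) 𝓘(ℝ, E) ∞ (extChartAt 𝓘(ℝ, E) p) y :=
  contMDiffAt_extChartAt' (by simpa using h)

theorem contMDiffAt_chart_symm {p : N} {z : E} (h : z ∈ (extChartAt 𝓘(ℝ, E) p).target) :
    ContMDiffAt 𝓘(ℝ, E) 𝓘(ℝ, E) ∞ (extChartAt 𝓘(ℝ, E) p).symm z :=
  (contMDiffOn_extChartAt_symm p).contMDiffAt ((isOpen_extChartAt_target p).mem_nhds h)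

theorem tc_comp_tcInv {p y : N} (h : y ∈ (extChartAt 𝓘(ℝ, E) p).source) :
    (tc E p y).comp (tcInv E p y) = ContinuousLinearMap.id ℝ E := by
  have hz := (extChartAt 𝓘(ℝ, E) p).map_source h
  have h1 := md_comp (I := 𝓘(ℝ, E)) (I' := 𝓘(ℝ, E)) (I'' := 𝓘(ℝ, E))
    (g := extChartAt 𝓘(ℝ, E) p) (f := (extChartAt 𝓘(ℝ, E) p).symm)
    (x := extChartAt 𝓘(ℝ, E) p y) (by
      rw [(extChartAt 𝓘(ℝ, E) p).left_inv h]; exact mdifferentiableAt_chart h)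
    ((contMDiffAt_chart_symm hz).mdifferentiableAt (by simp))
  rw [(extChartAt 𝓘(ℝ, E) p).left_inv h] at h1
  unfold tc tcInv
  rw [← h1, ← md_id (I := 𝓘(ℝ, E)) (extChartAt 𝓘(ℝ, E) p y)]
  apply md_congr
  filter_upwards [(isOpen_extChartAt_target p).mem_nhds hz] with w hw
  exact (extChartAt 𝓘(ℝ, E) p).right_inv hw

theorem tcInv_comp_tc {p y : N} (h : y ∈ (extChartAt 𝓘(ℝ, E) p).source) :
    (tcInv E p y).comp (tc E p y) = ContinuousLinearMap.id ℝ E := by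
  have hz := (extChartAt 𝓘(ℝ, E) p).map_source h
  have h1 := md_comp (I := 𝓘(ℝ, E)) (I' := 𝓘(ℝ, E)) (I'' := 𝓘(ℝ, E))
    (f := extChartAt 𝓘(ℝ, E) p) (g := (extChartAt 𝓘(ℝ, E) p).symm) (x := y)
    ((contMDiffAt_chart_symm hz).mdifferentiableAt (by simp)) (mdifferentiableAt_chart h)
  unfold tc tcInv
  rw [← h1, ← md_id (I := 𝓘(ℝ, E)) y]
  apply md_congr
  filter_upwards [(isOpen_extChartAt_source p).mem_nhds h] with w hw
  exact (extChartAt 𝓘(ℝ, E) p).left_inv hw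

theorem tc_tcInv {p y : N} (h : y ∈ (extChartAt 𝓘(ℝ, E) p).source) (v : E) :
    tc E p y (tcInv E p y v) = v :=
  DFunLike.congr_fun (tc_comp_tcInv h) v

theorem tcInv_tc {p y : N} (h : y ∈ (extChartAt 𝓘(ℝ, E) p).source) (v : E) :
    tcInv E p y (tc E p y v) = v :=
  DFunLike.congr_fun (tcInv_comp_tc h) v

theorem tc_injective {p y : N} (h : y ∈ (extChartAt 𝓘(ℝ, E) p).source) {v w : E}
    (hvw : tc E p y v = tc E p y w) : v = w := by
  rw [← tcInv_tc h v, hvw, tcInv_tc h]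

theorem deriv_chart_comp {p : N} {c : ℝ → N} {t : ℝ}
    (h : c t ∈ (extChartAt 𝓘(ℝ, E) p).source) (hc : MDifferentiableAt 𝓘(ℝ, ℝ) 𝓘(ℝ, E) c t) :
    HasDerivAt (fun s => extChartAt 𝓘(ℝ, E) p (c s)) (tc E p (c t) (vel 𝓘(ℝ, E) c t)) t :=
  hasDerivAt_comp_curve (mdifferentiableAt_chart h) hc

/-- Every tangent vector is the velocity of a smooth curve. -/
theorem exists_curve (n : N) (v : E) :
    ∃ c : ℝ → N, ContMDiffAt 𝓘(ℝ, ℝ) 𝓘(ℝ, E) ∞ c 0 ∧ c 0 = n ∧ vel 𝓘(ℝ, E) c 0 = v := by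
  set e := extChartAt 𝓘(ℝ, E) n
  have h0 : e.symm (e n + (0 : ℝ) • v) = n := by simp [e]
  have hl : ContMDiffAt 𝓘(ℝ, ℝ) 𝓘(ℝ, E) ∞ (fun t : ℝ => e n + t • v) 0 := by
    apply ContDiffAt.contMDiffAt; fun_prop
  have hs : ContMDiffAt 𝓘(ℝ, E) 𝓘(ℝ, E) ∞ e.symm (e n + (0 : ℝ) • v) := by
    apply contMDiffAt_chart_symm; simp [e]
  refine ⟨fun t => e.symm (e n + t • v), hs.comp (0 : ℝ) hl, h0, ?_⟩
  have h1 := deriv_chart_comp (E := E) (p := n) (c := fun t : ℝ => e.symm (e n + t • v)) (t := 0)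
    (by rw [h0]; simp) ((hs.comp (0 : ℝ) hl).mdifferentiableAt (by simp))
  rw [h0, tc_self] at h1
  have h2 : HasDerivAt (fun t : ℝ => e n + t • v) v 0 := by
    simpa using ((hasDerivAt_id (0 : ℝ)).smul_const v).const_add (e n)
  refine h1.unique (h2.congr_of_eventuallyEq ?_)
  have : ∀ᶠ t in 𝓝 (0 : ℝ), e n + t • v ∈ e.target := by
    apply hl.continuousAt.eventually
    exact (isOpen_extChartAt_target n).mem_nhds (by simp [e])
  filter_upwards [this] with t ht
  exact e.right_inv ht

end Chart

end PlainDeriv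

/-! ### Smooth vector fields along maps -/

namespace PlainDeriv

section Along

variable {E₀ : Type*} [NormedAddCommGroup E₀] [NormedSpace ℝ E₀]
  {H₀ : Type*} [TopologicalSpace H₀] {I₀ : ModelWithCorners ℝ E₀ H₀}
  {N : Type*} [TopologicalSpace N] [ChartedSpace H₀ N]
  {E₁ : Type*} [NormedAddCommGroup E₁] [NormedSpace ℝ E₁]
  {H₁ : Type*} [TopologicalSpace H₁] {I₁ : ModelWithCorners ℝ E₁ H₁}
  {N₁ : Type*} [TopologicalSpace N₁] [ChartedSpace H₁ N₁]
  {E : Type*} [NormedAddCommGroup E] [NormedSpace ℝ E]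
  {X : Type*} [TopologicalSpace X] [ChartedSpace E X] [IsManifold 𝓘(ℝ, E) ∞ X]
  {E' : Type*} [NormedAddCommGroup E'] [NormedSpace ℝ E']
  {X' : Type*} [TopologicalSpace X'] [ChartedSpace E' X'] [IsManifold 𝓘(ℝ, E') ∞ X']

/-- `w` is a vector field along the map `b`, smooth at the point `n`. -/
def SmoothAlong (I₀ : ModelWithCorners ℝ E₀ H₀) (b : N → X) (w : N → E) (n : N) : Prop :=
  ContMDiffAt I₀ 𝓘(ℝ, E).tangent ∞ (fun y => (⟨b y, w y⟩ : TangentBundle 𝓘(ℝ, E) X)) n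

omit [IsManifold 𝓘(ℝ, E) ∞ X] in
theorem trivialization_snd [IsManifold 𝓘(ℝ, E) 1 X] {p y : X} (hy : y ∈ (chartAt E p).source)
    (v : TangentSpace 𝓘(ℝ, E) y) :
    (trivializationAt E (TangentSpace 𝓘(ℝ, E) : X → Type _) p
      (⟨y, v⟩ : TangentBundle 𝓘(ℝ, E) X)).2 = tc E p y v := by
  have h3 := congrArg (fun L : TangentSpace 𝓘(ℝ, E) y →L[ℝ] E => L v)
    (TangentBundle.continuousLinearMapAt_trivializationAt (I := 𝓘(ℝ, E)) hy)
  refine Eq.trans ?_ h3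
  rw [Trivialization.continuousLinearMapAt_apply, Trivialization.linearMapAt_apply, if_pos]
  simpa using hy

/-- The fibre coordinate of the trivialization of the tangent bundle at `p` is `tc E p`. Allowing
any `p` whose chart contains `b n` lets one fixed chart serve all nearby points. -/
theorem smoothAlong_iff {b : N → X} {w : N → E} {n : N} {p : X}
    (h : b n ∈ (extChartAt 𝓘(ℝ, E) p).source) :
    SmoothAlong I₀ b w n ↔ ContMDiffAt I₀ 𝓘(ℝ, E) ∞ b n ∧
      ContMDiffAt I₀ 𝓘(ℝ, E) ∞ (fun y => tc E p (b y) (w y)) n := by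
  have hs : b n ∈ (chartAt E p).source := by simpa using h
  have hb : (⟨b n, w n⟩ : TangentBundle 𝓘(ℝ, E) X) ∈
      (trivializationAt E (TangentSpace 𝓘(ℝ, E) : X → Type _) p).source := by
    rw [Trivialization.mem_source]; simpa using hs
  refine Iff.trans (Trivialization.contMDiffAt_iff
    (f := fun y => (⟨b y, w y⟩ : TangentBundle 𝓘(ℝ, E) X)) hb) ?_
  refine and_congr_right fun h1 => ?_
  have h1' : ContMDiffAt I₀ 𝓘(ℝ, E) ∞ b n := h1
  refine Filter.EventuallyEq.contMDiffAt_iff ?_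
  filter_upwards [h1'.continuousAt.eventually ((chartAt E p).open_source.mem_nhds hs)] with y hy
  exact trivialization_snd hy (w y)

theorem SmoothAlong.base {b : N → X} {w : N → E} {n : N} (h : SmoothAlong I₀ b w n) :
    ContMDiffAt I₀ 𝓘(ℝ, E) ∞ b n :=
  ((smoothAlong_iff (p := b n) (by simp)).1 h).1

theorem SmoothAlong.fiber {b : N → X} {w : N → E} {n : N} (h : SmoothAlong I₀ b w n) {p : X}
    (hp : b n ∈ (extChartAt 𝓘(ℝ, E) p).source) :
    ContMDiffAt I₀ 𝓘(ℝ, E) ∞ (fun y => tc E p (b y) (w y)) n :=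
  ((smoothAlong_iff hp).1 h).2

theorem SmoothAlong.congr {b b' : N → X} {w w' : N → E} {n : N} (h : SmoothAlong I₀ b w n)
    (hb : ∀ᶠ y in 𝓝 n, b y = b' y) (hw : ∀ᶠ y in 𝓝 n, w y = w' y) : SmoothAlong I₀ b' w' n := by
  refine ContMDiffAt.congr_of_eventuallyEq h ?_
  filter_upwards [hb, hw] with y h1 h2
  rw [h1, h2]

theorem SmoothAlong.comp {b : N → X} {w : N → E} {g : N₁ → N} {n : N₁}
    (h : SmoothAlong I₀ b w (g n)) (hg : ContMDiffAt I₁ I₀ ∞ g n) :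
    SmoothAlong I₁ (fun y => b (g y)) (fun y => w (g y)) n :=
  ContMDiffAt.comp n h hg

theorem SmoothAlong.add {b : N → X} {w w' : N → E} {n : N} (h : SmoothAlong I₀ b w n)
    (h' : SmoothAlong I₀ b w' n) : SmoothAlong I₀ b (fun y => w y + w' y) n := by
  rw [smoothAlong_iff (p := b n) (by simp)]
  refine ⟨h.base, ?_⟩
  simp only [map_add]
  exact (h.fiber (by simp)).add (h'.fiber (by simp))

theorem SmoothAlong.neg {b : N → X} {w : N → E} {n : N} (h : SmoothAlong I₀ b w n) :
    SmoothAlong I₀ b (fun y => -w y) n := by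
  rw [smoothAlong_iff (p := b n) (by simp)]
  refine ⟨h.base, ?_⟩
  simp only [map_neg]
  exact (h.fiber (by simp)).neg

theorem SmoothAlong.sub {b : N → X} {w w' : N → E} {n : N} (h : SmoothAlong I₀ b w n)
    (h' : SmoothAlong I₀ b w' n) : SmoothAlong I₀ b (fun y => w y - w' y) n := by
  simpa only [sub_eq_add_neg] using h.add h'.neg

/-- The differential of a family of maps, in charts. -/
theorem exists_md_coordinates [IsManifold I₀ 1 N] {f : N → X → X'} {c : N → X} {n : N}
    (hf : ContMDiffAt (I₀.prod 𝓘(ℝ, E)) 𝓘(ℝ, E') ∞ (Function.uncurry f) (n, c n))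
    (hc : ContMDiffAt I₀ 𝓘(ℝ, E) ∞ c n) :
    ∃ T : N → E →L[ℝ] E', ContMDiffAt I₀ 𝓘(ℝ, E →L[ℝ] E') ∞ T n ∧
      T n = md 𝓘(ℝ, E) 𝓘(ℝ, E') (f n) (c n) ∧
      ∀ᶠ y in 𝓝 n, ∀ w : E, tc E' (f n (c n)) (f y (c y)) (md 𝓘(ℝ, E) 𝓘(ℝ, E') (f y) (c y) w)
        = T y (tc E (c n) (c y) w) := by
  have h := ContMDiffAt.mfderiv (m := ∞) f c hf hc (by simp)
  have hfc : ContinuousAt (fun y => f y (c y)) n :=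
    (ContMDiffAt.comp (g := Function.uncurry f) (f := fun y => (y, c y)) n hf
      (contMDiffAt_id.prodMk hc)).continuousAt
  have key : ∀ᶠ y in 𝓝 n,
      (inTangentCoordinates 𝓘(ℝ, E) 𝓘(ℝ, E') c (fun x => f x (c x))
        (fun x => mfderiv 𝓘(ℝ, E) 𝓘(ℝ, E') (f x) (c x)) n y : E →L[ℝ] E')
      = (tc E' (f n (c n)) (f y (c y))).comp
        ((md 𝓘(ℝ, E) 𝓘(ℝ, E') (f y) (c y)).comp (tcInv E (c n) (c y))) := by
    filter_upwards [hc.continuousAt.eventually (chart_source_mem_nhds E (c n)),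
      hfc.eventually (chart_source_mem_nhds E' (f n (c n)))] with y h1 h2
    have h3 := inTangentCoordinates_eq_mfderiv_comp (I := 𝓘(ℝ, E)) (I' := 𝓘(ℝ, E'))
      (f := c) (g := fun x => f x (c x))
      (ϕ := fun x => mfderiv 𝓘(ℝ, E) 𝓘(ℝ, E') (f x) (c x)) h1 h2
    rw [h3]
    simp only [modelWithCornersSelf_coe, range_id, mfderivWithin_univ]
    rfl
  refine ⟨_, h, ?_, ?_⟩
  · rw [key.self_of_nhds, tc_self]
    have h4 := tcInv_comp_tc (E := E) (p := c n) (y := c n) (by simp)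
    rw [tc_self] at h4
    ext v
    have h5 := DFunLike.congr_fun h4 v
    simp only [ContinuousLinearMap.comp_apply, ContinuousLinearMap.id_apply] at h5 ⊢
    rw [h5]
  · filter_upwards [key, hc.continuousAt.eventually (chart_source_mem_nhds E (c n))] with y hy h1 w
    rw [hy]
    simp only [ContinuousLinearMap.comp_apply]
    rw [tcInv_tc (by rw [extChartAt_source]; exact h1)]

/-- The differential of a smooth family of maps carries smooth fields along a map to such fields. -/
theorem SmoothAlong.md_apply [IsManifold I₀ 1 N] {f : N → X → X'} {c : N → X} {w : N → E} {n : N}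
    (hf : ContMDiffAt (I₀.prod 𝓘(ℝ, E)) 𝓘(ℝ, E') ∞ (Function.uncurry f) (n, c n))
    (hw : SmoothAlong I₀ c w n) :
    SmoothAlong I₀ (fun y => f y (c y)) (fun y => md 𝓘(ℝ, E) 𝓘(ℝ, E') (f y) (c y) (w y)) n := by
  obtain ⟨T, hT, -, hTe⟩ := exists_md_coordinates hf hw.base
  rw [smoothAlong_iff (p := f n (c n)) (by simp)]
  refine ⟨ContMDiffAt.comp (g := Function.uncurry f) (f := fun y => (y, c y)) n hf
    (contMDiffAt_id.prodMk hw.base), ?_⟩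
  refine (hT.clm_apply (hw.fiber (p := c n) (by simp))).congr_of_eventuallyEq ?_
  filter_upwards [hTe] with y hy
  exact hy (w y)

/-- The differential, in charts, of the image of a vector field along a curve that vanishes at
the initial time. -/
theorem hasDerivAt_md_of_vanishing {f : ℝ → X → X'} {c : ℝ → X} {w : ℝ → E} {w' : E}
    (hf : ContMDiffAt (𝓘(ℝ, ℝ).prod 𝓘(ℝ, E)) 𝓘(ℝ, E') ∞ (Function.uncurry f) (0, c 0))
    (hc : ContMDiffAt 𝓘(ℝ, ℝ) 𝓘(ℝ, E) ∞ c 0) (hw0 : w 0 = 0)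
    (hw : HasDerivAt (fun s => tc E (c 0) (c s) (w s)) w' 0) :
    HasDerivAt (fun s => tc E' (f 0 (c 0)) (f s (c s)) (md 𝓘(ℝ, E) 𝓘(ℝ, E') (f s) (c s) (w s)))
      (md 𝓘(ℝ, E) 𝓘(ℝ, E') (f 0) (c 0) w') 0 := by
  obtain ⟨T, hT, hT0, hTe⟩ := exists_md_coordinates hf hc
  have hT1 : HasDerivAt T (deriv T 0) 0 :=
    (hT.contDiffAt.differentiableAt (by simp)).hasDerivAt
  have h := hT1.clm_apply hw
  -- The derivative of the operators `T s` is applied to `w 0 = 0` and drops out. This is why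
  -- derivatives of vector fields at a zero transform linearly, independently of charts.
  rw [hw0, map_zero, map_zero, zero_add, hT0] at h
  refine h.congr_of_eventuallyEq ?_
  filter_upwards [hTe] with s hs
  exact hs (w s)

end Along

end PlainDeriv

/-! ### Submersions, Lie brackets and mixed second derivatives -/

namespace PlainDeriv

theorem two_le_infty : (2 : WithTop ℕ∞) ≤ ∞ := by
  have : ((2 : ℕ∞) : WithTop ℕ∞) ≤ ((⊤ : ℕ∞) : WithTop ℕ∞) := WithTop.coe_le_coe.2 le_top
  exact this

section Submersion

variable {E : Type*} [NormedAddCommGroup E] [NormedSpace ℝ E]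
  {X : Type*} [TopologicalSpace X] [ChartedSpace E X]
  {E' : Type*} [NormedAddCommGroup E'] [NormedSpace ℝ E']
  {B : Type*} [TopologicalSpace B] [ChartedSpace E' B]

/-- Near a point `x`, a submersion `f` admits a smooth map `ρ` that moves a point `x'` into the
fibre over a given `b`, and fixes the points that lie in this fibre already. -/
theorem exists_fibre_retraction {f : X → B} (hf : IsSubmersion 𝓘(ℝ, E) 𝓘(ℝ, E') ∞ f) (x : X) :
    ∃ ρ : B × X → X, ContMDiffAt (𝓘(ℝ, E').prod 𝓘(ℝ, E)) 𝓘(ℝ, E) ∞ ρ (f x, x) ∧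
      (∀ᶠ q in 𝓝 (f x, x), f (ρ q) = q.1) ∧ ∀ᶠ x' in 𝓝 x, ρ (f x', x') = x' := by
  have h := hf.isSubmersionAt x
  set φ := h.domChart
  set ψ := h.codChart
  have hφ := h.domChart_mem_maximalAtlas
  have hψ := h.codChart_mem_maximalAtlas
  have hx : x ∈ φ.source := h.mem_domChart_source
  have hfx : f x ∈ ψ.source := h.mem_codChart_source
  have hw : ∀ z ∈ φ.target, ψ (f (φ.symm z)) = (h.equiv z).1 := by
    intro z hz
    have := h.writtenInCharts
      (show z ∈ (h.domChart.extend 𝓘(ℝ, E)).target by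
        rw [OpenPartialHomeomorph.extend_target]; simpa using hz)
    simpa using this
  have hw' : ∀ x' ∈ φ.source, ψ (f x') = (h.equiv (φ x')).1 := by
    intro x' hx'
    have := hw (φ x') (φ.map_source hx')
    rwa [φ.left_inv hx'] at this
  -- In submersion charts `f` is the first projection. The fibre coordinates of the point are kept
  -- and its base coordinates are replaced by those of the prescribed base point.
  let r : B × X → E := fun q => h.equiv.symm (ψ q.1, (h.equiv (φ q.2)).2)
  have hr0 : ∀ x' ∈ φ.source, r (f x', x') = φ x' := by
    intro x' hx'
    simp only [r]
    rw [hw' x' hx']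
    simp
  have hr : ContMDiffAt (𝓘(ℝ, E').prod 𝓘(ℝ, E)) 𝓘(ℝ, E) ∞ r (f x, x) := by
    have h1 : ContMDiffAt (𝓘(ℝ, E').prod 𝓘(ℝ, E)) 𝓘(ℝ, E') ∞ (fun q : B × X => ψ q.1) (f x, x) :=
      ContMDiffAt.comp (f x, x) (contMDiffAt_of_mem_maximalAtlas hψ hfx) contMDiffAt_fst
    have h2 : ContMDiffAt (𝓘(ℝ, E').prod 𝓘(ℝ, E)) 𝓘(ℝ, E) ∞ (fun q : B × X => φ q.2) (f x, x) :=
      ContMDiffAt.comp (f x, x) (contMDiffAt_of_mem_maximalAtlas hφ hx) contMDiffAt_snd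
    have h3 : ContDiff ℝ ∞ (fun z : E' × E => h.equiv.symm (z.1, (h.equiv z.2).2)) := by
      fun_prop
    exact h3.contMDiff.contMDiffAt.comp (f x, x) (h1.prodMk_space h2)
  have hrt : r (f x, x) ∈ φ.target := by rw [hr0 x hx]; exact φ.map_source hx
  refine ⟨fun q => φ.symm (r q), ?_, ?_, ?_⟩
  · exact ContMDiffAt.comp (f x, x) (contMDiffAt_symm_of_mem_maximalAtlas hφ hrt) hr
  · filter_upwards [hr.continuousAt.eventually (φ.open_target.mem_nhds hrt),
      continuousAt_fst.eventually (ψ.open_source.mem_nhds hfx)] with q hq hq1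
    have h1 : f (φ.symm (r q)) ∈ ψ.source := h.source_subset_preimage_source (φ.map_target hq)
    refine ψ.injOn h1 hq1 ?_
    rw [hw _ hq]
    simp [r]
  · filter_upwards [φ.open_source.mem_nhds hx] with x' hx'
    rw [hr0 x' hx', φ.left_inv hx']

end Submersion

section Functions

variable {E : Type*} [NormedAddCommGroup E] [NormedSpace ℝ E]
  {N : Type*} [TopologicalSpace N] [ChartedSpace E N] [IsManifold 𝓘(ℝ, E) ∞ N]
  {F : Type*} [NormedAddCommGroup F] [NormedSpace ℝ F]

theorem contDiffAt_comp_chart_symm {φ : N → F} {p y : N}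
    (hy : y ∈ (extChartAt 𝓘(ℝ, E) p).source) (hφ : ContMDiffAt 𝓘(ℝ, E) 𝓘(ℝ, F) ∞ φ y) :
    ContDiffAt ℝ ∞ (fun z => φ ((extChartAt 𝓘(ℝ, E) p).symm z)) (extChartAt 𝓘(ℝ, E) p y) := by
  rw [← contMDiffAt_iff_contDiffAt]
  refine ContMDiffAt.comp (g := φ) _ ?_
    (contMDiffAt_chart_symm ((extChartAt 𝓘(ℝ, E) p).map_source hy))
  rwa [(extChartAt 𝓘(ℝ, E) p).left_inv hy]

theorem md_eq_fderiv_chart {φ : N → F} {p y : N}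
    (hy : y ∈ (extChartAt 𝓘(ℝ, E) p).source) (hφ : MDifferentiableAt 𝓘(ℝ, E) 𝓘(ℝ, F) φ y) (v : E) :
    md 𝓘(ℝ, E) 𝓘(ℝ, F) φ y v =
      fderiv ℝ (fun z => φ ((extChartAt 𝓘(ℝ, E) p).symm z)) (extChartAt 𝓘(ℝ, E) p y)
        (tc E p y v) := by
  rw [← md_eq_fderiv]
  have hz := (extChartAt 𝓘(ℝ, E) p).map_source hy
  have hl := (extChartAt 𝓘(ℝ, E) p).left_inv hy
  have h1 := md_comp_apply (I := 𝓘(ℝ, E)) (I' := 𝓘(ℝ, E)) (I'' := 𝓘(ℝ, F)) (g := φ)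
    (f := (extChartAt 𝓘(ℝ, E) p).symm) (x := extChartAt 𝓘(ℝ, E) p y) (by rwa [hl])
    ((contMDiffAt_chart_symm hz).mdifferentiableAt (by simp)) (tc E p y v)
  rw [h1, hl]
  exact congrArg _ (tcInv_tc hy v).symm

/-- The Lie bracket of vector fields, as a map between model vector spaces. -/
def br (U V : N → E) (n : N) : E :=
  VectorField.mlieBracket 𝓘(ℝ, E) (fun y => (U y : TangentSpace 𝓘(ℝ, E) y))
    (fun y => (V y : TangentSpace 𝓘(ℝ, E) y)) n

omit [IsManifold 𝓘(ℝ, E) ∞ N] in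
theorem br_swap (U V : N → E) (n : N) : br U V n = -br V U n :=
  VectorField.mlieBracket_swap_apply

/-- In the chart centred at `n` the bracket is the commutator of coordinate derivatives, and no
final conversion of the result is needed because the differential of that chart at `n` is the
identity. -/
theorem br_eq {U V : N → E} {n : N}
    (hU : SmoothAlong 𝓘(ℝ, E) (fun y => y) U n) (hV : SmoothAlong 𝓘(ℝ, E) (fun y => y) V n) :
    br U V n = md 𝓘(ℝ, E) 𝓘(ℝ, E) (fun y => tc E n y (V y)) n (U n)
      - md 𝓘(ℝ, E) 𝓘(ℝ, E) (fun y => tc E n y (U y)) n (V n) := by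
  -- Pulling a field back by the inverse chart applies the inverse of `tcInv`, which is `tc`.
  have key : ∀ W : N → E, ∀ᶠ z in 𝓝 (extChartAt 𝓘(ℝ, E) n n),
      (VectorField.mpullbackWithin 𝓘(ℝ, E) 𝓘(ℝ, E) (extChartAt 𝓘(ℝ, E) n).symm
        (fun y => (W y : TangentSpace 𝓘(ℝ, E) y)) (range 𝓘(ℝ, E)) z : E) =
      tc E n ((extChartAt 𝓘(ℝ, E) n).symm z) (W ((extChartAt 𝓘(ℝ, E) n).symm z)) := by
    intro W
    filter_upwards [extChartAt_target_mem_nhds (I := 𝓘(ℝ, E)) n] with z hz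
    have hs := (extChartAt 𝓘(ℝ, E) n).map_target hz
    have hr := (extChartAt 𝓘(ℝ, E) n).right_inv hz
    have h1 := tc_comp_tcInv hs
    have h2 := tcInv_comp_tc hs
    have h3 : ContinuousLinearMap.inverse (tcInv E n ((extChartAt 𝓘(ℝ, E) n).symm z)) =
        tc E n ((extChartAt 𝓘(ℝ, E) n).symm z) := ContinuousLinearMap.inverse_eq h2 h1
    have h4 : ContinuousLinearMap.inverse (tcInv E n ((extChartAt 𝓘(ℝ, E) n).symm z))
        (W ((extChartAt 𝓘(ℝ, E) n).symm z)) =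
        tc E n ((extChartAt 𝓘(ℝ, E) n).symm z) (W ((extChartAt 𝓘(ℝ, E) n).symm z)) := by rw [h3]
    refine Eq.trans ?_ h4
    refine (VectorField.mpullbackWithin_apply (I := 𝓘(ℝ, E)) (I' := 𝓘(ℝ, E))
      (V := fun y => (W y : TangentSpace 𝓘(ℝ, E) y))).trans ?_
    simp only [modelWithCornersSelf_coe, range_id, mfderivWithin_univ]
    unfold tcInv md
    rw [hr]
    rfl
  have hin : extChartAt 𝓘(ℝ, E) n n ∈ (extChartAt 𝓘(ℝ, E) n).target := mem_extChartAt_target n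
  have hsym : (extChartAt 𝓘(ℝ, E) n).symm (extChartAt 𝓘(ℝ, E) n n) = n := by simp
  unfold br VectorField.mlieBracket
  refine (VectorField.mlieBracketWithin_apply (I := 𝓘(ℝ, E))
    (V := fun y => (U y : TangentSpace 𝓘(ℝ, E) y))
    (W := fun y => (V y : TangentSpace 𝓘(ℝ, E) y))).trans ?_
  rw [mfderiv_extChartAt_self]
  have h1 : ∀ z : E, ContinuousLinearMap.inverse (ContinuousLinearMap.id ℝ E) z = z := by
    intro z; rw [ContinuousLinearMap.inverse_id]; rfl
  refine (h1 _).trans ?_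
  simp only [modelWithCornersSelf_coe, range_id, preimage_univ, inter_univ]
  set A : E → E := VectorField.mpullbackWithin 𝓘(ℝ, E) 𝓘(ℝ, E)
    (extChartAt 𝓘(ℝ, E) n).symm (fun y => (U y : TangentSpace 𝓘(ℝ, E) y)) univ
  set B : E → E := VectorField.mpullbackWithin 𝓘(ℝ, E) 𝓘(ℝ, E)
    (extChartAt 𝓘(ℝ, E) n).symm (fun y => (V y : TangentSpace 𝓘(ℝ, E) y)) univ
  have hA := key U
  have hB := key V
  simp only [modelWithCornersSelf_coe, range_id] at hA hB
  change A =ᶠ[_] _ at hA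
  change B =ᶠ[_] _ at hB
  change fderivWithin ℝ B univ (extChartAt 𝓘(ℝ, E) n n) (A (extChartAt 𝓘(ℝ, E) n n)) -
    fderivWithin ℝ A univ (extChartAt 𝓘(ℝ, E) n n) (B (extChartAt 𝓘(ℝ, E) n n)) = _
  rw [fderivWithin_univ, fderivWithin_univ, hA.fderiv_eq, hB.fderiv_eq, hA.eq_of_nhds,
    hB.eq_of_nhds, hsym,
    md_eq_fderiv_chart (p := n) (by simp) ((hU.fiber (by simp)).mdifferentiableAt (by simp)),
    md_eq_fderiv_chart (p := n) (by simp) ((hV.fiber (by simp)).mdifferentiableAt (by simp))]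

/-- The derivative of a function along a smooth vector field is smooth. -/
theorem contMDiffAt_md_apply {φ : N → F} {h : N → E} {n : N}
    (hφ : ∀ᶠ y in 𝓝 n, ContMDiffAt 𝓘(ℝ, E) 𝓘(ℝ, F) ∞ φ y)
    (hh : SmoothAlong 𝓘(ℝ, E) (fun y => y) h n) :
    ContMDiffAt 𝓘(ℝ, E) 𝓘(ℝ, F) ∞ (fun y => md 𝓘(ℝ, E) 𝓘(ℝ, F) φ y (h y)) n := by
  have hh' := hh.fiber (p := n) (by simp)
  have h1 := contDiffAt_comp_chart_symm (p := n) (y := n) (by simp) hφ.self_of_nhds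
  have h2 : ContDiffAt ℝ ∞ (fderiv ℝ (fun z => φ ((extChartAt 𝓘(ℝ, E) n).symm z)))
    (extChartAt 𝓘(ℝ, E) n n) := h1.fderiv_right (by simp)
  have h3 : ContMDiffAt 𝓘(ℝ, E) 𝓘(ℝ, E →L[ℝ] F) ∞ (fun y =>
      fderiv ℝ (fun z => φ ((extChartAt 𝓘(ℝ, E) n).symm z)) (extChartAt 𝓘(ℝ, E) n y)) n :=
    ContMDiffAt.comp n h2.contMDiffAt (contMDiffAt_chart (by simp))
  refine (h3.clm_apply hh').congr_of_eventuallyEq ?_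
  filter_upwards [hφ, extChartAt_source_mem_nhds (I := 𝓘(ℝ, E)) n] with y hy hys
  exact md_eq_fderiv_chart hys (hy.mdifferentiableAt (by simp)) _

/-- The commutator of the derivatives along two vector fields is the derivative along their
Lie bracket. -/
theorem md_br {φ : N → F} {h₁ h₂ : N → E} {n : N}
    (hφ : ∀ᶠ y in 𝓝 n, ContMDiffAt 𝓘(ℝ, E) 𝓘(ℝ, F) ∞ φ y)
    (hh₁ : SmoothAlong 𝓘(ℝ, E) (fun y => y) h₁ n) (hh₂ : SmoothAlong 𝓘(ℝ, E) (fun y => y) h₂ n) :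
    md 𝓘(ℝ, E) 𝓘(ℝ, F) φ n (br h₁ h₂ n) =
      md 𝓘(ℝ, E) 𝓘(ℝ, F) (fun y => md 𝓘(ℝ, E) 𝓘(ℝ, F) φ y (h₂ y)) n (h₁ n)
      - md 𝓘(ℝ, E) 𝓘(ℝ, F) (fun y => md 𝓘(ℝ, E) 𝓘(ℝ, F) φ y (h₁ y)) n (h₂ n) := by
  set φ' := fun z => φ ((extChartAt 𝓘(ℝ, E) n).symm z) with hφ'
  have h1 := contDiffAt_comp_chart_symm (p := n) (y := n) (by simp) hφ.self_of_nhds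
  have h2 : ContDiffAt ℝ ∞ (fderiv ℝ φ') (extChartAt 𝓘(ℝ, E) n n) := h1.fderiv_right (by simp)
  -- An iterated derivative is the Hessian of `φ` in the chart plus the differential of `φ` on the
  -- derivative of the inner field. The Hessian is symmetric and cancels in the commutator; what
  -- remains is `br_eq`.
  have key : ∀ {a b : N → E}, SmoothAlong 𝓘(ℝ, E) (fun y => y) b n →
      md 𝓘(ℝ, E) 𝓘(ℝ, F) (fun y => md 𝓘(ℝ, E) 𝓘(ℝ, F) φ y (b y)) n (a n) =
      fderiv ℝ (fderiv ℝ φ') (extChartAt 𝓘(ℝ, E) n n) (a n) (b n) +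
      md 𝓘(ℝ, E) 𝓘(ℝ, F) φ n (md 𝓘(ℝ, E) 𝓘(ℝ, E) (fun y => tc E n y (b y)) n (a n)) := by
    intro a b hb
    obtain ⟨c, hc, hc0, hcv⟩ := exists_curve (E := E) n (a n)
    have hcm := hc.mdifferentiableAt (n := ∞) (by simp)
    have hA := hasDerivAt_comp_curve (c := c) (t := 0)
      (by rw [hc0]; exact (contMDiffAt_md_apply hφ hb).mdifferentiableAt (by simp)) hcm
    have hB := hasDerivAt_comp_curve (c := c) (t := 0) (φ := fun y => tc E n y (b y))
      (by rw [hc0]; exact (hb.fiber (by simp)).mdifferentiableAt (by simp)) hcm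
    have hC : HasDerivAt (fun s => fderiv ℝ φ' (extChartAt 𝓘(ℝ, E) n (c s)))
        (fderiv ℝ (fderiv ℝ φ') (extChartAt 𝓘(ℝ, E) n n) (a n)) 0 := by
      have h3 := deriv_chart_comp (p := n) (c := c) (t := 0) (by rw [hc0]; simp) hcm
      rw [hc0, hcv, tc_self] at h3
      have h4 := (h2.differentiableAt (by simp)).hasFDerivAt
      have h5 : extChartAt 𝓘(ℝ, E) n n = extChartAt 𝓘(ℝ, E) n (c 0) := by rw [hc0]
      nth_rewrite 2 [h5] at h4
      exact h4.comp_hasDerivAt (0 : ℝ) h3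
    have hD := hC.clm_apply hB
    rw [hc0, hcv] at hA hD
    refine (hA.unique (hD.congr_of_eventuallyEq ?_)).trans ?_
    · filter_upwards [hc.continuousAt.eventually (hc0 ▸ hφ),
        hc.continuousAt.eventually
          (hc0.symm ▸ extChartAt_source_mem_nhds (I := 𝓘(ℝ, E)) n :
            (extChartAt 𝓘(ℝ, E) n).source ∈ 𝓝 (c 0))]
        with s hs hs'
      exact md_eq_fderiv_chart hs' (hs.mdifferentiableAt (by simp)) _
    · rw [md_eq_fderiv_chart (p := n) (by simp) (hφ.self_of_nhds.mdifferentiableAt (by simp))]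
      simp [tc_self, hφ']
  have hsymm : IsSymmSndFDerivAt ℝ φ' (extChartAt 𝓘(ℝ, E) n n) :=
    h1.isSymmSndFDerivAt (by simpa using two_le_infty)
  rw [br_eq hh₁ hh₂, map_sub, key hh₂, key hh₁, hsymm.eq (h₁ n) (h₂ n)]
  abel

/-- The mixed second derivatives of a two-parameter family of points, in a chart. -/
theorem exists_mixed_derivative {K : ℝ × ℝ → N} {p : N}
    (hK : ContMDiffAt 𝓘(ℝ, ℝ × ℝ) 𝓘(ℝ, E) ∞ K (0, 0))
    (hp : K (0, 0) ∈ (extChartAt 𝓘(ℝ, E) p).source) :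
    ∃ m : E, HasDerivAt (fun s => tc E p (K (s, 0)) (vel 𝓘(ℝ, E) (fun t => K (s, t)) 0)) m 0 ∧
      HasDerivAt (fun t => tc E p (K (0, t)) (vel 𝓘(ℝ, E) (fun s => K (s, t)) 0)) m 0 := by
  set k : ℝ × ℝ → E := fun q => extChartAt 𝓘(ℝ, E) p (K q) with hk
  have hks : ContDiffAt ℝ ∞ k (0, 0) :=
    contMDiffAt_iff_contDiffAt.1 (ContMDiffAt.comp _ (contMDiffAt_chart hp) hK)
  have hk' : ContDiffAt ℝ ∞ (fderiv ℝ k) (0, 0) := hks.fderiv_right (by simp)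
  have hk'' := (hk'.differentiableAt (by simp)).hasFDerivAt
  have hev : ∀ᶠ q in 𝓝 ((0, 0) : ℝ × ℝ), MDifferentiableAt 𝓘(ℝ, ℝ × ℝ) 𝓘(ℝ, E) K q ∧
      K q ∈ (extChartAt 𝓘(ℝ, E) p).source := by
    have h1 : ∀ᶠ q in 𝓝 ((0, 0) : ℝ × ℝ), ContMDiffAt 𝓘(ℝ, ℝ × ℝ) 𝓘(ℝ, E) 1 K q :=
      (contMDiffAt_iff_contMDiffAt_nhds (by simp)).1 (hK.of_le (one_le_two.trans two_le_infty))
    filter_upwards [h1, hK.continuousAt.eventually ((isOpen_extChartAt_source p).mem_nhds hp)]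
      with q hq hq'
    exact ⟨hq.mdifferentiableAt (by simp), hq'⟩
  have aux : ∀ (i : ℝ → ℝ × ℝ) (d : ℝ × ℝ) (t : ℝ), HasDerivAt i d t →
      MDifferentiableAt 𝓘(ℝ, ℝ × ℝ) 𝓘(ℝ, E) K (i t) →
      K (i t) ∈ (extChartAt 𝓘(ℝ, E) p).source →
      tc E p (K (i t)) (vel 𝓘(ℝ, E) (fun s => K (i s)) t) = fderiv ℝ k (i t) d := by
    intro i d t hi hd hs
    have hi' := hi.differentiableAt.mdifferentiableAt
    have h1 := deriv_chart_comp (c := fun s => K (i s)) hs (hd.comp t hi')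
    have h2 : MDifferentiableAt 𝓘(ℝ, ℝ × ℝ) 𝓘(ℝ, E) k (i t) :=
      (mdifferentiableAt_chart hs).comp _ hd
    have h3 := (mdifferentiableAt_iff_differentiableAt.1 h2).hasFDerivAt.comp_hasDerivAt t hi
    exact h1.unique h3
  have hs1 : HasDerivAt (fun s : ℝ => fderiv ℝ k (s, 0))
      (fderiv ℝ (fderiv ℝ k) (0, 0) (1, 0)) 0 := by
    have h1 : HasDerivAt (fun s : ℝ => ((s, 0) : ℝ × ℝ)) (1, 0) 0 :=
      (hasDerivAt_id (0 : ℝ)).prodMk (hasDerivAt_const 0 (0 : ℝ))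
    exact HasFDerivAt.comp_hasDerivAt (f := fun s : ℝ => ((s, 0) : ℝ × ℝ)) (0 : ℝ) hk'' h1
  have ht1 : HasDerivAt (fun t : ℝ => fderiv ℝ k (0, t))
      (fderiv ℝ (fderiv ℝ k) (0, 0) (0, 1)) 0 := by
    have h1 : HasDerivAt (fun s : ℝ => ((0, s) : ℝ × ℝ)) (0, 1) 0 :=
      (hasDerivAt_const 0 (0 : ℝ)).prodMk (hasDerivAt_id (0 : ℝ))
    exact HasFDerivAt.comp_hasDerivAt (f := fun s : ℝ => ((0, s) : ℝ × ℝ)) (0 : ℝ) hk'' h1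
  have hsymm : IsSymmSndFDerivAt ℝ k (0, 0) := hks.isSymmSndFDerivAt (by simpa using two_le_infty)
  -- The common value is the mixed second derivative of `K` in the chart, and symmetry of the second
  -- derivative makes it serve both orders.
  refine ⟨fderiv ℝ (fderiv ℝ k) (0, 0) (1, 0) (0, 1), ?_, ?_⟩
  · have h1 := hs1.clm_apply (hasDerivAt_const (0 : ℝ) ((0, 1) : ℝ × ℝ))
    simp only [map_zero, add_zero] at h1
    refine h1.congr_of_eventuallyEq ?_
    have hc : ContinuousAt (fun s : ℝ => ((s, 0) : ℝ × ℝ)) 0 := by fun_prop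
    filter_upwards [hc.eventually hev] with s hs
    exact aux (fun t => (s, t)) (0, 1) 0
      ((hasDerivAt_const 0 s).prodMk (hasDerivAt_id (0 : ℝ))) hs.1 hs.2
  · have h1 := ht1.clm_apply (hasDerivAt_const (0 : ℝ) ((1, 0) : ℝ × ℝ))
    simp only [map_zero, add_zero] at h1
    rw [hsymm.eq (0, 1) (1, 0)] at h1
    refine h1.congr_of_eventuallyEq ?_
    have hc : ContinuousAt (fun s : ℝ => ((0, s) : ℝ × ℝ)) 0 := by fun_prop
    filter_upwards [hc.eventually hev] with t ht
    exact aux (fun s => (s, t)) (1, 0) 0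
      ((hasDerivAt_id (0 : ℝ)).prodMk (hasDerivAt_const 0 t)) ht.1 ht.2

end Functions

end PlainDeriv

/-! ### Fibre retractions and endomorphisms of the tangent bundle -/

namespace PlainDeriv

section Retraction

variable {E : Type*} [NormedAddCommGroup E] [NormedSpace ℝ E]
  {X : Type*} [TopologicalSpace X] [ChartedSpace E X]
  {E' : Type*} [NormedAddCommGroup E'] [NormedSpace ℝ E']
  {B : Type*} [TopologicalSpace B] [ChartedSpace E' B]

/-- Differentiate the identity `ρ (f x', x') = x'` at `x`. -/
theorem md_retraction {f : X → B} {x : X} {ρ : B × X → X}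
    (hf : MDifferentiableAt 𝓘(ℝ, E) 𝓘(ℝ, E') f x)
    (hρ : MDifferentiableAt (𝓘(ℝ, E').prod 𝓘(ℝ, E)) 𝓘(ℝ, E) ρ (f x, x))
    (hfix : ∀ᶠ x' in 𝓝 x, ρ (f x', x') = x') (w : E) :
    md (𝓘(ℝ, E').prod 𝓘(ℝ, E)) 𝓘(ℝ, E) ρ (f x, x) (md 𝓘(ℝ, E) 𝓘(ℝ, E') f x w, w) = w := by
  have h1 := md_comp_apply (I := 𝓘(ℝ, E)) (I' := 𝓘(ℝ, E').prod 𝓘(ℝ, E)) (I'' := 𝓘(ℝ, E))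
    (g := ρ) (f := fun x' => (f x', x')) (x := x) hρ
    (hf.prodMk mdifferentiableAt_id) w
  rw [md_congr (g := fun x' => x') hfix, md_id,
    md_prodMk (g := fun x' : X => x') hf mdifferentiableAt_id, md_id] at h1
  exact h1.symm

/-- A curve, or a family of curves, can be moved into prescribed fibres of a submersion
without changing its velocity, provided the velocity projects to the given one. -/
theorem vel_retraction {f : X → B} {x : X} {ρ : B × X → X}
    (hf : MDifferentiableAt 𝓘(ℝ, E) 𝓘(ℝ, E') f x)
    (hρ : MDifferentiableAt (𝓘(ℝ, E').prod 𝓘(ℝ, E)) 𝓘(ℝ, E) ρ (f x, x))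
    (hfix : ∀ᶠ x' in 𝓝 x, ρ (f x', x') = x') {a : ℝ → B} {d : ℝ → X} {t : ℝ}
    (ha : MDifferentiableAt 𝓘(ℝ, ℝ) 𝓘(ℝ, E') a t) (hd : MDifferentiableAt 𝓘(ℝ, ℝ) 𝓘(ℝ, E) d t)
    (ha0 : a t = f x) (hd0 : d t = x)
    (hv : vel 𝓘(ℝ, E') a t = md 𝓘(ℝ, E) 𝓘(ℝ, E') f x (vel 𝓘(ℝ, E) d t)) :
    vel 𝓘(ℝ, E) (fun s => ρ (a s, d s)) t = vel 𝓘(ℝ, E) d t := by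
  rw [vel_comp (I := 𝓘(ℝ, E').prod 𝓘(ℝ, E)) (g := ρ) (c := fun s => (a s, d s))
    (by rw [ha0, hd0]; exact hρ) (ha.prodMk hd),
    vel_prodMk ha hd, hv, ha0, hd0]
  exact md_retraction hf hρ hfix _

end Retraction

section Endomorphism

variable {E : Type*} [NormedAddCommGroup E] [NormedSpace ℝ E]
  {X : Type*} [TopologicalSpace X] [ChartedSpace E X] [IsManifold 𝓘(ℝ, E) ∞ X]

/-- An endomorphism of the tangent bundle in the preferred chart at `p`. -/
def chartEnd (A : X → E →L[ℝ] E) (p : X) (z : E) : E →L[ℝ] E :=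
  (tc E p ((extChartAt 𝓘(ℝ, E) p).symm z)).comp
    ((A ((extChartAt 𝓘(ℝ, E) p).symm z)).comp (tcInv E p ((extChartAt 𝓘(ℝ, E) p).symm z)))

/-- Smoothness of an endomorphism of the tangent bundle. -/
def SmoothEnd (A : X → E →L[ℝ] E) : Prop :=
  ContMDiff 𝓘(ℝ, E).tangent 𝓘(ℝ, E).tangent ∞
    (fun q : TangentBundle 𝓘(ℝ, E) X => (⟨q.1, A q.1 q.2⟩ : TangentBundle 𝓘(ℝ, E) X))

theorem chartEnd_apply (A : X → E →L[ℝ] E) {p y : X} (hy : y ∈ (extChartAt 𝓘(ℝ, E) p).source)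
    (v : E) : chartEnd A p (extChartAt 𝓘(ℝ, E) p y) (tc E p y v) = tc E p y (A y v) := by
  unfold chartEnd
  simp only [ContinuousLinearMap.comp_apply]
  rw [(extChartAt 𝓘(ℝ, E) p).left_inv hy, tcInv_tc hy]

theorem SmoothEnd.along {E₀ : Type*} [NormedAddCommGroup E₀] [NormedSpace ℝ E₀]
    {H₀ : Type*} [TopologicalSpace H₀] {I₀ : ModelWithCorners ℝ E₀ H₀}
    {N : Type*} [TopologicalSpace N] [ChartedSpace H₀ N] {A : X → E →L[ℝ] E} (hA : SmoothEnd A)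
    {b : N → X} {w : N → E} {n : N} (hw : SmoothAlong I₀ b w n) :
    SmoothAlong I₀ b (fun y => A (b y) (w y)) n :=
  ContMDiffAt.comp (f := fun y => (⟨b y, w y⟩ : TangentBundle 𝓘(ℝ, E) X)) n (hA _) hw

/-- In finite dimension an operator-valued map is smooth once its values on each fixed vector are.
Here the endomorphism is applied to the field with constant coordinates `v`. -/
theorem SmoothEnd.contDiffOn [FiniteDimensional ℝ E] {A : X → E →L[ℝ] E} (hA : SmoothEnd A)
    (p : X) : ContDiffOn ℝ ∞ (chartEnd A p) (extChartAt 𝓘(ℝ, E) p).target := by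
  rw [contDiffOn_clm_apply]
  intro v z hz
  have hs := (extChartAt 𝓘(ℝ, E) p).map_target hz
  have h1 : SmoothAlong 𝓘(ℝ, E) (extChartAt 𝓘(ℝ, E) p).symm
      (fun z => tcInv E p ((extChartAt 𝓘(ℝ, E) p).symm z) v) z := by
    rw [smoothAlong_iff hs]
    refine ⟨contMDiffAt_chart_symm hz, ?_⟩
    refine (contMDiffAt_const (c := v)).congr_of_eventuallyEq ?_
    filter_upwards [(isOpen_extChartAt_target p).mem_nhds hz] with z' hz'
    exact tc_tcInv ((extChartAt 𝓘(ℝ, E) p).map_target hz') v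
  exact (contMDiffAt_iff_contDiffAt.1 ((hA.along h1).fiber hs)).contDiffWithinAt

theorem SmoothEnd.contDiffAt [FiniteDimensional ℝ E] {A : X → E →L[ℝ] E} (hA : SmoothEnd A)
    {p y : X} (hy : y ∈ (extChartAt 𝓘(ℝ, E) p).source) :
    ContDiffAt ℝ ∞ (chartEnd A p) (extChartAt 𝓘(ℝ, E) p y) :=
  (hA.contDiffOn p).contDiffAt
    ((isOpen_extChartAt_target p).mem_nhds ((extChartAt 𝓘(ℝ, E) p).map_source hy))

/-- The antisymmetrized derivative of an endomorphism of the tangent bundle in a chart. -/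
def chartCurv (A : X → E →L[ℝ] E) (p : X) (z : E) (a b : E) : E :=
  fderiv ℝ (chartEnd A p) z a b - fderiv ℝ (chartEnd A p) z b a

omit [IsManifold 𝓘(ℝ, E) ∞ X] in
theorem chartCurv_swap (A : X → E →L[ℝ] E) (p : X) (z a b : E) :
    chartCurv A p z a b = -chartCurv A p z b a := by
  unfold chartCurv; abel

/-- The derivative of the image of a vector field along a curve under an endomorphism, in a
chart. -/
theorem SmoothEnd.hasDerivAt [FiniteDimensional ℝ E] {A : X → E →L[ℝ] E} (hA : SmoothEnd A)
    {p : X} {c : ℝ → X} {w : ℝ → E} {w' : E}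
    (hc : ContMDiffAt 𝓘(ℝ, ℝ) 𝓘(ℝ, E) ∞ c 0) (hp : c 0 ∈ (extChartAt 𝓘(ℝ, E) p).source)
    (hw : HasDerivAt (fun s => tc E p (c s) (w s)) w' 0) :
    HasDerivAt (fun s => tc E p (c s) (A (c s) (w s)))
      (fderiv ℝ (chartEnd A p) (extChartAt 𝓘(ℝ, E) p (c 0)) (tc E p (c 0) (vel 𝓘(ℝ, E) c 0))
        (tc E p (c 0) (w 0)) + chartEnd A p (extChartAt 𝓘(ℝ, E) p (c 0)) w') 0 := by
  have h1 := deriv_chart_comp hp (hc.mdifferentiableAt (by simp))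
  have h2 := (((hA.contDiffAt hp).differentiableAt (by simp)).hasFDerivAt.comp_hasDerivAt
    (f := fun s => extChartAt 𝓘(ℝ, E) p (c s)) (0 : ℝ) h1).clm_apply hw
  refine h2.congr_of_eventuallyEq ?_
  filter_upwards [hc.continuousAt.eventually ((isOpen_extChartAt_source p).mem_nhds hp)]
    with s hs
  exact (chartEnd_apply A hs (w s)).symm

/-- For a two-parameter family of points whose velocities at the origin are annihilated by `A`,
the antisymmetrized derivative of `A` is the exterior derivative of the pulled back form. -/
theorem SmoothEnd.exists_curv_family [FiniteDimensional ℝ E] {A : X → E →L[ℝ] E}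
    (hA : SmoothEnd A) {K : ℝ × ℝ → X} {p : X}
    (hK : ContMDiffAt 𝓘(ℝ, ℝ × ℝ) 𝓘(ℝ, E) ∞ K (0, 0))
    (hp : K (0, 0) ∈ (extChartAt 𝓘(ℝ, E) p).source) :
    ∃ d₁ d₂ : E,
      HasDerivAt (fun s => tc E p (K (s, 0)) (A (K (s, 0)) (vel 𝓘(ℝ, E) (fun t => K (s, t)) 0)))
        d₁ 0 ∧
      HasDerivAt (fun t => tc E p (K (0, t)) (A (K (0, t)) (vel 𝓘(ℝ, E) (fun s => K (s, t)) 0)))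
        d₂ 0 ∧
      chartCurv A p (extChartAt 𝓘(ℝ, E) p (K (0, 0)))
        (tc E p (K (0, 0)) (vel 𝓘(ℝ, E) (fun s => K (s, 0)) 0))
        (tc E p (K (0, 0)) (vel 𝓘(ℝ, E) (fun t => K (0, t)) 0)) = d₁ - d₂ := by
  obtain ⟨m, hm1, hm2⟩ := exists_mixed_derivative hK hp
  have hl : ContMDiffAt 𝓘(ℝ, ℝ) 𝓘(ℝ, ℝ × ℝ) ∞ (fun s : ℝ => ((s, 0) : ℝ × ℝ)) 0 :=
    ContDiffAt.contMDiffAt (by fun_prop)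
  have hr : ContMDiffAt 𝓘(ℝ, ℝ) 𝓘(ℝ, ℝ × ℝ) ∞ (fun s : ℝ => ((0, s) : ℝ × ℝ)) 0 :=
    ContDiffAt.contMDiffAt (by fun_prop)
  have h1 := hA.hasDerivAt (c := fun s => K (s, 0)) (ContMDiffAt.comp (0 : ℝ) hK hl) hp hm1
  have h2 := hA.hasDerivAt (c := fun s => K (0, s)) (ContMDiffAt.comp (0 : ℝ) hK hr) hp hm2
  -- Both derivatives contain the image under `A` of the same mixed derivative `m`, which cancels in
  -- `d₁ - d₂`.
  exact ⟨_, _, h1, h2, by unfold chartCurv; abel⟩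

end Endomorphism

end PlainDeriv

open PlainDeriv




/-! ### Groupoid algebra and the product of tangent vectors -/

namespace LieGrpd

variable {EG : Type*} [NormedAddCommGroup EG] [NormedSpace ℝ EG]
  {EM : Type*} [NormedAddCommGroup EM] [NormedSpace ℝ EM]
  {G : Type*} [TopologicalSpace G] [ChartedSpace EG G]
  {M : Type*} [TopologicalSpace M] [ChartedSpace EM M]
  (Γ : LieGrpd (EG := EG) (EM := EM) G M)

theorem inv_unit (m : M) : Γ.inv (Γ.unit m) = Γ.unit m := by
  have h1 := Γ.unit_mul (Γ.inv (Γ.unit m))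
  rw [Γ.src_inv, Γ.tgt_unit, Γ.mul_inv, Γ.src_unit] at h1
  exact h1.symm

theorem inv_mul_cancel_left {x y : G} (h : Γ.tgt x = Γ.src y) :
    Γ.mul (Γ.inv x) (Γ.mul x y) = y := by
  rw [← Γ.mul_assoc _ _ _ (Γ.tgt_inv x) h, Γ.inv_mul, h, Γ.unit_mul]

theorem mul_inv_cancel_left {x y : G} (h : Γ.src x = Γ.src y) :
    Γ.mul x (Γ.mul (Γ.inv x) y) = y := by
  rw [← Γ.mul_assoc _ _ _ (Γ.src_inv x).symm ((Γ.tgt_inv x).trans h), Γ.mul_inv, h, Γ.unit_mul]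

theorem eq_inv_of_mul_eq_unit {x y : G} (h : Γ.tgt x = Γ.src y)
    (hxy : Γ.mul x y = Γ.unit (Γ.src x)) : y = Γ.inv x := by
  have h1 := Γ.inv_mul_cancel_left h
  rw [hxy] at h1
  have h2 := Γ.mul_unit (Γ.inv x)
  rw [Γ.tgt_inv] at h2
  rw [← h1, h2]

theorem inv_inv (x : G) : Γ.inv (Γ.inv x) = x := by
  refine (Γ.eq_inv_of_mul_eq_unit (Γ.tgt_inv x) ?_).symm
  rw [Γ.inv_mul, Γ.src_inv]

theorem inv_mul_rev {x y : G} (h : Γ.tgt x = Γ.src y) :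
    Γ.inv (Γ.mul x y) = Γ.mul (Γ.inv y) (Γ.inv x) := by
  have h1 : Γ.tgt (Γ.inv y) = Γ.src (Γ.inv x) := by rw [Γ.tgt_inv, Γ.src_inv, h]
  have h2 : Γ.tgt y = Γ.src (Γ.mul (Γ.inv y) (Γ.inv x)) := by rw [Γ.src_mul _ _ h1, Γ.src_inv]
  refine (Γ.eq_inv_of_mul_eq_unit (by rw [Γ.tgt_mul _ _ h, h2]) ?_).symm
  rw [Γ.mul_assoc _ _ _ h h2, Γ.mul_inv_cancel_left (by rw [Γ.src_inv, h]), Γ.mul_inv,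
    Γ.src_mul _ _ h]

theorem contMDiff_src : ContMDiff 𝓘(ℝ, EG) 𝓘(ℝ, EM) ∞ Γ.src := Γ.src_submersion.contMDiff

theorem contMDiff_tgt : ContMDiff 𝓘(ℝ, EG) 𝓘(ℝ, EM) ∞ Γ.tgt := Γ.tgt_submersion.contMDiff

theorem mdifferentiableAt_src (x : G) : MDifferentiableAt 𝓘(ℝ, EG) 𝓘(ℝ, EM) Γ.src x :=
  Γ.contMDiff_src.contMDiffAt.mdifferentiableAt (by simp)

theorem mdifferentiableAt_tgt (x : G) : MDifferentiableAt 𝓘(ℝ, EG) 𝓘(ℝ, EM) Γ.tgt x :=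
  Γ.contMDiff_tgt.contMDiffAt.mdifferentiableAt (by simp)

theorem mdifferentiableAt_inv (x : G) : MDifferentiableAt 𝓘(ℝ, EG) 𝓘(ℝ, EG) Γ.inv x :=
  Γ.contMDiff_inv.contMDiffAt.mdifferentiableAt (by simp)

theorem mdifferentiableAt_unit (m : M) : MDifferentiableAt 𝓘(ℝ, EM) 𝓘(ℝ, EG) Γ.unit m :=
  Γ.contMDiff_unit.contMDiffAt.mdifferentiableAt (by simp)

section Product

variable {E₀ : Type*} [NormedAddCommGroup E₀] [NormedSpace ℝ E₀]
  {H₀ : Type*} [TopologicalSpace H₀] {I₀ : ModelWithCorners ℝ E₀ H₀}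
  {N : Type*} [TopologicalSpace N] [ChartedSpace H₀ N]

/-- The product of smooth maps that are composable near a point is smooth. -/
theorem contMDiffAt_mul {a b : N → G} {n : N} (ha : ContMDiffAt I₀ 𝓘(ℝ, EG) ∞ a n)
    (hb : ContMDiffAt I₀ 𝓘(ℝ, EG) ∞ b n) (h : ∀ᶠ y in 𝓝 n, Γ.tgt (a y) = Γ.src (b y)) :
    ContMDiffAt I₀ 𝓘(ℝ, EG) ∞ (fun y => Γ.mul (a y) (b y)) n := by
  have h1 : ContMDiffWithinAt I₀ 𝓘(ℝ, EG) ∞ (fun y => Γ.mul (a y) (b y))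
      {y | Γ.tgt (a y) = Γ.src (b y)} n :=
    ContMDiffWithinAt.comp n (g := fun p : G × G => Γ.mul p.1 p.2) (f := fun y => (a y, b y))
      (Γ.contMDiffOn_mul (a n, b n) h.self_of_nhds) (ha.prodMk hb).contMDiffWithinAt
      (fun y hy => hy)
  exact h1.contMDiffAt h

end Product

/-- The product in the tangent groupoid as a linear map. -/
def tmL (x y : G) : EG × EG →L[ℝ] EG :=
  mdWithin (𝓘(ℝ, EG).prod 𝓘(ℝ, EG)) 𝓘(ℝ, EG) (fun p : G × G => Γ.mul p.1 p.2) Γ.composable (x, y)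

/-- The velocity of a product of curves. -/
theorem vel_mul {a b : ℝ → G} {t : ℝ} (ha : MDifferentiableAt 𝓘(ℝ, ℝ) 𝓘(ℝ, EG) a t)
    (hb : MDifferentiableAt 𝓘(ℝ, ℝ) 𝓘(ℝ, EG) b t)
    (h : ∀ᶠ s in 𝓝 t, Γ.tgt (a s) = Γ.src (b s)) :
    MDifferentiableAt 𝓘(ℝ, ℝ) 𝓘(ℝ, EG) (fun s => Γ.mul (a s) (b s)) t ∧
    vel 𝓘(ℝ, EG) (fun s => Γ.mul (a s) (b s)) t =
      Γ.tmL (a t) (b t) (vel 𝓘(ℝ, EG) a t, vel 𝓘(ℝ, EG) b t) := by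
  have h1 := vel_comp_within (I := 𝓘(ℝ, EG).prod 𝓘(ℝ, EG)) (I' := 𝓘(ℝ, EG))
    (g := fun p : G × G => Γ.mul p.1 p.2) (S := Γ.composable) (c := fun s => (a s, b s)) (t := t)
    ((Γ.contMDiffOn_mul (a t, b t) h.self_of_nhds).mdifferentiableWithinAt (by simp))
    (ha.prodMk hb) h
  rw [vel_prodMk ha hb] at h1
  exact h1

theorem md_tgt_vel_eq {a b : ℝ → G} {t : ℝ} (ha : MDifferentiableAt 𝓘(ℝ, ℝ) 𝓘(ℝ, EG) a t)
    (hb : MDifferentiableAt 𝓘(ℝ, ℝ) 𝓘(ℝ, EG) b t)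
    (h : ∀ᶠ s in 𝓝 t, Γ.tgt (a s) = Γ.src (b s)) :
    md 𝓘(ℝ, EG) 𝓘(ℝ, EM) Γ.tgt (a t) (vel 𝓘(ℝ, EG) a t) =
      md 𝓘(ℝ, EG) 𝓘(ℝ, EM) Γ.src (b t) (vel 𝓘(ℝ, EG) b t) := by
  rw [← vel_comp (Γ.mdifferentiableAt_tgt _) ha, ← vel_comp (Γ.mdifferentiableAt_src _) hb]
  exact vel_congr h

variable [IsManifold 𝓘(ℝ, EG) ∞ G]

/-- A tangent vector that is annihilated by the differential of a submersion is the velocity of a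
curve in a fibre. -/
theorem _root_.PlainDeriv.exists_fibre_curve {E' : Type*} [NormedAddCommGroup E']
    [NormedSpace ℝ E'] {B : Type*} [TopologicalSpace B] [ChartedSpace E' B] {f : G → B}
    (hf : IsSubmersion 𝓘(ℝ, EG) 𝓘(ℝ, E') ∞ f) {x : G} {v : EG}
    (hv : md 𝓘(ℝ, EG) 𝓘(ℝ, E') f x v = 0) :
    ∃ c : ℝ → G, ContMDiffAt 𝓘(ℝ, ℝ) 𝓘(ℝ, EG) ∞ c 0 ∧ c 0 = x ∧ vel 𝓘(ℝ, EG) c 0 = v ∧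
      ∀ᶠ t in 𝓝 (0 : ℝ), f (c t) = f x := by
  obtain ⟨ρ, hρ, hρ1, hρ2⟩ := exists_fibre_retraction hf x
  obtain ⟨d, hd, hd0, hdv⟩ := exists_curve (E := EG) x v
  have hfd : MDifferentiableAt 𝓘(ℝ, EG) 𝓘(ℝ, E') f x :=
    hf.contMDiff.contMDiffAt.mdifferentiableAt (by simp)
  have hpair : ContMDiffAt 𝓘(ℝ, ℝ) (𝓘(ℝ, E').prod 𝓘(ℝ, EG)) ∞ (fun t => (f x, d t)) (0 : ℝ) :=
    contMDiffAt_const.prodMk hd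
  -- An arbitrary curve with velocity `v` is pushed into the fibre through `x`; the velocity
  -- survives because `f` annihilates `v` to first order.
  refine ⟨fun t => ρ (f x, d t), ?_, ?_, ?_, ?_⟩
  · exact ContMDiffAt.comp (0 : ℝ) (by rw [hd0]; exact hρ) hpair
  · change ρ (f x, d 0) = x
    rw [hd0]; exact hρ2.self_of_nhds
  · rw [vel_retraction (a := fun _ => f x) (d := d) hfd (hρ.mdifferentiableAt (by simp)) hρ2 mdifferentiableAt_const
      (hd.mdifferentiableAt (by simp)) rfl hd0, hdv]
    rw [hdv, hv, vel_const]
  · have hc : Tendsto (fun t => (f x, d t)) (𝓝 (0 : ℝ)) (𝓝 (f x, x)) := by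
      have := hpair.continuousAt.tendsto
      rwa [hd0] at this
    exact hc.eventually hρ1

/-- Near a composable pair the multiplication has a smooth extension to all pairs. -/
theorem exists_mul_extension {x y : G} (h : Γ.tgt x = Γ.src y) :
    ∃ μ : G × G → G, ContMDiffAt (𝓘(ℝ, EG).prod 𝓘(ℝ, EG)) 𝓘(ℝ, EG) ∞ μ (x, y) ∧
      (∀ᶠ p in 𝓝 (x, y), Γ.tgt p.1 = Γ.src p.2 → μ p = Γ.mul p.1 p.2) ∧
      (∀ᶠ p in 𝓝 (x, y), Γ.tgt p.1 = Γ.src p.2 →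
        ∀ v, md 𝓘(ℝ, EG) 𝓘(ℝ, EM) Γ.src p.2 v = 0 →
          md 𝓘(ℝ, EG) 𝓘(ℝ, EG) (fun z => μ (p.1, z)) p.2 v = Γ.tmL p.1 p.2 (0, v)) ∧
      (∀ᶠ p in 𝓝 (x, y), Γ.tgt p.1 = Γ.src p.2 →
        ∀ u, md 𝓘(ℝ, EG) 𝓘(ℝ, EM) Γ.tgt p.1 u = 0 →
          md 𝓘(ℝ, EG) 𝓘(ℝ, EG) (fun z => μ (z, p.2)) p.1 u = Γ.tmL p.1 p.2 (u, 0)) := by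
  obtain ⟨ρ, hρ, hρ1, hρ2⟩ := exists_fibre_retraction Γ.src_submersion y
  have hr : ContMDiffAt (𝓘(ℝ, EG).prod 𝓘(ℝ, EG)) 𝓘(ℝ, EG) ∞
      (fun p : G × G => ρ (Γ.tgt p.1, p.2)) (x, y) := by
    refine ContMDiffAt.comp (I' := 𝓘(ℝ, EM).prod 𝓘(ℝ, EG)) (g := ρ)
      (f := fun p : G × G => (Γ.tgt p.1, p.2)) (x, y) ?_ ?_
    · change ContMDiffAt (𝓘(ℝ, EM).prod 𝓘(ℝ, EG)) 𝓘(ℝ, EG) ∞ ρ (Γ.tgt x, y)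
      rw [h]; exact hρ
    · exact (ContMDiffAt.comp (x, y) Γ.contMDiff_tgt.contMDiffAt contMDiffAt_fst).prodMk
        contMDiffAt_snd
  have hcont : Tendsto (fun p : G × G => (Γ.tgt p.1, p.2)) (𝓝 (x, y)) (𝓝 (Γ.src y, y)) := by
    rw [← h]
    exact ((Γ.contMDiff_tgt.continuous.comp continuous_fst).prodMk continuous_snd).tendsto _
  -- The second factor is first moved into the source fibre over `Γ.tgt p.1`, so near `(x, y)` the
  -- product is always defined. On composable pairs the retraction changes nothing.
  set μ : G × G → G := fun p => Γ.mul p.1 (ρ (Γ.tgt p.1, p.2)) with hμdef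
  have hμ : ContMDiffAt (𝓘(ℝ, EG).prod 𝓘(ℝ, EG)) 𝓘(ℝ, EG) ∞ μ (x, y) := by
    refine Γ.contMDiffAt_mul contMDiffAt_fst hr ?_
    filter_upwards [hcont.eventually hρ1] with p hp
    exact hp.symm
  have hext : ∀ᶠ p in 𝓝 (x, y), Γ.tgt p.1 = Γ.src p.2 → μ p = Γ.mul p.1 p.2 := by
    filter_upwards [continuousAt_snd.eventually hρ2] with p hp hc
    simp only [hμdef]
    rw [hc, hp]
  have hdiff : ∀ᶠ p in 𝓝 (x, y),
      MDifferentiableAt (𝓘(ℝ, EG).prod 𝓘(ℝ, EG)) 𝓘(ℝ, EG) μ p := by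
    have h1 : ∀ᶠ p in 𝓝 (x, y), ContMDiffAt (𝓘(ℝ, EG).prod 𝓘(ℝ, EG)) 𝓘(ℝ, EG) 1 μ p :=
      (contMDiffAt_iff_contMDiffAt_nhds (by simp)).1 (hμ.of_le (one_le_two.trans two_le_infty))
    filter_upwards [h1] with p hp
    exact hp.mdifferentiableAt (by simp)
  refine ⟨μ, hμ, hext, ?_, ?_⟩
  · filter_upwards [hdiff, hext.eventually_nhds] with p hp hp' hc v hv
    -- Along a curve in a source fibre the constant first factor stays composable, so `μ` and the
    -- product agree along it and have the same velocity.
    obtain ⟨c, hc1, hc0, hcv, hcf⟩ := exists_fibre_curve Γ.src_submersion hv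
    have hcd := hc1.mdifferentiableAt (n := ∞) (by simp)
    have h1 : MDifferentiableAt 𝓘(ℝ, EG) 𝓘(ℝ, EG) (fun z => μ (p.1, z)) p.2 :=
      MDifferentiableAt.comp (g := μ) p.2 hp (mdifferentiableAt_const.prodMk mdifferentiableAt_id)
    have h2 := vel_comp (g := fun z => μ (p.1, z)) (c := c) (t := 0) (by rw [hc0]; exact h1) hcd
    have hcomp : ∀ᶠ s in 𝓝 (0 : ℝ), Γ.tgt p.1 = Γ.src (c s) := by
      filter_upwards [hcf] with s hs
      rw [hs, hc]
    have h3 := (Γ.vel_mul (a := fun _ => p.1) mdifferentiableAt_const hcd hcomp).2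
    rw [vel_const, hc0, hcv] at h3
    rw [hc0, hcv] at h2
    rw [← h2, ← h3]
    apply vel_congr
    have hcc : Tendsto (fun s => (p.1, c s)) (𝓝 (0 : ℝ)) (𝓝 p) := by
      have := (continuousAt_const (y := p.1)).prodMk hc1.continuousAt
      have h4 := this.tendsto
      rwa [hc0] at h4
    filter_upwards [hcc.eventually hp', hcomp] with s hs hs'
    exact hs hs'
  · filter_upwards [hdiff, hext.eventually_nhds] with p hp hp' hc v hv
    obtain ⟨c, hc1, hc0, hcv, hcf⟩ := exists_fibre_curve Γ.tgt_submersion hv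
    have hcd := hc1.mdifferentiableAt (n := ∞) (by simp)
    have h1 : MDifferentiableAt 𝓘(ℝ, EG) 𝓘(ℝ, EG) (fun z => μ (z, p.2)) p.1 :=
      MDifferentiableAt.comp (g := μ) p.1 hp (mdifferentiableAt_id.prodMk mdifferentiableAt_const)
    have h2 := vel_comp (g := fun z => μ (z, p.2)) (c := c) (t := 0) (by rw [hc0]; exact h1) hcd
    have hcomp : ∀ᶠ s in 𝓝 (0 : ℝ), Γ.tgt (c s) = Γ.src p.2 := by
      filter_upwards [hcf] with s hs
      rw [hs, hc]
    have h3 := (Γ.vel_mul (b := fun _ => p.2) hcd mdifferentiableAt_const hcomp).2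
    rw [vel_const, hc0, hcv] at h3
    rw [hc0, hcv] at h2
    rw [← h2, ← h3]
    apply vel_congr
    have hcc : Tendsto (fun s => (c s, p.2)) (𝓝 (0 : ℝ)) (𝓝 p) := by
      have := hc1.continuousAt.prodMk (continuousAt_const (y := p.2))
      have h4 := this.tendsto
      rwa [hc0] at h4
    filter_upwards [hcc.eventually hp', hcomp] with s hs hs'
    exact hs hs'

end LieGrpd

/-! ### Vertical vectors, left translation and the adjoint representation -/

namespace LieGrpdExt

variable {EX : Type*} [NormedAddCommGroup EX] [NormedSpace ℝ EX]
  {EY : Type*} [NormedAddCommGroup EY] [NormedSpace ℝ EY]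
  {EM : Type*} [NormedAddCommGroup EM] [NormedSpace ℝ EM]
  {X : Type*} [TopologicalSpace X] [ChartedSpace EX X]
  {Y : Type*} [TopologicalSpace Y] [ChartedSpace EY Y]
  {M : Type*} [TopologicalSpace M] [ChartedSpace EM M]
  (P : LieGrpdExt (EX := EX) (EY := EY) (EM := EM) X Y M)

/-- The differential of the projection. -/
def dproj (x : X) : EX →L[ℝ] EY := md 𝓘(ℝ, EX) 𝓘(ℝ, EY) P.proj x

/-- The differential at `x` of the left translation by `x⁻¹` on the fibre through `x`. -/
def AL (x : X) : EX →L[ℝ] EX :=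
  mdWithin 𝓘(ℝ, EX) 𝓘(ℝ, EX) (fun z => P.top.mul (P.top.inv x) z) {z | P.proj z = P.proj x} x

/-- The adjoint representation as a linear map. -/
def AdL (x : X) : EX →L[ℝ] EX :=
  mdWithin 𝓘(ℝ, EX) 𝓘(ℝ, EX) (fun k => P.top.mul (P.top.mul x k) (P.top.inv x))
    (P.ker (P.top.tgt x)) (P.top.unit (P.top.tgt x))

/-- The right fundamental vector at `x` of an element of the Lie algebra at `tgt x`. -/
def lam (x : X) (ξ : EX) : EX := P.top.tmL x (P.top.unit (P.top.tgt x)) (0, ξ)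

theorem mdifferentiableAt_proj (x : X) : MDifferentiableAt 𝓘(ℝ, EX) 𝓘(ℝ, EY) P.proj x :=
  P.proj_submersion.contMDiff.contMDiffAt.mdifferentiableAt (by simp)

theorem src_eq_of_proj_eq {x y : X} (h : P.proj x = P.proj y) : P.top.src x = P.top.src y := by
  rw [← P.src_proj, h, P.src_proj]

theorem tgt_eq_of_proj_eq {x y : X} (h : P.proj x = P.proj y) : P.top.tgt x = P.top.tgt y := by
  rw [← P.tgt_proj, h, P.tgt_proj]

theorem src_of_mem_ker {m : M} {k : X} (h : k ∈ P.ker m) : P.top.src k = m := by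
  rw [← P.src_proj, show P.proj k = P.bot.unit m from h, P.bot.src_unit]

theorem tgt_of_mem_ker {m : M} {k : X} (h : k ∈ P.ker m) : P.top.tgt k = m := by
  rw [← P.tgt_proj, show P.proj k = P.bot.unit m from h, P.bot.tgt_unit]

theorem unit_mem_ker (m : M) : P.top.unit m ∈ P.ker m := P.proj_unit m

theorem proj_eq_of_mem_ker {m : M} {k : X} (h : k ∈ P.ker m) :
    P.proj k = P.proj (P.top.unit m) := by
  rw [P.proj_unit]; exact h

theorem inv_mul_mem_ker {x z : X} (h : P.proj z = P.proj x) :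
    P.top.mul (P.top.inv x) z ∈ P.ker (P.top.tgt x) := by
  change P.proj _ = _
  rw [P.proj_mul _ _ ((P.top.tgt_inv x).trans (P.src_eq_of_proj_eq h).symm), h,
    ← P.proj_mul _ _ (P.top.tgt_inv x), P.top.inv_mul, P.proj_unit]

theorem proj_mul_ker {x k : X} (h : k ∈ P.ker (P.top.tgt x)) :
    P.proj (P.top.mul x k) = P.proj x := by
  rw [P.proj_mul _ _ (P.src_of_mem_ker h).symm, show P.proj k = _ from h, ← P.tgt_proj,
    P.bot.mul_unit]

theorem mul_mem_ker {m : M} {k l : X} (hk : k ∈ P.ker m) (hl : l ∈ P.ker m) :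
    P.top.mul k l ∈ P.ker m := by
  have h := P.proj_mul_ker (x := k) (k := l) (by rwa [P.tgt_of_mem_ker hk])
  exact h.trans hk

theorem inv_mem_ker {m : M} {k : X} (hk : k ∈ P.ker m) : P.top.inv k ∈ P.ker m := by
  have h := P.inv_mul_mem_ker (x := k) (z := P.top.unit m) (P.proj_eq_of_mem_ker hk).symm
  have h2 := P.top.mul_unit (P.top.inv k)
  rw [P.top.tgt_inv, P.src_of_mem_ker hk] at h2
  rwa [h2, P.tgt_of_mem_ker hk] at h

theorem conj_eq {x k : X} (h : k ∈ P.ker (P.top.tgt x)) :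
    P.top.tgt x = P.top.src k ∧ P.top.tgt (P.top.mul x k) = P.top.src (P.top.inv x) := by
  have h1 : P.top.tgt x = P.top.src k := (P.src_of_mem_ker h).symm
  exact ⟨h1, by rw [P.top.tgt_mul _ _ h1, P.tgt_of_mem_ker h, P.top.src_inv]⟩

/-- The target of the total groupoid factors through the projection. Vertical vectors are thus
composable with zero vectors on either side, which underlies all the splittings below. -/
theorem md_tgt_of_vert {x : X} {v : EX} (h : P.dproj x v = 0) :
    md 𝓘(ℝ, EX) 𝓘(ℝ, EM) P.top.tgt x v = 0 := by
  have h1 := md_comp_apply (g := P.bot.tgt) (f := P.proj) (x := x)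
    (P.bot.mdifferentiableAt_tgt _) (P.mdifferentiableAt_proj x) v
  rw [show md 𝓘(ℝ, EX) 𝓘(ℝ, EY) P.proj x v = 0 from h, map_zero] at h1
  rw [← h1]
  congr 2
  funext y
  exact (P.tgt_proj y).symm

theorem md_src_of_vert {x : X} {v : EX} (h : P.dproj x v = 0) :
    md 𝓘(ℝ, EX) 𝓘(ℝ, EM) P.top.src x v = 0 := by
  have h1 := md_comp_apply (g := P.bot.src) (f := P.proj) (x := x)
    (P.bot.mdifferentiableAt_src _) (P.mdifferentiableAt_proj x) v
  rw [show md 𝓘(ℝ, EX) 𝓘(ℝ, EY) P.proj x v = 0 from h, map_zero] at h1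
  rw [← h1]
  congr 2
  funext y
  exact (P.src_proj y).symm

/-- A curve in a fibre of the projection has vertical velocity. -/
theorem dproj_vel {c : ℝ → X} {t : ℝ} {x : X} (hc : MDifferentiableAt 𝓘(ℝ, ℝ) 𝓘(ℝ, EX) c t)
    (h : ∀ᶠ s in 𝓝 t, P.proj (c s) = P.proj x) : P.dproj (c t) (vel 𝓘(ℝ, EX) c t) = 0 := by
  unfold dproj
  rw [← vel_comp (P.mdifferentiableAt_proj _) hc, ← vel_const (I := 𝓘(ℝ, EY)) (P.proj x) t]
  exact vel_congr h

/-- `AL` on the velocity of a curve in a fibre. -/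
theorem AL_vel {c : ℝ → X} {t : ℝ} (hc : MDifferentiableAt 𝓘(ℝ, ℝ) 𝓘(ℝ, EX) c t)
    (h : ∀ᶠ s in 𝓝 t, P.proj (c s) = P.proj (c t)) :
    MDifferentiableAt 𝓘(ℝ, ℝ) 𝓘(ℝ, EX) (fun s => P.top.mul (P.top.inv (c t)) (c s)) t ∧
    vel 𝓘(ℝ, EX) (fun s => P.top.mul (P.top.inv (c t)) (c s)) t =
      P.AL (c t) (vel 𝓘(ℝ, EX) c t) := by
  refine vel_comp_within (g := fun z => P.top.mul (P.top.inv (c t)) z)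
    (S := {z | P.proj z = P.proj (c t)}) ?_ hc h
  have h1 := (P.top.contMDiffOn_mul (P.top.inv (c t), c t)
    (P.top.tgt_inv (c t))).mdifferentiableWithinAt (by simp)
  exact MDifferentiableWithinAt.comp (g := fun p : X × X => P.top.mul p.1 p.2)
    (f := fun z => (P.top.inv (c t), z)) (c t) h1
    (mdifferentiableWithinAt_const.prodMk mdifferentiableWithinAt_id)
    (fun z hz => (P.top.tgt_inv (c t)).trans (P.src_eq_of_proj_eq hz).symm)

/-- `AdL` on the velocity of a curve in the kernel. -/
theorem AdL_vel {x : X} {κ : ℝ → X} (hκ : MDifferentiableAt 𝓘(ℝ, ℝ) 𝓘(ℝ, EX) κ 0)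
    (h : ∀ᶠ s in 𝓝 (0 : ℝ), κ s ∈ P.ker (P.top.tgt x)) (h0 : κ 0 = P.top.unit (P.top.tgt x)) :
    MDifferentiableAt 𝓘(ℝ, ℝ) 𝓘(ℝ, EX)
      (fun s => P.top.mul (P.top.mul x (κ s)) (P.top.inv x)) 0 ∧
    vel 𝓘(ℝ, EX) (fun s => P.top.mul (P.top.mul x (κ s)) (P.top.inv x)) 0 =
      P.AdL x (vel 𝓘(ℝ, EX) κ 0) := by
  have hu := P.unit_mem_ker (P.top.tgt x)
  have hS : ∀ k ∈ P.ker (P.top.tgt x), (x, k) ∈ P.top.composable :=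
    fun k hk => (P.conj_eq hk).1
  have hS' : ∀ k ∈ P.ker (P.top.tgt x), (P.top.mul x k, P.top.inv x) ∈ P.top.composable :=
    fun k hk => (P.conj_eq hk).2
  have h1 : MDifferentiableWithinAt 𝓘(ℝ, EX) 𝓘(ℝ, EX) (fun k => P.top.mul x k)
      (P.ker (P.top.tgt x)) (P.top.unit (P.top.tgt x)) :=
    MDifferentiableWithinAt.comp (g := fun p : X × X => P.top.mul p.1 p.2)
      (f := fun z => (x, z)) (P.top.unit (P.top.tgt x))
      ((P.top.contMDiffOn_mul _ (hS _ hu)).mdifferentiableWithinAt (by simp))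
      (mdifferentiableWithinAt_const.prodMk mdifferentiableWithinAt_id) hS
  have h2 : MDifferentiableWithinAt 𝓘(ℝ, EX) 𝓘(ℝ, EX)
      (fun k => P.top.mul (P.top.mul x k) (P.top.inv x))
      (P.ker (P.top.tgt x)) (P.top.unit (P.top.tgt x)) :=
    MDifferentiableWithinAt.comp (g := fun p : X × X => P.top.mul p.1 p.2)
      (f := fun z => (P.top.mul x z, P.top.inv x)) (P.top.unit (P.top.tgt x))
      ((P.top.contMDiffOn_mul _ (hS' _ hu)).mdifferentiableWithinAt (by simp))
      (h1.prodMk mdifferentiableWithinAt_const) hS'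
  have h3 := vel_comp_within (I := 𝓘(ℝ, EX)) (I' := 𝓘(ℝ, EX)) (c := κ) (t := 0)
    (by rw [h0]; exact h2) hκ h
  rw [h0] at h3
  exact h3

variable [IsManifold 𝓘(ℝ, EX) ∞ X]

theorem exists_vertical_curve {x : X} {v : EX} (hv : P.dproj x v = 0) :
    ∃ c : ℝ → X, ContMDiffAt 𝓘(ℝ, ℝ) 𝓘(ℝ, EX) ∞ c 0 ∧ c 0 = x ∧ vel 𝓘(ℝ, EX) c 0 = v ∧
      ∀ᶠ t in 𝓝 (0 : ℝ), P.proj (c t) = P.proj x :=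
  exists_fibre_curve P.proj_submersion hv

theorem exists_kernel_curve {m : M} {ξ : EX} (hξ : P.dproj (P.top.unit m) ξ = 0) :
    ∃ c : ℝ → X, ContMDiffAt 𝓘(ℝ, ℝ) 𝓘(ℝ, EX) ∞ c 0 ∧ c 0 = P.top.unit m ∧
      vel 𝓘(ℝ, EX) c 0 = ξ ∧ ∀ᶠ t in 𝓝 (0 : ℝ), c t ∈ P.ker m := by
  obtain ⟨c, h1, h2, h3, h4⟩ := P.exists_vertical_curve hξ
  refine ⟨c, h1, h2, h3, ?_⟩
  filter_upwards [h4] with t ht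
  exact ht.trans (P.proj_unit m)

/-- The product of vertical vectors is vertical. -/
theorem dproj_tmL {x y : X} (h : P.top.tgt x = P.top.src y) {u v : EX} (hu : P.dproj x u = 0)
    (hv : P.dproj y v = 0) : P.dproj (P.top.mul x y) (P.top.tmL x y (u, v)) = 0 := by
  obtain ⟨a, ha, ha0, hau, haf⟩ := P.exists_vertical_curve hu
  obtain ⟨b, hb, hb0, hbv, hbf⟩ := P.exists_vertical_curve hv
  have hc : ∀ᶠ s in 𝓝 (0 : ℝ), P.top.tgt (a s) = P.top.src (b s) := by
    filter_upwards [haf, hbf] with s h1 h2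
    rw [P.tgt_eq_of_proj_eq h1, P.src_eq_of_proj_eq h2, h]
  obtain ⟨h1, h2⟩ := P.top.vel_mul (ha.mdifferentiableAt (by simp))
    (hb.mdifferentiableAt (by simp)) hc
  have h3 := P.dproj_vel (x := P.top.mul x y) h1 (by
    filter_upwards [haf, hbf, hc] with s h1 h2 h3
    rw [P.proj_mul _ _ h3, P.proj_mul _ _ h, h1, h2])
  rwa [h2, ha0, hb0, hau, hbv] at h3

theorem lam_curve {x : X} {κ : ℝ → X} (hκ : MDifferentiableAt 𝓘(ℝ, ℝ) 𝓘(ℝ, EX) κ 0)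
    (h : ∀ᶠ s in 𝓝 (0 : ℝ), κ s ∈ P.ker (P.top.tgt x)) (h0 : κ 0 = P.top.unit (P.top.tgt x)) :
    MDifferentiableAt 𝓘(ℝ, ℝ) 𝓘(ℝ, EX) (fun s => P.top.mul x (κ s)) 0 ∧
    vel 𝓘(ℝ, EX) (fun s => P.top.mul x (κ s)) 0 = P.lam x (vel 𝓘(ℝ, EX) κ 0) := by
  have h1 := P.top.vel_mul (a := fun _ => x) (b := κ) (t := 0) mdifferentiableAt_const hκ (by
    filter_upwards [h] with s hs
    exact (P.src_of_mem_ker hs).symm)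
  rw [h0, vel_const] at h1
  exact h1

theorem dproj_lam {x : X} {ξ : EX} (hξ : P.dproj (P.top.unit (P.top.tgt x)) ξ = 0) :
    P.dproj x (P.lam x ξ) = 0 := by
  have h := P.dproj_tmL (x := x) (y := P.top.unit (P.top.tgt x)) (u := 0) (v := ξ)
    (P.top.src_unit _).symm (map_zero _) hξ
  rwa [P.top.mul_unit] at h

/-- Take a curve c in the fibre through `x` with velocity `v` and set κ = x⁻¹ c. This reduces
statements about vertical vectors to groupoid identities between curves. -/
theorem exists_kernel_curve_of_vert {x : X} {v : EX} (hv : P.dproj x v = 0) :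
    ∃ κ : ℝ → X, MDifferentiableAt 𝓘(ℝ, ℝ) 𝓘(ℝ, EX) κ 0 ∧
      κ 0 = P.top.unit (P.top.tgt x) ∧ (∀ᶠ s in 𝓝 (0 : ℝ), κ s ∈ P.ker (P.top.tgt x)) ∧
      vel 𝓘(ℝ, EX) κ 0 = P.AL x v ∧
      MDifferentiableAt 𝓘(ℝ, ℝ) 𝓘(ℝ, EX) (fun s => P.top.mul x (κ s)) 0 ∧
      vel 𝓘(ℝ, EX) (fun s => P.top.mul x (κ s)) 0 = v := by
  obtain ⟨c, hc, h0, hcv, hf⟩ := P.exists_vertical_curve hv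
  have hf' : ∀ᶠ s in 𝓝 (0 : ℝ), P.proj (c s) = P.proj (c 0) := by rwa [h0]
  obtain ⟨h1, h2⟩ := P.AL_vel (hc.mdifferentiableAt (by simp)) hf'
  rw [h0] at h1 h2
  have h3 : (fun s => P.top.mul x (P.top.mul (P.top.inv x) (c s))) =ᶠ[𝓝 (0 : ℝ)] c := by
    filter_upwards [hf] with s hs
    exact P.top.mul_inv_cancel_left (P.src_eq_of_proj_eq hs).symm
  refine ⟨_, h1, ?_, ?_, by rw [h2, hcv], ?_, ?_⟩
  · rw [h0, P.top.inv_mul]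
  · filter_upwards [hf] with s hs
    exact P.inv_mul_mem_ker hs
  · exact (hc.mdifferentiableAt (by simp)).congr_of_eventuallyEq h3
  · rw [vel_congr h3, hcv]

theorem dproj_AL {x : X} {v : EX} (hv : P.dproj x v = 0) :
    P.dproj (P.top.unit (P.top.tgt x)) (P.AL x v) = 0 := by
  obtain ⟨κ, h1, h0, hk, h2, -, -⟩ := P.exists_kernel_curve_of_vert hv
  have h3 := P.dproj_vel (x := P.top.unit (P.top.tgt x)) h1 (by
    filter_upwards [hk] with s hs
    exact P.proj_eq_of_mem_ker hs)
  rwa [h0, h2] at h3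

/-- The velocity form of x (x⁻¹ z) = z: the element extracted by `AL` has `v` as its right
fundamental vector. -/
theorem lam_AL {x : X} {v : EX} (hv : P.dproj x v = 0) : P.lam x (P.AL x v) = v := by
  obtain ⟨κ, h1, h0, hk, h2, h3, h4⟩ := P.exists_kernel_curve_of_vert hv
  rw [← h2, ← (P.lam_curve h1 hk h0).2, h4]

theorem AL_unit {m : M} {ξ : EX} (hξ : P.dproj (P.top.unit m) ξ = 0) :
    P.AL (P.top.unit m) ξ = ξ := by
  obtain ⟨c, hc, h0, hcv, hk⟩ := P.exists_kernel_curve hξ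
  have h1 := (P.AL_vel (hc.mdifferentiableAt (by simp)) (by
    filter_upwards [hk] with s hs
    rw [h0, P.proj_eq_of_mem_ker hs])).2
  rw [h0, hcv] at h1
  rw [← h1, ← hcv]
  apply vel_congr
  filter_upwards [hk] with s hs
  rw [P.top.inv_unit]
  have h2 := P.top.unit_mul (c s)
  rwa [P.src_of_mem_ker hs] at h2

/-- `AL` of a product with a zero vector on the left. -/
theorem AL_tmL_right {x y : X} (h : P.top.tgt x = P.top.src y) {v : EX} (hv : P.dproj y v = 0) :
    P.AL (P.top.mul x y) (P.top.tmL x y (0, v)) = P.AL y v := by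
  obtain ⟨b, hb, hb0, hbv, hbf⟩ := P.exists_vertical_curve hv
  have hbm := hb.mdifferentiableAt (n := ∞) (by simp)
  have hc : ∀ᶠ s in 𝓝 (0 : ℝ), P.top.tgt x = P.top.src (b s) := by
    filter_upwards [hbf] with s h2
    rw [P.src_eq_of_proj_eq h2, h]
  obtain ⟨h1, h2⟩ := P.top.vel_mul (a := fun _ => x) mdifferentiableAt_const hbm hc
  rw [vel_const, hb0, hbv] at h2
  have h3 := (P.AL_vel h1 (by
    filter_upwards [hbf, hc] with s h1 h3
    rw [P.proj_mul _ _ h3, hb0, P.proj_mul _ _ h, h1])).2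
  have h4 := (P.AL_vel hbm (by rwa [hb0])).2
  rw [h2, hb0] at h3
  rw [hbv, hb0] at h4
  rw [← h3, ← h4]
  apply vel_congr
  -- The underlying identity is (x y)⁻¹ (x b) = y⁻¹ b.
  filter_upwards [hc] with s hs
  have h5 : P.top.tgt (P.top.inv y) = P.top.src (P.top.inv x) := by
    rw [P.top.tgt_inv, P.top.src_inv, h]
  rw [P.top.inv_mul_rev h, P.top.mul_assoc _ _ _ h5
    (by rw [P.top.tgt_inv, P.top.src_mul _ _ hs]), P.top.inv_mul_cancel_left hs]

/-- `AL` of a product with a zero vector on the right. -/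
theorem AL_tmL_left {x y : X} (h : P.top.tgt x = P.top.src y) {u : EX} (hu : P.dproj x u = 0) :
    P.AL (P.top.mul x y) (P.top.tmL x y (u, 0)) = P.AdL (P.top.inv y) (P.AL x u) := by
  obtain ⟨κ, h1, h0, hk, h2, h3, h4⟩ := P.exists_kernel_curve_of_vert hu
  have hty : P.top.tgt (P.top.inv y) = P.top.tgt x := by rw [P.top.tgt_inv, h]
  have hxk : ∀ k ∈ P.ker (P.top.tgt x), P.top.tgt (P.top.mul x k) = P.top.src y := by
    intro k hk
    rw [P.top.tgt_mul _ _ (P.src_of_mem_ker hk).symm, P.tgt_of_mem_ker hk, h]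
  have hc : ∀ᶠ s in 𝓝 (0 : ℝ), P.top.tgt (P.top.mul x (κ s)) = P.top.src y := by
    filter_upwards [hk] with s hs
    exact hxk _ hs
  obtain ⟨h5, h6⟩ := P.top.vel_mul (b := fun _ => y) h3 mdifferentiableAt_const hc
  have hx0 : P.top.mul x (κ 0) = x := by rw [h0, P.top.mul_unit]
  rw [vel_const, hx0, h4] at h6
  have h7 := (P.AL_vel h5 (by
    filter_upwards [hk, hc] with s h1 h3
    rw [P.proj_mul _ _ h3, hx0, P.proj_mul _ _ h, P.proj_mul_ker h1])).2
  rw [h6, hx0] at h7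
  have h8 := (P.AdL_vel (x := P.top.inv y) h1 (by rwa [hty]) (by rw [hty, h0])).2
  rw [h2] at h8
  rw [← h7, ← h8]
  apply vel_congr
  -- The underlying identity is (x y)⁻¹ (x κ y) = y⁻¹ κ y, whose right-hand side is the conjugation
  -- defining Ad at y⁻¹.
  filter_upwards [hk] with s hs
  have e1 : P.top.tgt x = P.top.src (κ s) := (P.src_of_mem_ker hs).symm
  have e2 : P.top.tgt (κ s) = P.top.src y := by rw [P.tgt_of_mem_ker hs, h]
  have e3 : P.top.tgt (P.top.inv y) = P.top.src (P.top.inv x) := by rw [hty, P.top.src_inv]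
  have e4 : P.top.tgt (P.top.inv y) = P.top.src (κ s) := by rw [hty, e1]
  rw [P.top.inv_inv, P.top.inv_mul_rev h, P.top.mul_assoc x _ _ e1 e2,
    P.top.mul_assoc _ _ _ e3 (by
      rw [P.top.tgt_inv, P.top.src_mul _ _ (by rw [P.top.src_mul _ _ e2, e1])]),
    P.top.inv_mul_cancel_left (by rw [P.top.src_mul _ _ e2, e1]), P.top.mul_assoc _ _ _ e4 e2]

end LieGrpdExt

/-! ### Smooth dependence of products with a zero vector -/

namespace LieGrpd

variable {EG : Type*} [NormedAddCommGroup EG] [NormedSpace ℝ EG]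
  {EM : Type*} [NormedAddCommGroup EM] [NormedSpace ℝ EM]
  {G : Type*} [TopologicalSpace G] [ChartedSpace EG G] [IsManifold 𝓘(ℝ, EG) ∞ G]
  {M : Type*} [TopologicalSpace M] [ChartedSpace EM M]
  (Γ : LieGrpd (EG := EG) (EM := EM) G M)

section Product

variable {E₀ : Type*} [NormedAddCommGroup E₀] [NormedSpace ℝ E₀]
  {H₀ : Type*} [TopologicalSpace H₀] {I₀ : ModelWithCorners ℝ E₀ H₀}
  {N : Type*} [TopologicalSpace N] [ChartedSpace H₀ N]

/-- A product with a zero vector on the left is a partial differential of the smooth extension of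
the multiplication. The two agree because `w` is tangent to the source fibres. -/
theorem smoothAlong_tmL_right [IsManifold I₀ 1 N] {a b : N → G} {n : N} {w : N → EG}
    (ha : ContMDiffAt I₀ 𝓘(ℝ, EG) ∞ a n) (hw : SmoothAlong I₀ b w n)
    (hc : ∀ᶠ y in 𝓝 n, Γ.tgt (a y) = Γ.src (b y))
    (hv : ∀ᶠ y in 𝓝 n, md 𝓘(ℝ, EG) 𝓘(ℝ, EM) Γ.src (b y) (w y) = 0) :
    SmoothAlong I₀ (fun y => Γ.mul (a y) (b y)) (fun y => Γ.tmL (a y) (b y) (0, w y)) n := by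
  obtain ⟨μ, hμ, hext, hr, -⟩ := Γ.exists_mul_extension hc.self_of_nhds
  have hab : Tendsto (fun y => (a y, b y)) (𝓝 n) (𝓝 (a n, b n)) :=
    ha.continuousAt.tendsto.prodMk_nhds hw.base.continuousAt.tendsto
  have hf : ContMDiffAt (I₀.prod 𝓘(ℝ, EG)) 𝓘(ℝ, EG) ∞
      (Function.uncurry fun y z => μ (a y, z)) (n, b n) :=
    ContMDiffAt.comp (g := μ) (f := fun q : N × G => (a q.1, q.2)) (n, b n) hμ
      ((ContMDiffAt.comp (g := a) (f := Prod.fst) (n, b n) ha contMDiffAt_fst).prodMk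
        contMDiffAt_snd)
  refine (SmoothAlong.md_apply hf hw).congr ?_ ?_
  · filter_upwards [hab.eventually hext, hc] with y h1 h2
    exact h1 h2
  · filter_upwards [hab.eventually hr, hc, hv] with y h1 h2 h3
    exact h1 h2 _ h3

/-- Since `w` vanishes at time zero, the motion of the base points `a s`, `b s` does not contribute
to the derivative: only the linear map at the initial pair survives. -/
theorem hasDerivAt_tmL_right {a b : ℝ → G} {w : ℝ → EG} {w' : EG}
    (ha : ContMDiffAt 𝓘(ℝ, ℝ) 𝓘(ℝ, EG) ∞ a 0) (hb : ContMDiffAt 𝓘(ℝ, ℝ) 𝓘(ℝ, EG) ∞ b 0)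
    (hc : ∀ᶠ s in 𝓝 (0 : ℝ), Γ.tgt (a s) = Γ.src (b s))
    (hv : ∀ᶠ s in 𝓝 (0 : ℝ), md 𝓘(ℝ, EG) 𝓘(ℝ, EM) Γ.src (b s) (w s) = 0) (hw0 : w 0 = 0)
    (hw : HasDerivAt (fun s => tc EG (b 0) (b s) (w s)) w' 0)
    (hv' : md 𝓘(ℝ, EG) 𝓘(ℝ, EM) Γ.src (b 0) w' = 0) :
    HasDerivAt (fun s => tc EG (Γ.mul (a 0) (b 0)) (Γ.mul (a s) (b s))
      (Γ.tmL (a s) (b s) (0, w s))) (Γ.tmL (a 0) (b 0) (0, w')) 0 := by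
  obtain ⟨μ, hμ, hext, hr, -⟩ := Γ.exists_mul_extension hc.self_of_nhds
  have hab : Tendsto (fun y => (a y, b y)) (𝓝 0) (𝓝 (a 0, b 0)) :=
    ha.continuousAt.tendsto.prodMk_nhds hb.continuousAt.tendsto
  have hf : ContMDiffAt (𝓘(ℝ, ℝ).prod 𝓘(ℝ, EG)) 𝓘(ℝ, EG) ∞
      (Function.uncurry fun y z => μ (a y, z)) (0, b 0) :=
    ContMDiffAt.comp (g := μ) (f := fun q : ℝ × G => (a q.1, q.2)) ((0 : ℝ), b 0) hμ
      ((ContMDiffAt.comp (g := a) (f := Prod.fst) ((0 : ℝ), b 0) ha contMDiffAt_fst).prodMk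
        contMDiffAt_snd)
  have h := hasDerivAt_md_of_vanishing hf hb hw0 hw
  have h1 := hr.self_of_nhds hc.self_of_nhds w' hv'
  have h2 : μ (a 0, b 0) = Γ.mul (a 0) (b 0) := hext.self_of_nhds hc.self_of_nhds
  rw [h1] at h
  refine h.congr_of_eventuallyEq ?_
  filter_upwards [hab.eventually hext, hab.eventually hr, hc, hv] with y h3 h4 h5 h6
  rw [h2, h3 h5, h4 h5 _ h6]

theorem hasDerivAt_tmL_left {a b : ℝ → G} {w : ℝ → EG} {w' : EG}
    (ha : ContMDiffAt 𝓘(ℝ, ℝ) 𝓘(ℝ, EG) ∞ a 0) (hb : ContMDiffAt 𝓘(ℝ, ℝ) 𝓘(ℝ, EG) ∞ b 0)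
    (hc : ∀ᶠ s in 𝓝 (0 : ℝ), Γ.tgt (a s) = Γ.src (b s))
    (hv : ∀ᶠ s in 𝓝 (0 : ℝ), md 𝓘(ℝ, EG) 𝓘(ℝ, EM) Γ.tgt (a s) (w s) = 0) (hw0 : w 0 = 0)
    (hw : HasDerivAt (fun s => tc EG (a 0) (a s) (w s)) w' 0)
    (hv' : md 𝓘(ℝ, EG) 𝓘(ℝ, EM) Γ.tgt (a 0) w' = 0) :
    HasDerivAt (fun s => tc EG (Γ.mul (a 0) (b 0)) (Γ.mul (a s) (b s))
      (Γ.tmL (a s) (b s) (w s, 0))) (Γ.tmL (a 0) (b 0) (w', 0)) 0 := by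
  obtain ⟨μ, hμ, hext, -, hl⟩ := Γ.exists_mul_extension hc.self_of_nhds
  have hab : Tendsto (fun y => (a y, b y)) (𝓝 0) (𝓝 (a 0, b 0)) :=
    ha.continuousAt.tendsto.prodMk_nhds hb.continuousAt.tendsto
  have hf : ContMDiffAt (𝓘(ℝ, ℝ).prod 𝓘(ℝ, EG)) 𝓘(ℝ, EG) ∞
      (Function.uncurry fun y z => μ (z, b y)) (0, a 0) :=
    ContMDiffAt.comp (g := μ) (f := fun q : ℝ × G => (q.2, b q.1)) ((0 : ℝ), a 0) hμ
      (contMDiffAt_snd.prodMk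
        (ContMDiffAt.comp (g := b) (f := Prod.fst) ((0 : ℝ), a 0) hb contMDiffAt_fst))
  have h := hasDerivAt_md_of_vanishing hf ha hw0 hw
  have h1 := hl.self_of_nhds hc.self_of_nhds w' hv'
  have h2 : μ (a 0, b 0) = Γ.mul (a 0) (b 0) := hext.self_of_nhds hc.self_of_nhds
  rw [h1] at h
  refine h.congr_of_eventuallyEq ?_
  filter_upwards [hab.eventually hext, hab.eventually hl, hc, hv] with y h3 h4 h5 h6
  rw [h2, h3 h5, h4 h5 _ h6]

end Product

end LieGrpd

/-! ### Right fundamental vectors and the bracket of the Lie algebra bundle -/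

namespace LieGrpdExt

variable {EX : Type*} [NormedAddCommGroup EX] [NormedSpace ℝ EX]
  {EY : Type*} [NormedAddCommGroup EY] [NormedSpace ℝ EY]
  {EM : Type*} [NormedAddCommGroup EM] [NormedSpace ℝ EM]
  {X : Type*} [TopologicalSpace X] [ChartedSpace EX X] [IsManifold 𝓘(ℝ, EX) ∞ X]
  {Y : Type*} [TopologicalSpace Y] [ChartedSpace EY Y]
  {M : Type*} [TopologicalSpace M] [ChartedSpace EM M]
  (P : LieGrpdExt (EX := EX) (EY := EY) (EM := EM) X Y M)

/-- The differential of the left translation by `x⁻¹` on vertical vectors. -/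
theorem AL_eq_tmL {x : X} {v : EX} (hv : P.dproj x v = 0) :
    P.AL x v = P.top.tmL (P.top.inv x) x (0, v) := by
  obtain ⟨c, hc, h0, hcv, hf⟩ := P.exists_vertical_curve hv
  have h1 := (P.AL_vel (hc.mdifferentiableAt (by simp)) (by rwa [h0])).2
  have h2 := (P.top.vel_mul (a := fun _ => P.top.inv x) mdifferentiableAt_const
    (hc.mdifferentiableAt (n := ∞) (by simp)) (by
      filter_upwards [hf] with s hs
      rw [P.top.tgt_inv, P.src_eq_of_proj_eq hs])).2
  rw [h0, hcv] at h1
  rw [vel_const, h0, hcv] at h2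
  rw [← h1, h2]

theorem lam_unit {m : M} {ξ : EX} (hξ : P.dproj (P.top.unit m) ξ = 0) :
    P.lam (P.top.unit m) ξ = ξ := by
  have h := P.lam_AL hξ
  rwa [P.AL_unit hξ] at h

theorem tmL_unit_left {m : M} {ξ : EX} (hξ : P.dproj (P.top.unit m) ξ = 0) :
    P.top.tmL (P.top.unit m) (P.top.unit m) (ξ, 0) = ξ := by
  obtain ⟨c, hc, h0, hcv, hk⟩ := P.exists_kernel_curve hξ
  have h2 := (P.top.vel_mul (b := fun _ => P.top.unit m)
    (hc.mdifferentiableAt (n := ∞) (by simp)) mdifferentiableAt_const (by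
      filter_upwards [hk] with s hs
      rw [P.top.src_unit, P.tgt_of_mem_ker hs])).2
  rw [vel_const, h0, hcv] at h2
  rw [← h2]
  refine Eq.trans ?_ hcv
  apply vel_congr
  filter_upwards [hk] with s hs
  have := P.top.mul_unit (c s)
  rwa [P.tgt_of_mem_ker hs] at this

theorem tmL_unit_right {m : M} {ξ : EX} (hξ : P.dproj (P.top.unit m) ξ = 0) :
    P.top.tmL (P.top.unit m) (P.top.unit m) (0, ξ) = ξ := by
  have h := P.lam_unit hξ
  unfold lam at h
  rwa [P.top.tgt_unit] at h

/-- Smoothness of the right fundamental vectors of a smooth section along a map. -/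
theorem smoothAlong_lam {E₀ : Type*} [NormedAddCommGroup E₀] [NormedSpace ℝ E₀]
    {H₀ : Type*} [TopologicalSpace H₀] {I₀ : ModelWithCorners ℝ E₀ H₀}
    {N : Type*} [TopologicalSpace N] [ChartedSpace H₀ N] [IsManifold I₀ 1 N]
    {g : N → X} {η : N → EX} {n : N} (hg : ContMDiffAt I₀ 𝓘(ℝ, EX) ∞ g n)
    (hη : SmoothAlong I₀ (fun y => P.top.unit (P.top.tgt (g y))) η n)
    (hv : ∀ᶠ y in 𝓝 n, P.dproj (P.top.unit (P.top.tgt (g y))) (η y) = 0) :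
    SmoothAlong I₀ g (fun y => P.lam (g y) (η y)) n := by
  refine (P.top.smoothAlong_tmL_right hg hη ?_ ?_).congr ?_ ?_
  · exact .of_forall fun y => (P.top.src_unit _).symm
  · filter_upwards [hv] with y hy
    exact P.md_src_of_vert hy
  · exact .of_forall fun y => P.top.mul_unit _
  · exact .of_forall fun y => rfl

section Bracket

/-- Near the unit the conjugation of the kernel has a smooth extension. -/
theorem exists_conj_extension (m : M) :
    ∃ Ψ : X × X → X, ContMDiffAt (𝓘(ℝ, EX).prod 𝓘(ℝ, EX)) 𝓘(ℝ, EX) ∞ Ψ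
        (P.top.unit m, P.top.unit m) ∧
      ∀ᶠ p in 𝓝 (P.top.unit m, P.top.unit m), p.1 ∈ P.ker m → p.2 ∈ P.ker m →
        Ψ p = P.top.mul (P.top.mul p.1 p.2) (P.top.inv p.1) := by
  have h11 : P.top.tgt (P.top.unit m) = P.top.src (P.top.unit m) := by
    rw [P.top.tgt_unit, P.top.src_unit]
  obtain ⟨μ, hμ, hext, -, -⟩ := P.top.exists_mul_extension h11
  have hm : P.top.mul (P.top.unit m) (P.top.unit m) = P.top.unit m := by
    have := P.top.mul_unit (P.top.unit m)
    rwa [P.top.tgt_unit] at this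
  have hμ1 : μ (P.top.unit m, P.top.unit m) = P.top.unit m :=
    (hext.self_of_nhds h11).trans hm
  have hpair : ContMDiffAt (𝓘(ℝ, EX).prod 𝓘(ℝ, EX)) (𝓘(ℝ, EX).prod 𝓘(ℝ, EX)) ∞
      (fun p : X × X => (μ p, P.top.inv p.1)) (P.top.unit m, P.top.unit m) :=
    hμ.prodMk (ContMDiffAt.comp (g := P.top.inv) (f := Prod.fst) _
      P.top.contMDiff_inv.contMDiffAt contMDiffAt_fst)
  have hval : (μ (P.top.unit m, P.top.unit m), P.top.inv (P.top.unit m)) =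
      (P.top.unit m, P.top.unit m) := by rw [hμ1, P.top.inv_unit]
  refine ⟨fun p => μ (μ p, P.top.inv p.1), ?_, ?_⟩
  · refine ContMDiffAt.comp (g := μ) (f := fun p : X × X => (μ p, P.top.inv p.1)) _ ?_ hpair
    rw [hval]; exact hμ
  · have ht := hpair.continuousAt.tendsto
    rw [hval] at ht
    filter_upwards [hext, ht.eventually hext] with p h1 h2 hp1 hp2
    have h3 := h1 ((P.tgt_of_mem_ker hp1).trans (P.src_of_mem_ker hp2).symm)
    have h4 : P.top.tgt (μ p) = P.top.src (P.top.inv p.1) := by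
      rw [h3, P.tgt_of_mem_ker (P.mul_mem_ker hp1 hp2), P.top.src_inv, P.tgt_of_mem_ker hp1]
    refine (h2 h4).trans ?_
    simp only [h3]

/-- The bracket is a derivative within the kernel, which has its intended meaning only if this
differentiability holds. On the kernel, `P.AdL k ζ` is the partial differential at the unit of a
smooth extension of conjugation, hence depends smoothly on `k`. -/
theorem mdifferentiableWithinAt_AdL {m : M} {ζ : EX} (hζ : P.dproj (P.top.unit m) ζ = 0) :
    MDifferentiableWithinAt 𝓘(ℝ, EX) 𝓘(ℝ, EX) (fun k : X => P.AdL k ζ) (P.ker m)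
      (P.top.unit m) := by
  obtain ⟨Ψ, hΨ, hext⟩ := P.exists_conj_extension m
  have h1 : SmoothAlong 𝓘(ℝ, EX) (fun _ : X => P.top.unit m) (fun _ => ζ) (P.top.unit m) := by
    rw [smoothAlong_iff (p := P.top.unit m) (by simp)]
    exact ⟨contMDiffAt_const, contMDiffAt_const⟩
  have h2 := SmoothAlong.md_apply (I₀ := 𝓘(ℝ, EX)) (f := fun y z => Ψ (y, z)) hΨ h1
  have hm : P.top.mul (P.top.unit m) (P.top.unit m) = P.top.unit m := by
    have := P.top.mul_unit (P.top.unit m)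
    rwa [P.top.tgt_unit] at this
  have hu := P.unit_mem_ker m
  have h0 : Ψ (P.top.unit m, P.top.unit m) = P.top.unit m := by
    rw [hext.self_of_nhds hu hu, P.top.inv_unit, hm, hm]
  have h3 := h2.fiber (p := P.top.unit m) (by simp [h0])
  have hd : ∀ᶠ p in 𝓝 (P.top.unit m, P.top.unit m),
      MDifferentiableAt (𝓘(ℝ, EX).prod 𝓘(ℝ, EX)) 𝓘(ℝ, EX) Ψ p := by
    have h1 : ∀ᶠ p in 𝓝 (P.top.unit m, P.top.unit m),
        ContMDiffAt (𝓘(ℝ, EX).prod 𝓘(ℝ, EX)) 𝓘(ℝ, EX) 1 Ψ p :=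
      (contMDiffAt_iff_contMDiffAt_nhds (by simp)).1 (hΨ.of_le (one_le_two.trans two_le_infty))
    filter_upwards [h1] with p hp
    exact hp.mdifferentiableAt (by simp)
  -- Conjugation by a kernel element fixes the unit, so the image vector stays in one tangent space
  -- and needs no change of chart. The differential is compared with `AdL` on a kernel curve with
  -- velocity `ζ`.
  have key : ∀ᶠ k in 𝓝 (P.top.unit m), k ∈ P.ker m →
      Ψ (k, P.top.unit m) = P.top.unit m ∧
      md 𝓘(ℝ, EX) 𝓘(ℝ, EX) (fun z => Ψ (k, z)) (P.top.unit m) ζ = P.AdL k ζ := by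
    filter_upwards [hext.curry_nhds, hd.curry_nhds] with k hk hk' hkm
    have hkt := P.tgt_of_mem_ker hkm
    have hks := P.src_of_mem_ker hkm
    refine ⟨?_, ?_⟩
    · rw [hk.self_of_nhds hkm hu]
      have := P.top.mul_unit k
      rw [hkt] at this
      simp only [this]
      rw [P.top.mul_inv, hks]
    · obtain ⟨κ, hκ, hκ0, hκv, hκk⟩ := P.exists_kernel_curve hζ
      have hκm := hκ.mdifferentiableAt (n := ∞) (by simp)
      have e1 := (P.AdL_vel (x := k) hκm (by rwa [hkt]) (by rw [hκ0, hkt])).2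
      have hz : MDifferentiableAt 𝓘(ℝ, EX) 𝓘(ℝ, EX) (fun z => Ψ (k, z)) (P.top.unit m) :=
        MDifferentiableAt.comp (g := Ψ) (f := fun z => (k, z)) _ hk'.self_of_nhds
          (mdifferentiableAt_const.prodMk mdifferentiableAt_id)
      have e2 := vel_comp (g := fun z => Ψ (k, z)) (c := κ) (t := 0) (by rw [hκ0]; exact hz) hκm
      rw [hκ0, hκv] at e2
      rw [hκv] at e1
      rw [← e2, ← e1]
      apply vel_congr
      have ht := hκ.continuousAt.tendsto
      rw [hκ0] at ht
      filter_upwards [ht.eventually hk, hκk] with s h1 h2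
      exact h1 hkm h2
  have h4 := (h3.mdifferentiableAt (by simp)).mdifferentiableWithinAt (s := P.ker m)
  refine h4.congr_of_eventuallyEq ?_ ?_
  · filter_upwards [self_mem_nhdsWithin, nhdsWithin_le_nhds key] with k hk h5
    obtain ⟨e1, e2⟩ := h5 hk
    simp only [e1, e2, tc_self]
    rfl
  · obtain ⟨e1, e2⟩ := key.self_of_nhds hu
    simp only [e1, e2, tc_self]
    rfl

/-- The bracket as a linear map of its first argument. -/
def brkL (m : M) (ζ : EX) : EX →L[ℝ] EX :=
  mdWithin 𝓘(ℝ, EX) 𝓘(ℝ, EX) (fun k : X => P.AdL k ζ) (P.ker m) (P.top.unit m)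

/-- The direction of differentiation is the last argument of `brkL`: the value `P.brkL m ζ η` is the
bracket [η, ζ]. -/
theorem hasDerivAt_AdL {m : M} {ζ η : EX} (hζ : P.dproj (P.top.unit m) ζ = 0) {k : ℝ → X}
    (hk : MDifferentiableAt 𝓘(ℝ, ℝ) 𝓘(ℝ, EX) k 0) (hkk : ∀ᶠ s in 𝓝 (0 : ℝ), k s ∈ P.ker m)
    (hk0 : k 0 = P.top.unit m) (hkv : vel 𝓘(ℝ, EX) k 0 = η) :
    HasDerivAt (fun s => P.AdL (k s) ζ) (P.brkL m ζ η) 0 := by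
  obtain ⟨h1, h2⟩ := vel_comp_within (I' := 𝓘(ℝ, EX)) (g := fun k : X => P.AdL k ζ)
    (S := P.ker m) (c := k) (t := 0) (by rw [hk0]; exact P.mdifferentiableWithinAt_AdL hζ) hk hkk
  have h3 := hasDerivAt_vel h1
  rw [h2, hk0, hkv] at h3
  exact h3

/-- Differentiate k k⁻¹ = 1, using that the product of vertical tangent vectors at a unit is their
sum. -/
theorem vel_inv_kernel {m : M} {η : EX} {k : ℝ → X}
    (hk : MDifferentiableAt 𝓘(ℝ, ℝ) 𝓘(ℝ, EX) k 0) (hkk : ∀ᶠ s in 𝓝 (0 : ℝ), k s ∈ P.ker m)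
    (hk0 : k 0 = P.top.unit m) (hkv : vel 𝓘(ℝ, EX) k 0 = η) :
    MDifferentiableAt 𝓘(ℝ, ℝ) 𝓘(ℝ, EX) (fun s => P.top.inv (k s)) 0 ∧
    vel 𝓘(ℝ, EX) (fun s => P.top.inv (k s)) 0 = -η := by
  have hi : MDifferentiableAt 𝓘(ℝ, ℝ) 𝓘(ℝ, EX) (fun s => P.top.inv (k s)) 0 :=
    MDifferentiableAt.comp (g := P.top.inv) (0 : ℝ) (P.top.mdifferentiableAt_inv _) hk
  refine ⟨hi, ?_⟩
  have hη : P.dproj (P.top.unit m) η = 0 := by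
    have := P.dproj_vel (x := P.top.unit m) hk (by
      filter_upwards [hkk] with s hs
      exact P.proj_eq_of_mem_ker hs)
    rwa [hk0, hkv] at this
  have hη' : P.dproj (P.top.unit m) (vel 𝓘(ℝ, EX) (fun s => P.top.inv (k s)) 0) = 0 := by
    have := P.dproj_vel (x := P.top.unit m) hi (by
      filter_upwards [hkk] with s hs
      exact P.proj_eq_of_mem_ker (P.inv_mem_ker hs))
    simpa only [hk0, P.top.inv_unit] using this
  have h := (P.top.vel_mul hk hi (.of_forall fun s => (P.top.src_inv _).symm)).2
  rw [hk0, P.top.inv_unit, hkv] at h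
  have h5 : vel 𝓘(ℝ, EX) (fun s => P.top.mul (k s) (P.top.inv (k s))) 0 = 0 := by
    rw [← vel_const (I := 𝓘(ℝ, EX)) (P.top.unit m) (0 : ℝ)]
    apply vel_congr
    filter_upwards [hkk] with s hs
    rw [P.top.mul_inv, P.src_of_mem_ker hs]
  rw [h5] at h
  have h6 : ((η, vel 𝓘(ℝ, EX) (fun s => P.top.inv (k s)) 0) : EX × EX) =
      (η, 0) + (0, vel 𝓘(ℝ, EX) (fun s => P.top.inv (k s)) 0) := by simp
  rw [h6, map_add, P.tmL_unit_left hη, P.tmL_unit_right hη'] at h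
  exact (neg_eq_of_add_eq_zero_right h.symm).symm

theorem hasDerivAt_AdL_inv {m : M} {ζ η : EX} (hζ : P.dproj (P.top.unit m) ζ = 0) {k : ℝ → X}
    (hk : MDifferentiableAt 𝓘(ℝ, ℝ) 𝓘(ℝ, EX) k 0) (hkk : ∀ᶠ s in 𝓝 (0 : ℝ), k s ∈ P.ker m)
    (hk0 : k 0 = P.top.unit m) (hkv : vel 𝓘(ℝ, EX) k 0 = η) :
    HasDerivAt (fun s => P.AdL (P.top.inv (k s)) ζ) (-P.brkL m ζ η) 0 := by
  obtain ⟨h1, h2⟩ := P.vel_inv_kernel hk hkk hk0 hkv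
  have h3 := P.hasDerivAt_AdL hζ h1 (by
    filter_upwards [hkk] with s hs
    exact P.inv_mem_ker hs) (by rw [hk0, P.top.inv_unit]) h2
  rwa [map_neg] at h3

/-- Each Ad_k is linear. Along a kernel curve with velocity `η` the two sides are derivatives of the
same function. -/
theorem brkL_add {m : M} {ζ ζ' η : EX} (hη : P.dproj (P.top.unit m) η = 0)
    (hζ : P.dproj (P.top.unit m) ζ = 0) (hζ' : P.dproj (P.top.unit m) ζ' = 0) :
    P.brkL m (ζ + ζ') η = P.brkL m ζ η + P.brkL m ζ' η := by
  obtain ⟨κ, hκ, hκ0, hκv, hκk⟩ := P.exists_kernel_curve hη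
  have hκm := hκ.mdifferentiableAt (n := ∞) (by simp)
  have h1 := P.hasDerivAt_AdL hζ hκm hκk hκ0 hκv
  have h2 := P.hasDerivAt_AdL hζ' hκm hκk hκ0 hκv
  have h3 := P.hasDerivAt_AdL (by rw [map_add, hζ, hζ', add_zero]) hκm hκk hκ0 hκv
    (ζ := ζ + ζ')
  simp only [map_add] at h3
  exact h3.unique (h1.add h2)

theorem brkL_zero {m : M} {η : EX} (hη : P.dproj (P.top.unit m) η = 0) : P.brkL m 0 η = 0 := by
  have := P.brkL_add hη (ζ := 0) (ζ' := 0) (map_zero _) (map_zero _)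
  rw [add_zero] at this
  exact left_eq_add.1 this

theorem brkL_neg {m : M} {ζ η : EX} (hη : P.dproj (P.top.unit m) η = 0)
    (hζ : P.dproj (P.top.unit m) ζ = 0) : P.brkL m (-ζ) η = -P.brkL m ζ η := by
  have := P.brkL_add hη hζ (ζ' := -ζ) (by rw [map_neg, hζ, neg_zero])
  rw [add_neg_cancel, P.brkL_zero hη] at this
  exact (neg_eq_of_add_eq_zero_right this.symm).symm

end Bracket

end LieGrpdExt

/-! ### Multiplicativity and smoothness of the connection form -/

namespace LieGrpdExt

variable {EX : Type*} [NormedAddCommGroup EX] [NormedSpace ℝ EX] [FiniteDimensional ℝ EX]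
  {EY : Type*} [NormedAddCommGroup EY] [NormedSpace ℝ EY]
  {EM : Type*} [NormedAddCommGroup EM] [NormedSpace ℝ EM]
  {X : Type*} [TopologicalSpace X] [ChartedSpace EX X] [IsManifold 𝓘(ℝ, EX) ∞ X]
  {Y : Type*} [TopologicalSpace Y] [ChartedSpace EY Y]
  {M : Type*} [TopologicalSpace M] [ChartedSpace EM M]
  {P : LieGrpdExt (EX := EX) (EY := EY) (EM := EM) X Y M}

namespace Connection

variable (C : P.Connection)

/-- The projection onto the vertical vectors as a continuous linear map. -/
def vr (x : X) : EX →L[ℝ] EX :=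
  LinearMap.toContinuousLinearMap (E := EX) (F' := EX)
    ((P.vert x).projection (C.hor x) (C.isCompl x))

/-- The connection form as a continuous linear map. -/
def fm (x : X) : EX →L[ℝ] EX := (P.AL x).comp (C.vr x)

theorem smoothEnd_vr : SmoothEnd C.vr := C.contMDiff_projection

theorem dproj_vr (x : X) (v : EX) : P.dproj x (C.vr x v) = 0 :=
  Submodule.projection_apply_mem (C.isCompl x) v

theorem vr_of_vert {x : X} {v : EX} (h : P.dproj x v = 0) : C.vr x v = v :=
  Submodule.projection_apply_of_mem_left (C.isCompl x) (x := v) h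

theorem vr_eq_zero_iff {x : X} {v : EX} : C.vr x v = 0 ↔ v ∈ C.hor x :=
  Submodule.projection_apply_eq_zero_iff (C.isCompl x)

theorem vr_vr (x : X) (v : EX) : C.vr x (C.vr x v) = C.vr x v := C.vr_of_vert (C.dproj_vr x v)

theorem vr_sub_vr (x : X) (v : EX) : C.vr x (v - C.vr x v) = 0 := by
  rw [map_sub, C.vr_vr, sub_self]

/-- Source and target annihilate vertical vectors, so the horizontal parts are again composable and
their product is horizontal by `tmul_mem`. The product of the vertical parts is vertical, so it is
the vertical part. -/
theorem vr_tmL {x y : X} (h : P.top.tgt x = P.top.src y) {u v : EX}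
    (huv : md 𝓘(ℝ, EX) 𝓘(ℝ, EM) P.top.tgt x u = md 𝓘(ℝ, EX) 𝓘(ℝ, EM) P.top.src y v) :
    C.vr (P.top.mul x y) (P.top.tmL x y (u, v)) = P.top.tmL x y (C.vr x u, C.vr y v) := by
  have h1 : P.top.tmL x y (u - C.vr x u, v - C.vr y v) ∈ C.hor (P.top.mul x y) := by
    refine C.tmul_mem x y h _ (C.vr_eq_zero_iff.1 (C.vr_sub_vr x u)) _
      (C.vr_eq_zero_iff.1 (C.vr_sub_vr y v)) ?_
    change md 𝓘(ℝ, EX) 𝓘(ℝ, EM) P.top.tgt x (u - C.vr x u) =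
      md 𝓘(ℝ, EX) 𝓘(ℝ, EM) P.top.src y (v - C.vr y v)
    rw [map_sub, map_sub, P.md_tgt_of_vert (C.dproj_vr x u), P.md_src_of_vert (C.dproj_vr y v), huv]
  have h2 : ((u, v) : EX × EX) =
      (u - C.vr x u, v - C.vr y v) + (C.vr x u, C.vr y v) := by simp
  rw [h2, map_add, map_add, C.vr_eq_zero_iff.2 h1, zero_add]
  exact C.vr_of_vert (P.dproj_tmL h (C.dproj_vr x u) (C.dproj_vr y v))

theorem fm_vr (x : X) (v : EX) : C.fm x (C.vr x v) = C.fm x v := by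
  unfold fm
  simp only [ContinuousLinearMap.comp_apply, C.vr_vr]

theorem fm_of_vert {x : X} {v : EX} (h : P.dproj x v = 0) : C.fm x v = P.AL x v := by
  unfold fm
  rw [ContinuousLinearMap.comp_apply, C.vr_of_vert h]

theorem fm_of_vr_eq_zero {x : X} {v : EX} (h : C.vr x v = 0) : C.fm x v = 0 := by
  rw [← C.fm_vr, h, map_zero]

theorem dproj_fm (x : X) (v : EX) : P.dproj (P.top.unit (P.top.tgt x)) (C.fm x v) = 0 :=
  P.dproj_AL (C.dproj_vr x v)

theorem lam_fm (x : X) (v : EX) : P.lam x (C.fm x v) = C.vr x v := P.lam_AL (C.dproj_vr x v)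

theorem fm_unit {m : M} {ξ : EX} (hξ : P.dproj (P.top.unit m) ξ = 0) :
    C.fm (P.top.unit m) ξ = ξ := by
  rw [C.fm_of_vert hξ, P.AL_unit hξ]

/-- Only the vertical parts matter, and as a pair they split as (u, 0) + (0, v). Translating the
first summand back to the unit conjugates by y⁻¹; the second is unaffected by x. -/
theorem fm_tmL {x y : X} (h : P.top.tgt x = P.top.src y) {u v : EX}
    (huv : md 𝓘(ℝ, EX) 𝓘(ℝ, EM) P.top.tgt x u = md 𝓘(ℝ, EX) 𝓘(ℝ, EM) P.top.src y v) :
    C.fm (P.top.mul x y) (P.top.tmL x y (u, v)) =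
      P.AdL (P.top.inv y) (C.fm x u) + C.fm y v := by
  have h2 : ((C.vr x u, C.vr y v) : EX × EX) = (C.vr x u, 0) + (0, C.vr y v) := by simp
  have h3 : ∀ w, P.dproj (P.top.mul x y) w = 0 → C.fm (P.top.mul x y) w =
      P.AL (P.top.mul x y) w := fun w hw => C.fm_of_vert hw
  have hu := C.dproj_vr x u
  have hv := C.dproj_vr y v
  rw [← C.fm_vr, C.vr_tmL h huv, h2, map_add, map_add,
    h3 _ (P.dproj_tmL h hu (map_zero _)), h3 _ (P.dproj_tmL h (map_zero _) hv),
    P.AL_tmL_left h hu, P.AL_tmL_right h hv]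
  rfl

/-- The tangent vectors to the units are horizontal. -/
theorem vr_md_unit [IsManifold 𝓘(ℝ, EM) ∞ M] (m : M) (v : EM) :
    C.vr (P.top.unit m) (md 𝓘(ℝ, EM) 𝓘(ℝ, EX) P.top.unit m v) = 0 := by
  obtain ⟨n, hn, hn0, hnv⟩ := exists_curve (E := EM) m v
  have h11 : P.top.tgt (P.top.unit m) = P.top.src (P.top.unit m) := by
    rw [P.top.tgt_unit, P.top.src_unit]
  have hnm := hn.mdifferentiableAt (n := ∞) (by simp)
  have hu : MDifferentiableAt 𝓘(ℝ, ℝ) 𝓘(ℝ, EX) (fun s => P.top.unit (n s)) 0 :=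
    MDifferentiableAt.comp (g := P.top.unit) (0 : ℝ) (P.top.mdifferentiableAt_unit _) hnm
  have hw : vel 𝓘(ℝ, EX) (fun s => P.top.unit (n s)) 0 =
      md 𝓘(ℝ, EM) 𝓘(ℝ, EX) P.top.unit m v := by
    rw [vel_comp (P.top.mdifferentiableAt_unit _) hnm, hn0, hnv]
  have hc : ∀ s, P.top.tgt (P.top.unit (n s)) = P.top.src (P.top.unit (n s)) := by
    intro s
    rw [P.top.tgt_unit, P.top.src_unit]
  have h1 := (P.top.vel_mul hu hu (.of_forall hc)).2
  have h2 := P.top.md_tgt_vel_eq hu hu (.of_forall hc)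
  have hmm : ∀ m, P.top.mul (P.top.unit m) (P.top.unit m) = P.top.unit m := by
    intro m
    have := P.top.mul_unit (P.top.unit m)
    rwa [P.top.tgt_unit] at this
  have h3 : (fun s => P.top.mul (P.top.unit (n s)) (P.top.unit (n s))) =
      fun s => P.top.unit (n s) := by
    funext s; exact hmm _
  rw [h3, hw, hn0] at h1
  rw [hw, hn0] at h2
  set w := md 𝓘(ℝ, EM) 𝓘(ℝ, EX) P.top.unit m v
  have h4 := C.vr_tmL h11 h2
  have h5 : ((C.vr (P.top.unit m) w, C.vr (P.top.unit m) w) : EX × EX) =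
    (C.vr (P.top.unit m) w, 0) + (0, C.vr (P.top.unit m) w) := by simp
  have hvw := C.dproj_vr (P.top.unit m) w
  -- From 1 · 1 = 1 one gets w = w · w. The product of vertical vectors at a unit is addition, so
  -- the vertical part of w equals its own double and vanishes.
  rw [← h1, h5, map_add, P.tmL_unit_left hvw, P.tmL_unit_right hvw, hmm] at h4
  exact left_eq_add.1 h4

section Smooth

variable {E₀ : Type*} [NormedAddCommGroup E₀] [NormedSpace ℝ E₀]
  {H₀ : Type*} [TopologicalSpace H₀] {I₀ : ModelWithCorners ℝ E₀ H₀}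
  {N : Type*} [TopologicalSpace N] [ChartedSpace H₀ N] [IsManifold I₀ 1 N]

theorem fm_eq_tmL (x : X) (v : EX) :
    C.fm x v = P.top.tmL (P.top.inv x) x (0, C.vr x v) := P.AL_eq_tmL (C.dproj_vr x v)

/-- The connection form is the tangent product of the zero vector at the inverse with the vertical
part, and both operations preserve smoothness. -/
theorem smoothAlong_fm {g : N → X} {w : N → EX} {n : N} (hw : SmoothAlong I₀ g w n) :
    SmoothAlong I₀ (fun y => P.top.unit (P.top.tgt (g y))) (fun y => C.fm (g y) (w y)) n := by
  have hi : ContMDiffAt I₀ 𝓘(ℝ, EX) ∞ (fun y => P.top.inv (g y)) n :=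
    ContMDiffAt.comp (g := P.top.inv) n P.top.contMDiff_inv.contMDiffAt hw.base
  refine (P.top.smoothAlong_tmL_right hi (C.smoothEnd_vr.along hw) ?_ ?_).congr ?_ ?_
  · exact .of_forall fun y => P.top.tgt_inv _
  · exact .of_forall fun y => P.md_src_of_vert (C.dproj_vr _ _)
  · exact .of_forall fun y => P.top.inv_mul _
  · exact .of_forall fun y => (C.fm_eq_tmL _ _).symm

/-- The derivative of the connection form on vectors vanishing at the origin. -/
theorem hasDerivAt_fm_of_vanishing {c : ℝ → X} {w : ℝ → EX} {w' : EX}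
    (hc : ContMDiffAt 𝓘(ℝ, ℝ) 𝓘(ℝ, EX) ∞ c 0) (hw0 : w 0 = 0)
    (hw : HasDerivAt (fun s => tc EX (c 0) (c s) (w s)) w' 0) :
    HasDerivAt (fun s => tc EX (P.top.unit (P.top.tgt (c 0))) (P.top.unit (P.top.tgt (c s)))
      (C.fm (c s) (w s))) (C.fm (c 0) w') 0 := by
  have hi : ContMDiffAt 𝓘(ℝ, ℝ) 𝓘(ℝ, EX) ∞ (fun y => P.top.inv (c y)) 0 :=
    ContMDiffAt.comp (g := P.top.inv) (0 : ℝ) P.top.contMDiff_inv.contMDiffAt hc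
  have h1 := C.smoothEnd_vr.hasDerivAt hc (p := c 0) (by simp) hw
  have h2 : chartEnd C.vr (c 0) (extChartAt 𝓘(ℝ, EX) (c 0) (c 0)) w' = C.vr (c 0) w' := by
    have := chartEnd_apply C.vr (p := c 0) (y := c 0) (by simp) w'
    simpa only [tc_self, ContinuousLinearMap.id_apply] using this
  -- As `w 0 = 0`, the derivative of the projector does not enter.
  rw [hw0, map_zero, map_zero, zero_add, h2] at h1
  have h3 := P.top.hasDerivAt_tmL_right hi hc (.of_forall fun s => P.top.tgt_inv _)
    (.of_forall fun s => P.md_src_of_vert (C.dproj_vr _ _)) (by rw [hw0, map_zero]) h1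
    (P.md_src_of_vert (C.dproj_vr _ _))
  simp only [← C.fm_eq_tmL, P.top.inv_mul] at h3
  exact h3

end Smooth

end Connection

end LieGrpdExt

/-! ### The induced covariant derivative in charts -/

namespace PlainDeriv

/-- Smooth maps are differentiable near the point. -/
theorem eventually_mdifferentiableAt {E₀ : Type*} [NormedAddCommGroup E₀] [NormedSpace ℝ E₀]
    {H₀ : Type*} [TopologicalSpace H₀] {I₀ : ModelWithCorners ℝ E₀ H₀}
    {N : Type*} [TopologicalSpace N] [ChartedSpace H₀ N] [IsManifold I₀ 1 N]
    {E₁ : Type*} [NormedAddCommGroup E₁] [NormedSpace ℝ E₁]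
    {H₁ : Type*} [TopologicalSpace H₁] {I₁ : ModelWithCorners ℝ E₁ H₁}
    {N₁ : Type*} [TopologicalSpace N₁] [ChartedSpace H₁ N₁] [IsManifold I₁ 1 N₁]
    {f : N → N₁} {n : N} (h : ContMDiffAt I₀ I₁ ∞ f n) :
    ∀ᶠ y in 𝓝 n, MDifferentiableAt I₀ I₁ f y := by
  have h1 : ∀ᶠ y in 𝓝 n, ContMDiffAt I₀ I₁ 1 f y :=
    (contMDiffAt_iff_contMDiffAt_nhds (by simp)).1 (h.of_le (one_le_two.trans two_le_infty))
  filter_upwards [h1] with y hy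
  exact hy.mdifferentiableAt (by simp)

theorem tc_vectorSpace {F : Type*} [NormedAddCommGroup F] [NormedSpace ℝ F] (x y : F) :
    tc F x y = ContinuousLinearMap.id ℝ F := by
  unfold tc
  rw [extChartAt_model_space_eq_id]
  exact md_id _

end PlainDeriv

namespace LieGrpdExt

variable {EX : Type*} [NormedAddCommGroup EX] [NormedSpace ℝ EX] [FiniteDimensional ℝ EX]
  {EY : Type*} [NormedAddCommGroup EY] [NormedSpace ℝ EY]
  {EM : Type*} [NormedAddCommGroup EM] [NormedSpace ℝ EM]
  {X : Type*} [TopologicalSpace X] [ChartedSpace EX X] [IsManifold 𝓘(ℝ, EX) ∞ X]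
  {Y : Type*} [TopologicalSpace Y] [ChartedSpace EY Y] [IsManifold 𝓘(ℝ, EY) ∞ Y]
  {M : Type*} [TopologicalSpace M] [ChartedSpace EM M] [IsManifold 𝓘(ℝ, EM) ∞ M]
  {P : LieGrpdExt (EX := EX) (EY := EY) (EM := EM) X Y M}
  {EN : Type*} [NormedAddCommGroup EN] [NormedSpace ℝ EN]
  {N : Type*} [TopologicalSpace N] [ChartedSpace EN N] [IsManifold 𝓘(ℝ, EN) ∞ N]

/-- `η` is a section of `f^* 𝔎`, smooth at `n`. -/
structure SmoothSec (EN : Type*) [NormedAddCommGroup EN] [NormedSpace ℝ EN]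
    {N : Type*} [TopologicalSpace N] [ChartedSpace EN N]
    (P : LieGrpdExt (EX := EX) (EY := EY) (EM := EM) X Y M) (f : N → M)
    (η : N → EX) (n : N) : Prop where
  smooth : SmoothAlong 𝓘(ℝ, EN) (fun y => P.top.unit (f y)) η n
  vert : ∀ᶠ y in 𝓝 n, P.dproj (P.top.unit (f y)) (η y) = 0

section SmoothSec

variable {f : N → M} {η ζ : N → EX} {n : N}

theorem SmoothSec.add (h : SmoothSec EN P f η n) (h' : SmoothSec EN P f ζ n) :
    SmoothSec EN P f (fun y => η y + ζ y) n := by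
  refine ⟨h.smooth.add h'.smooth, ?_⟩
  filter_upwards [h.vert, h'.vert] with y h1 h2
  rw [map_add, h1, h2, add_zero]

theorem SmoothSec.neg (h : SmoothSec EN P f η n) : SmoothSec EN P f (fun y => -η y) n := by
  refine ⟨h.smooth.neg, ?_⟩
  filter_upwards [h.vert] with y h1
  rw [map_neg, h1, neg_zero]

theorem SmoothSec.congr (h : SmoothSec EN P f η n) (h' : η =ᶠ[𝓝 n] ζ) : SmoothSec EN P f ζ n := by
  refine ⟨h.smooth.congr (.of_forall fun y => rfl) h', ?_⟩
  filter_upwards [h.vert, h'] with y h1 h2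
  rw [← h2, h1]

theorem SmoothSec.contMDiffAt (h : SmoothSec EN P f η n) : ContMDiffAt 𝓘(ℝ, EN) 𝓘(ℝ, EM) ∞ f n := by
  have h1 := ContMDiffAt.comp (g := P.top.tgt) n P.top.contMDiff_tgt.contMDiffAt h.smooth.base
  refine h1.congr_of_eventuallyEq (.of_forall fun y => (P.top.tgt_unit _).symm)

theorem SmoothSec.eventually_mem (h : SmoothSec EN P f η n) {p : X}
    (hp : P.top.unit (f n) ∈ (extChartAt 𝓘(ℝ, EX) p).source) :
    ∀ᶠ y in 𝓝 n, P.top.unit (f y) ∈ (extChartAt 𝓘(ℝ, EX) p).source :=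
  h.smooth.base.continuousAt.eventually ((isOpen_extChartAt_source p).mem_nhds hp)

/-- Every smooth section of the pull back of `𝔎` is the velocity of a family of maps to the
kernel. -/
theorem exists_isFamily (h : SmoothSec EN P f η n) :
    ∃ k : ℝ → N → X, Connection.IsFamily (EN := EN) P f η n k := by
  set p := P.top.unit (f n) with hp
  set e := extChartAt 𝓘(ℝ, EX) p with he
  obtain ⟨ρ, hρ, hρ1, hρ2⟩ := exists_fibre_retraction P.proj_submersion p
  have hps : P.top.unit (f n) ∈ e.source := by simp [he, hp]
  have hφ := h.smooth.fiber (p := p) hps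
  have hbase := h.smooth.base
  have hγ : ContMDiffAt 𝓘(ℝ, EN) 𝓘(ℝ, EX) ∞ (fun y => e (P.top.unit (f y))) n :=
    ContMDiffAt.comp n (contMDiffAt_chart hps) hbase
  have hd : ContMDiffAt (𝓘(ℝ, ℝ).prod 𝓘(ℝ, EN)) 𝓘(ℝ, EX) ∞ (fun q : ℝ × N =>
      e (P.top.unit (f q.2)) + q.1 • tc EX p (P.top.unit (f q.2)) (η q.2)) (0, n) :=
    (ContMDiffAt.comp (f := Prod.snd) ((0 : ℝ), n) hγ contMDiffAt_snd).add
      (contMDiffAt_fst.smul (ContMDiffAt.comp (f := Prod.snd) ((0 : ℝ), n) hφ contMDiffAt_snd))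
  have hd0 : e p + (0 : ℝ) • tc EX p p (η n) = e p := by simp
  have hds : ContMDiffAt (𝓘(ℝ, ℝ).prod 𝓘(ℝ, EN)) 𝓘(ℝ, EX) ∞ (fun q : ℝ × N =>
      e.symm (e (P.top.unit (f q.2)) + q.1 • tc EX p (P.top.unit (f q.2)) (η q.2))) (0, n) := by
    refine ContMDiffAt.comp (g := e.symm) ((0 : ℝ), n) ?_ hd
    refine contMDiffAt_chart_symm ?_
    change e p + (0 : ℝ) • tc EX p p (η n) ∈ _
    rw [hd0]
    exact mem_extChartAt_target p
  have hpr : ContMDiffAt (𝓘(ℝ, ℝ).prod 𝓘(ℝ, EN)) 𝓘(ℝ, EY) ∞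
      (fun q : ℝ × N => P.proj (P.top.unit (f q.2))) (0, n) :=
    ContMDiffAt.comp (f := Prod.snd) ((0 : ℝ), n)
      (ContMDiffAt.comp (g := P.proj) n P.proj_submersion.contMDiff.contMDiffAt hbase)
      contMDiffAt_snd
  have hpair := hpr.prodMk hds
  have hval : (P.proj (P.top.unit (f n)),
      e.symm (e (P.top.unit (f n)) + (0 : ℝ) • tc EX p (P.top.unit (f n)) (η n))) =
      (P.proj p, p) := by
    rw [← hp, hd0]
    congr 1
    simp [he]
  have ht := hpair.continuousAt.tendsto
  rw [hval] at ht
  -- Straight lines with velocity η, in the chart at the unit over `f n`, are pushed into the kernel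
  -- by a retraction onto the fibres of the projection. Verticality of η keeps the velocity
  -- unchanged.
  refine ⟨fun s y => ρ (P.proj (P.top.unit (f y)),
    e.symm (e (P.top.unit (f y)) + s • tc EX p (P.top.unit (f y)) (η y))), ?_, ?_, ?_, ?_⟩
  · refine ContMDiffAt.comp (g := ρ) ((0 : ℝ), n) ?_ hpair
    rw [hval]; exact hρ
  · filter_upwards [ht.eventually hρ1] with q hq
    exact hq.trans (P.proj_unit _)
  · filter_upwards [h.eventually_mem hps, hbase.continuousAt.eventually hρ2] with y hy h2
    simp only [zero_smul, add_zero]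
    rw [e.left_inv hy]
    exact h2
  · have hρd : ∀ᶠ x in 𝓝 p,
        MDifferentiableAt (𝓘(ℝ, EY).prod 𝓘(ℝ, EX)) 𝓘(ℝ, EX) ρ (P.proj x, x) := by
      have h1 : ∀ᶠ q in 𝓝 (P.proj p, p),
          ContMDiffAt (𝓘(ℝ, EY).prod 𝓘(ℝ, EX)) 𝓘(ℝ, EX) 1 ρ q :=
        (contMDiffAt_iff_contMDiffAt_nhds (by simp)).1 (hρ.of_le (one_le_two.trans two_le_infty))
      have h2 : Tendsto (fun x => (P.proj x, x)) (𝓝 p) (𝓝 (P.proj p, p)) :=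
        (P.proj_submersion.contMDiff.continuous.prodMk continuous_id).tendsto p
      filter_upwards [h2.eventually h1] with x hx
      exact hx.mdifferentiableAt (by simp)
    filter_upwards [h.eventually_mem hps, hbase.continuousAt.eventually hρ2.eventually_nhds,
      hbase.continuousAt.eventually hρd, h.vert] with y hy h2 h3 h4
    set z := P.top.unit (f y) with hz
    have hl : ContMDiffAt 𝓘(ℝ, ℝ) 𝓘(ℝ, EX) ∞ (fun s : ℝ => e z + s • tc EX p z (η y)) 0 := by
      apply ContDiffAt.contMDiffAt; fun_prop
    have hd0' : e.symm (e z + (0 : ℝ) • tc EX p z (η y)) = z := by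
      rw [zero_smul, add_zero, e.left_inv hy]
    have hsm : ContMDiffAt 𝓘(ℝ, EX) 𝓘(ℝ, EX) ∞ e.symm (e z + (0 : ℝ) • tc EX p z (η y)) := by
      apply contMDiffAt_chart_symm
      rw [zero_smul, add_zero]
      exact e.map_source hy
    have hdm : MDifferentiableAt 𝓘(ℝ, ℝ) 𝓘(ℝ, EX)
        (fun s : ℝ => e.symm (e z + s • tc EX p z (η y))) 0 :=
      (ContMDiffAt.comp (0 : ℝ) hsm hl).mdifferentiableAt (by simp)
    have hdv : vel 𝓘(ℝ, EX) (fun s : ℝ => e.symm (e z + s • tc EX p z (η y))) 0 = η y := by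
      refine tc_injective hy ?_
      have h6 := deriv_chart_comp (p := p) (c := fun s : ℝ => e.symm (e z + s • tc EX p z (η y)))
        (t := 0) (by rw [hd0']; exact hy) hdm
      rw [hd0'] at h6
      refine h6.unique ?_
      have h7 : HasDerivAt (fun s : ℝ => e z + s • tc EX p z (η y)) (tc EX p z (η y)) 0 := by
        simpa using ((hasDerivAt_id (0 : ℝ)).smul_const (tc EX p z (η y))).const_add (e z)
      refine h7.congr_of_eventuallyEq ?_
      have h8 : ∀ᶠ s in 𝓝 (0 : ℝ), e z + s • tc EX p z (η y) ∈ e.target := by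
        refine hl.continuousAt.eventually ((isOpen_extChartAt_target p).mem_nhds ?_)
        change e z + (0 : ℝ) • tc EX p z (η y) ∈ _
        rw [zero_smul, add_zero]
        exact e.map_source hy
      filter_upwards [h8] with s hs
      exact e.right_inv hs
    have h9 := vel_retraction (a := fun _ => P.proj z)
      (d := fun s : ℝ => e.symm (e z + s • tc EX p z (η y))) (t := 0)
      (P.mdifferentiableAt_proj z) h3 h2 mdifferentiableAt_const hdm rfl hd0' (by
        rw [hdv, vel_const]; exact h4.symm)
    rw [hdv] at h9
    exact h9

end SmoothSec

namespace Connection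

variable (C : P.Connection)

/-- The covariant derivative along `v` of a section `η` of `g^* TX`, in terms of charts. -/
def cov (f : N → M) (η : N → EX) (n : N) (v : EN) : EX :=
  md 𝓘(ℝ, EN) 𝓘(ℝ, EX) (fun y => tc EX (P.top.unit (f n)) (P.top.unit (f y)) (η y)) n v
    - chartCurv C.vr (P.top.unit (f n))
      (extChartAt 𝓘(ℝ, EX) (P.top.unit (f n)) (P.top.unit (f n)))
      (md 𝓘(ℝ, EN) 𝓘(ℝ, EX) (fun y => P.top.unit (f y)) n v) (η n)

variable {f : N → M} {η ζ : N → EX} {n : N}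

/-- For a curve c with velocity `v`, the surface (s, t) ↦ k s (c t) has exterior derivative of A
equal to d/ds A(∂_t) - d/dt A(∂_s). The second derivative is that of η, the first is the one sought,
so the answer does not depend on the family. It transforms linearly between charts because A(∂_t)
vanishes at s = 0. -/
theorem exists_cov (h : SmoothSec EN P f η n) (v : EN) {k : ℝ → N → X}
    (hk : IsFamily (EN := EN) P f η n k) :
    HasDerivAt (fun s : ℝ => C.fm (k s n) (md 𝓘(ℝ, EN) 𝓘(ℝ, EX) (k s) n v)) (C.cov f η n v) 0 ∧
    P.dproj (P.top.unit (f n)) (C.cov f η n v) = 0 ∧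
    ∀ p : X, P.top.unit (f n) ∈ (extChartAt 𝓘(ℝ, EX) p).source →
      tc EX p (P.top.unit (f n)) (C.cov f η n v) =
        md 𝓘(ℝ, EN) 𝓘(ℝ, EX) (fun y => tc EX p (P.top.unit (f y)) (η y)) n v
        - chartCurv C.vr p (extChartAt 𝓘(ℝ, EX) p (P.top.unit (f n)))
          (tc EX p (P.top.unit (f n)) (md 𝓘(ℝ, EN) 𝓘(ℝ, EX) (fun y => P.top.unit (f y)) n v))
          (tc EX p (P.top.unit (f n)) (η n)) := by
  obtain ⟨c, hc, hc0, hcv⟩ := exists_curve (E := EN) n v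
  have hcm := hc.mdifferentiableAt (n := ∞) (by simp)
  have hct := hc.continuousAt.tendsto
  rw [hc0] at hct
  set g : N → X := fun y => P.top.unit (f y) with hg
  have hgm : MDifferentiableAt 𝓘(ℝ, EN) 𝓘(ℝ, EX) g n := h.smooth.base.mdifferentiableAt (by simp)
  have hkm := hk.contMDiffAt
  have hk0 : k 0 n = g n := hk.eq_unit.self_of_nhds
  -- differentiability of `k s`
  have hkd : ∀ᶠ s in 𝓝 (0 : ℝ), MDifferentiableAt 𝓘(ℝ, EN) 𝓘(ℝ, EX) (k s) n := by
    have h2 : Tendsto (fun s : ℝ => (s, n)) (𝓝 0) (𝓝 (0, n)) :=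
      (continuous_id.prodMk continuous_const).tendsto _
    filter_upwards [h2.eventually (eventually_mdifferentiableAt hkm)] with s hs
    exact MDifferentiableAt.comp (g := fun p : ℝ × N => k p.1 p.2) (f := fun y => (s, y)) n hs
      (mdifferentiableAt_const.prodMk mdifferentiableAt_id)
  have hcn : ContMDiffAt 𝓘(ℝ, ℝ) 𝓘(ℝ, EX) ∞ (fun s => k s n) 0 :=
    ContMDiffAt.comp (g := fun p : ℝ × N => k p.1 p.2) (f := fun s => (s, n)) (0 : ℝ) hkm
      (contMDiffAt_id.prodMk contMDiffAt_const)
  have hker : ∀ᶠ s in 𝓝 (0 : ℝ), k s n ∈ P.ker (f n) := by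
    have h2 : Tendsto (fun s : ℝ => (s, n)) (𝓝 0) (𝓝 (0, n)) :=
      (continuous_id.prodMk continuous_const).tendsto _
    exact h2.eventually hk.mem_ker
  set w : ℝ → EX := fun s => C.vr (k s n) (md 𝓘(ℝ, EN) 𝓘(ℝ, EX) (k s) n v) with hw
  -- At `s = 0` the family consists of units, and vectors tangent to the units are horizontal.
  have hw0 : w 0 = 0 := by
    have h1 : md 𝓘(ℝ, EN) 𝓘(ℝ, EX) (k 0) n v = md 𝓘(ℝ, EN) 𝓘(ℝ, EX) g n v := by
      rw [md_congr hk.eq_unit]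
    have h2 : md 𝓘(ℝ, EN) 𝓘(ℝ, EX) g n v = md 𝓘(ℝ, EM) 𝓘(ℝ, EX) P.top.unit (f n)
        (md 𝓘(ℝ, EN) 𝓘(ℝ, EM) f n v) :=
      md_comp_apply (P.top.mdifferentiableAt_unit _)
        (h.contMDiffAt.mdifferentiableAt (by simp)) v
    rw [hw]
    simp only [hk0, h1, h2]
    exact C.vr_md_unit _ _
  -- the derivative in a chart
  have key : ∀ p : X, g n ∈ (extChartAt 𝓘(ℝ, EX) p).source →
      HasDerivAt (fun s => tc EX p (k s n) (w s))
        (md 𝓘(ℝ, EN) 𝓘(ℝ, EX) (fun y => tc EX p (g y) (η y)) n v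
        - chartCurv C.vr p (extChartAt 𝓘(ℝ, EX) p (g n))
          (tc EX p (g n) (md 𝓘(ℝ, EN) 𝓘(ℝ, EX) g n v)) (tc EX p (g n) (η n))) 0 := by
    intro p hp
    have hK : ContMDiffAt 𝓘(ℝ, ℝ × ℝ) 𝓘(ℝ, EX) ∞ (fun q : ℝ × ℝ => k q.1 (c q.2)) (0, 0) := by
      have h1 : ContMDiffAt 𝓘(ℝ, ℝ × ℝ) 𝓘(ℝ, ℝ) ∞ (fun q : ℝ × ℝ => q.1) (0, 0) :=
        ContDiffAt.contMDiffAt (by fun_prop)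
      have h2 : ContMDiffAt 𝓘(ℝ, ℝ × ℝ) 𝓘(ℝ, ℝ) ∞ (fun q : ℝ × ℝ => q.2) (0, 0) :=
        ContDiffAt.contMDiffAt (by fun_prop)
      refine ContMDiffAt.comp (g := fun p : ℝ × N => k p.1 p.2)
        (f := fun q : ℝ × ℝ => (q.1, c q.2)) ((0 : ℝ), (0 : ℝ)) ?_
        (h1.prodMk (ContMDiffAt.comp (f := fun q : ℝ × ℝ => q.2) ((0 : ℝ), (0 : ℝ)) hc h2))
      change ContMDiffAt _ _ _ _ ((0 : ℝ), c 0)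
      rw [hc0]
      exact hkm
    have hp' : k 0 (c 0) ∈ (extChartAt 𝓘(ℝ, EX) p).source := by rwa [hc0, hk0]
    -- Here `d₁` is the wanted derivative in `s`, and `d₂` is the derivative of η along c because
    -- the projector fixes the vertical vectors η.
    obtain ⟨d₁, d₂, h1, h2, h3⟩ := C.smoothEnd_vr.exists_curv_family hK hp'
    have e1 : d₂ = md 𝓘(ℝ, EN) 𝓘(ℝ, EX) (fun y => tc EX p (g y) (η y)) n v := by
      have e2 := hasDerivAt_comp_curve (φ := fun y => tc EX p (g y) (η y)) (c := c) (t := 0)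
        (by rw [hc0]; exact (h.smooth.fiber hp).mdifferentiableAt (by simp)) hcm
      rw [hc0, hcv] at e2
      refine h2.unique (e2.congr_of_eventuallyEq ?_)
      filter_upwards [hct.eventually hk.eq_unit, hct.eventually hk.velocity,
        hct.eventually h.vert] with t e3 e4 e5
      change vel 𝓘(ℝ, EX) (fun s => k s (c t)) 0 = η (c t) at e4
      simp only [e3, e4]
      rw [C.vr_of_vert e5]
    have e6 : vel 𝓘(ℝ, EX) (fun s => k s (c 0)) 0 = η n := by
      rw [hc0]; exact hk.velocity.self_of_nhds
    have e7 : vel 𝓘(ℝ, EX) (fun t => k 0 (c t)) 0 = md 𝓘(ℝ, EN) 𝓘(ℝ, EX) g n v := by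
      have e9 : (fun t => k 0 (c t)) =ᶠ[𝓝 (0 : ℝ)] fun t => g (c t) := hct.eventually hk.eq_unit
      rw [vel_congr e9, vel_comp (g := g) (by rwa [hc0]) hcm, hc0, hcv]
    simp only at h3
    rw [e6, e7, hc0, hk0, chartCurv_swap, e1] at h3
    have e8 : d₁ = md 𝓘(ℝ, EN) 𝓘(ℝ, EX) (fun y => tc EX p (g y) (η y)) n v
        - chartCurv C.vr p (extChartAt 𝓘(ℝ, EX) p (g n))
          (tc EX p (g n) (md 𝓘(ℝ, EN) 𝓘(ℝ, EX) g n v)) (tc EX p (g n) (η n)) := by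
      rw [sub_eq_add_neg, h3]; abel
    rw [← e8]
    refine h1.congr_of_eventuallyEq ?_
    filter_upwards [hkd] with s hs
    simp only [hw]
    rw [vel_comp (g := k s) (by rwa [hc0]) hcm, hc0, hcv]
  have hcov : HasDerivAt (fun s => tc EX (g n) (k s n) (w s)) (C.cov f η n v) 0 := by
    have := key (g n) (by simp)
    simp only [tc_self, ContinuousLinearMap.id_apply] at this
    exact this
  have hcov' : HasDerivAt (fun s => tc EX (k 0 n) (k s n) (w s)) (C.cov f η n v) 0 := by
    rwa [hk0]
  -- The differential of the projection kills every `w s`, and it commutes with differentiation at a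
  -- zero of `w`.
  have hvert : P.dproj (g n) (C.cov f η n v) = 0 := by
    have h1 := hasDerivAt_md_of_vanishing (f := fun _ : ℝ => P.proj)
      (ContMDiffAt.comp (g := P.proj) (f := Prod.snd) ((0 : ℝ), k 0 n)
        P.proj_submersion.contMDiff.contMDiffAt contMDiffAt_snd) hcn hw0 hcov'
    rw [hk0] at h1
    refine h1.unique ((hasDerivAt_const (0 : ℝ) (0 : EY)).congr_of_eventuallyEq ?_)
    refine .of_forall fun s => ?_
    have h2 : md 𝓘(ℝ, EX) 𝓘(ℝ, EY) P.proj (k s n) (w s) = 0 := C.dproj_vr _ _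
    simp only [h2, map_zero]
  refine ⟨?_, hvert, ?_⟩
  · have h1 := C.hasDerivAt_fm_of_vanishing hcn hw0 hcov'
    rw [hk0, C.fm_unit hvert] at h1
    refine h1.congr_of_eventuallyEq ?_
    filter_upwards [hker] with s hs
    simp only [hg, P.top.tgt_unit, P.tgt_of_mem_ker hs, tc_self]
    exact (C.fm_vr _ _).symm
  -- The chart at `p` is treated as a smooth map into the model space, so the same rule for fields
  -- vanishing at time zero gives the change of chart.
  · intro p hp
    have h1 := hasDerivAt_md_of_vanishing (f := fun _ : ℝ => extChartAt 𝓘(ℝ, EX) p)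
      (ContMDiffAt.comp (g := extChartAt 𝓘(ℝ, EX) p) (f := Prod.snd) ((0 : ℝ), k 0 n)
        (contMDiffAt_chart (by rwa [hk0])) contMDiffAt_snd) hcn hw0 hcov'
    rw [hk0] at h1
    refine h1.unique ((key p hp).congr_of_eventuallyEq ?_)
    refine .of_forall fun s => ?_
    simp only [tc_vectorSpace]
    rfl

end Connection

end LieGrpdExt

/-! ### The curvature of the induced covariant derivative -/

namespace PlainDeriv

variable {E : Type*} [NormedAddCommGroup E] [NormedSpace ℝ E]
  {X : Type*} [TopologicalSpace X] [ChartedSpace E X] [IsManifold 𝓘(ℝ, E) ∞ X]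

/-- `chartCurv` as a bilinear map. -/
def chartCurvL (A : X → E →L[ℝ] E) (p : X) (z : E) : E →L[ℝ] E →L[ℝ] E :=
  fderiv ℝ (chartEnd A p) z - (fderiv ℝ (chartEnd A p) z).flip

theorem chartCurv_eq (A : X → E →L[ℝ] E) (p : X) (z a b : E) :
    chartCurv A p z a b = chartCurvL A p z a b := rfl

theorem SmoothEnd.contDiffAt_chartCurvL [FiniteDimensional ℝ E] {A : X → E →L[ℝ] E}
    (hA : SmoothEnd A) {p y : X} (hy : y ∈ (extChartAt 𝓘(ℝ, E) p).source) :
    ContDiffAt ℝ ∞ (chartCurvL A p) (extChartAt 𝓘(ℝ, E) p y) := by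
  have h1 : ContDiffAt ℝ ∞ (fderiv ℝ (chartEnd A p)) (extChartAt 𝓘(ℝ, E) p y) :=
    (hA.contDiffAt hy).fderiv_right (by simp)
  exact h1.sub ((ContinuousLinearMap.flipₗᵢ ℝ E E E).contDiff.contDiffAt.comp _ h1)

/-- The derivative along a curve of a linear map depending on a point. -/
theorem hasDerivAt_linear_comp {F : Type*} [NormedAddCommGroup F] [NormedSpace ℝ F]
    {G : E → E →L[ℝ] F} {z : E} (hG : DifferentiableAt ℝ G z)
    {c a : ℝ → E} {c' a' : E} (hc0 : c 0 = z) (hc : HasDerivAt c c' 0) (ha : HasDerivAt a a' 0) :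
    HasDerivAt (fun s => G (c s) (a s)) (fderiv ℝ G z c' (a 0) + G z a') 0 := by
  subst hc0
  exact (hG.hasFDerivAt.comp_hasDerivAt (0 : ℝ) hc).clm_apply ha

/-- The derivative along a curve of a bilinear map depending on a point. -/
theorem hasDerivAt_bilinear_comp {G : E → E →L[ℝ] E →L[ℝ] E} {z : E} (hG : DifferentiableAt ℝ G z)
    {c a b : ℝ → E} {c' a' b' : E} (hc0 : c 0 = z) (hc : HasDerivAt c c' 0)
    (ha : HasDerivAt a a' 0) (hb : HasDerivAt b b' 0) :
    HasDerivAt (fun s => G (c s) (a s) (b s))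
      (fderiv ℝ G z c' (a 0) (b 0) + G z a' (b 0) + G z (a 0) b') 0 := by
  have h1 := (hasDerivAt_linear_comp hG hc0 hc ha).clm_apply hb
  simpa only [add_apply, hc0] using h1

/-- The curvature term in the commutator of covariant derivatives, in the chart at `p`. -/
def chartRiem (A : X → E →L[ℝ] E) (p : X) (a b ξ : E) : E :=
  fderiv ℝ (chartCurvL A p) (extChartAt 𝓘(ℝ, E) p p) b a ξ
    - fderiv ℝ (chartCurvL A p) (extChartAt 𝓘(ℝ, E) p p) a b ξ
    + chartCurvL A p (extChartAt 𝓘(ℝ, E) p p) a (chartCurvL A p (extChartAt 𝓘(ℝ, E) p p) b ξ)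
    - chartCurvL A p (extChartAt 𝓘(ℝ, E) p p) b (chartCurvL A p (extChartAt 𝓘(ℝ, E) p p) a ξ)

end PlainDeriv

namespace LieGrpdExt

variable {EX : Type*} [NormedAddCommGroup EX] [NormedSpace ℝ EX] [FiniteDimensional ℝ EX]
  {EY : Type*} [NormedAddCommGroup EY] [NormedSpace ℝ EY]
  {EM : Type*} [NormedAddCommGroup EM] [NormedSpace ℝ EM]
  {X : Type*} [TopologicalSpace X] [ChartedSpace EX X] [IsManifold 𝓘(ℝ, EX) ∞ X]
  {Y : Type*} [TopologicalSpace Y] [ChartedSpace EY Y] [IsManifold 𝓘(ℝ, EY) ∞ Y]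
  {M : Type*} [TopologicalSpace M] [ChartedSpace EM M] [IsManifold 𝓘(ℝ, EM) ∞ M]
  {P : LieGrpdExt (EX := EX) (EY := EY) (EM := EM) X Y M}
  {EN : Type*} [NormedAddCommGroup EN] [NormedSpace ℝ EN]
  {N : Type*} [TopologicalSpace N] [ChartedSpace EN N] [IsManifold 𝓘(ℝ, EN) ∞ N]

namespace Connection

variable (C : P.Connection) {f : N → M} {η ζ : N → EX} {n : N}

/-- The choice operator needs both halves: `exists_cov` supplies a value valid for all families, and
`exists_isFamily` supplies one family on which derivatives are unique. -/
theorem covDeriv_eq (h : SmoothSec EN P f η n) (v : EN) : C.covDeriv f η n v = C.cov f η n v := by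
  have h1 : ∃ ζ : EX, ∀ k : ℝ → N → X, IsFamily (EN := EN) P f η n k →
      HasDerivAt
        (fun s : ℝ => (C.form (k s n) (mfderiv 𝓘(ℝ, EN) 𝓘(ℝ, EX) (k s) n v) : EX)) ζ 0 :=
    ⟨C.cov f η n v, fun k hk => (C.exists_cov h v hk).1⟩
  obtain ⟨k, hk⟩ := exists_isFamily h
  exact (Classical.epsilon_spec h1 k hk).unique (C.exists_cov h v hk).1

theorem dproj_cov (h : SmoothSec EN P f η n) (v : EN) :
    P.dproj (P.top.unit (f n)) (C.cov f η n v) = 0 := by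
  obtain ⟨k, hk⟩ := exists_isFamily h
  exact (C.exists_cov h v hk).2.1

/-- The definition of `cov` uses a chart that moves with the point. Differentiating a covariant
derivative again requires the formula in one fixed chart. -/
theorem tc_cov (h : SmoothSec EN P f η n) (v : EN) {p : X}
    (hp : P.top.unit (f n) ∈ (extChartAt 𝓘(ℝ, EX) p).source) :
    tc EX p (P.top.unit (f n)) (C.cov f η n v) =
      md 𝓘(ℝ, EN) 𝓘(ℝ, EX) (fun y => tc EX p (P.top.unit (f y)) (η y)) n v
      - chartCurvL C.vr p (extChartAt 𝓘(ℝ, EX) p (P.top.unit (f n)))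
        (md 𝓘(ℝ, EN) 𝓘(ℝ, EX) (fun y => extChartAt 𝓘(ℝ, EX) p (P.top.unit (f y))) n v)
        (tc EX p (P.top.unit (f n)) (η n)) := by
  obtain ⟨k, hk⟩ := exists_isFamily h
  have h1 := (C.exists_cov h v hk).2.2 p hp
  have h2 := md_comp_apply (g := extChartAt 𝓘(ℝ, EX) p) (f := fun y => P.top.unit (f y))
    (mdifferentiableAt_chart hp)
    (h.smooth.base.mdifferentiableAt (by simp)) v
  rw [h2]
  exact h1

theorem cov_add_vec (f : N → M) (η : N → EX) (n : N) (v w : EN) :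
    C.cov f η n (v + w) = C.cov f η n v + C.cov f η n w := by
  simp only [cov, chartCurv_eq, map_add, add_apply]
  abel

theorem cov_congr (h : η =ᶠ[𝓝 n] ζ) (v : EN) : C.cov f η n v = C.cov f ζ n v := by
  unfold cov
  rw [h.self_of_nhds]
  congr 2
  apply md_congr
  filter_upwards [h] with y hy
  rw [hy]

theorem mdifferentiableAt_tc (h : SmoothSec EN P f η n) :
    MDifferentiableAt 𝓘(ℝ, EN) 𝓘(ℝ, EX)
      (fun y => tc EX (P.top.unit (f n)) (P.top.unit (f y)) (η y)) n :=
  (h.smooth.fiber (by simp)).mdifferentiableAt (by simp)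

theorem cov_add (h : SmoothSec EN P f η n) (h' : SmoothSec EN P f ζ n) (v : EN) :
    C.cov f (fun y => η y + ζ y) n v = C.cov f η n v + C.cov f ζ n v := by
  obtain ⟨c, hc, hc0, hcv⟩ := exists_curve (E := EN) n v
  have hcm := hc.mdifferentiableAt (n := ∞) (by simp)
  have h1 := hasDerivAt_comp_curve (c := c) (t := 0)
    (by rw [hc0]; exact mdifferentiableAt_tc h) hcm
  have h2 := hasDerivAt_comp_curve (c := c) (t := 0)
    (by rw [hc0]; exact mdifferentiableAt_tc h') hcm
  have h3 := hasDerivAt_comp_curve (c := c) (t := 0)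
    (by rw [hc0]; exact mdifferentiableAt_tc (h.add h')) hcm
  simp only [map_add] at h3
  have h4 := h3.unique (h1.add h2)
  rw [hc0, hcv] at h4
  simp only [cov, chartCurv_eq, map_add, h4]
  abel

theorem cov_neg (h : SmoothSec EN P f η n) (v : EN) :
    C.cov f (fun y => -η y) n v = -C.cov f η n v := by
  have h0 := C.cov_add h h.neg v
  have h1 := C.cov_add (h.add h.neg) (h.add h.neg) v
  simp only [add_neg_cancel, add_zero] at h0 h1
  rw [left_eq_add.1 h1] at h0
  exact (neg_eq_of_add_eq_zero_right h0.symm).symm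

theorem smoothSec_cov {h : N → EN} (hη : ∀ᶠ y in 𝓝 n, SmoothSec EN P f η y)
    (hh : SmoothAlong 𝓘(ℝ, EN) (fun y => y) h n) :
    SmoothSec EN P f (fun y => C.cov f η y (h y)) n := by
  have hη0 := hη.self_of_nhds
  set p := P.top.unit (f n) with hp
  have hpn : P.top.unit (f n) ∈ (extChartAt 𝓘(ℝ, EX) p).source := by simp [hp]
  have hmem := hη0.eventually_mem hpn
  refine ⟨(smoothAlong_iff (b := fun y => P.top.unit (f y)) hpn).2 ⟨hη0.smooth.base, ?_⟩, ?_⟩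
  · have h1 : ∀ᶠ y in 𝓝 n, ContMDiffAt 𝓘(ℝ, EN) 𝓘(ℝ, EX) ∞
        (fun y => tc EX p (P.top.unit (f y)) (η y)) y := by
      filter_upwards [hη, hmem] with y h1 h2
      exact h1.smooth.fiber h2
    have h2 : ∀ᶠ y in 𝓝 n, ContMDiffAt 𝓘(ℝ, EN) 𝓘(ℝ, EX) ∞
        (fun y => extChartAt 𝓘(ℝ, EX) p (P.top.unit (f y))) y := by
      filter_upwards [hη, hmem] with y h1 h2
      exact ContMDiffAt.comp (g := extChartAt 𝓘(ℝ, EX) p) y (contMDiffAt_chart h2) h1.smooth.base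
    have h3 : ContMDiffAt 𝓘(ℝ, EN) 𝓘(ℝ, EX →L[ℝ] EX →L[ℝ] EX) ∞
        (fun y => chartCurvL C.vr p (extChartAt 𝓘(ℝ, EX) p (P.top.unit (f y)))) n :=
      ContMDiffAt.comp (g := chartCurvL C.vr p) n
        (C.smoothEnd_vr.contDiffAt_chartCurvL hpn).contMDiffAt h2.self_of_nhds
    have h4 := (contMDiffAt_md_apply h1 hh).sub
      ((h3.clm_apply (contMDiffAt_md_apply h2 hh)).clm_apply h1.self_of_nhds)
    refine h4.congr_of_eventuallyEq ?_
    filter_upwards [hη, hmem] with y h1 h2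
    exact C.tc_cov h1 (h y) h2
  · filter_upwards [hη] with y hy
    exact C.dproj_cov hy _

/-- The curvature of the pull back of the induced connection. -/
theorem cov_commutator {ξ : N → EX} {h₁ h₂ : N → EN} (hξ : ∀ᶠ y in 𝓝 n, SmoothSec EN P f ξ y)
    (hh₁ : SmoothAlong 𝓘(ℝ, EN) (fun y => y) h₁ n)
    (hh₂ : SmoothAlong 𝓘(ℝ, EN) (fun y => y) h₂ n) :
    C.cov f (fun y => C.cov f ξ y (h₂ y)) n (h₁ n)
      - C.cov f (fun y => C.cov f ξ y (h₁ y)) n (h₂ n) - C.cov f ξ n (br h₁ h₂ n) =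
    chartRiem C.vr (P.top.unit (f n))
      (md 𝓘(ℝ, EN) 𝓘(ℝ, EX) (fun y => P.top.unit (f y)) n (h₁ n))
      (md 𝓘(ℝ, EN) 𝓘(ℝ, EX) (fun y => P.top.unit (f y)) n (h₂ n)) (ξ n) := by
  have hξ0 := hξ.self_of_nhds
  set p := P.top.unit (f n) with hp
  have hpn : P.top.unit (f n) ∈ (extChartAt 𝓘(ℝ, EX) p).source := by simp [hp]
  have hmem := hξ0.eventually_mem hpn
  set φ : N → EX := fun y => tc EX p (P.top.unit (f y)) (ξ y) with hφ
  set γ : N → EX := fun y => extChartAt 𝓘(ℝ, EX) p (P.top.unit (f y)) with hγ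
  have hφs : ∀ᶠ y in 𝓝 n, ContMDiffAt 𝓘(ℝ, EN) 𝓘(ℝ, EX) ∞ φ y := by
    filter_upwards [hξ, hmem] with y h1 h2
    exact h1.smooth.fiber h2
  have hγs : ∀ᶠ y in 𝓝 n, ContMDiffAt 𝓘(ℝ, EN) 𝓘(ℝ, EX) ∞ γ y := by
    filter_upwards [hξ, hmem] with y h1 h2
    exact ContMDiffAt.comp (g := extChartAt 𝓘(ℝ, EX) p) y (contMDiffAt_chart h2) h1.smooth.base
  have hφ0 : φ n = ξ n := by simp only [hφ, ← hp, tc_self]; rfl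
  have hγ0 : γ n = extChartAt 𝓘(ℝ, EX) p p := rfl
  have hγv : ∀ v, md 𝓘(ℝ, EN) 𝓘(ℝ, EX) γ n v =
      md 𝓘(ℝ, EN) 𝓘(ℝ, EX) (fun y => P.top.unit (f y)) n v := by
    intro v
    have h2 := md_comp_apply (g := extChartAt 𝓘(ℝ, EX) p) (f := fun y => P.top.unit (f y))
      (mdifferentiableAt_chart hpn) (hξ0.smooth.base.mdifferentiableAt (by simp)) v
    refine h2.trans ?_
    change tc EX p p _ = _
    rw [tc_self]
    rfl
  set G : EX → EX →L[ℝ] EX →L[ℝ] EX := chartCurvL C.vr p with hG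
  have hGd := (C.smoothEnd_vr.contDiffAt_chartCurvL hpn).differentiableAt (by simp)
  have hcov : ∀ v, C.cov f ξ n v =
      md 𝓘(ℝ, EN) 𝓘(ℝ, EX) φ n v - G (γ n) (md 𝓘(ℝ, EN) 𝓘(ℝ, EX) γ n v) (φ n) := by
    intro v
    have h1 := C.tc_cov hξ0 v hpn
    rw [← hp, tc_self] at h1
    exact h1.trans (by rw [hφ0]; rfl)
  -- The product rule for ∇ = d - G(γ)(dγ) in the chart at `p`, where φ and γ are the coordinates of
  -- the section and of the base point.
  have key : ∀ {b : N → EN} (v : EN), SmoothAlong 𝓘(ℝ, EN) (fun y => y) b n →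
      C.cov f (fun y => C.cov f ξ y (b y)) n v =
        md 𝓘(ℝ, EN) 𝓘(ℝ, EX) (fun y => md 𝓘(ℝ, EN) 𝓘(ℝ, EX) φ y (b y)) n v
        - fderiv ℝ G (γ n) (md 𝓘(ℝ, EN) 𝓘(ℝ, EX) γ n v)
          (md 𝓘(ℝ, EN) 𝓘(ℝ, EX) γ n (b n)) (φ n)
        - G (γ n) (md 𝓘(ℝ, EN) 𝓘(ℝ, EX) (fun y => md 𝓘(ℝ, EN) 𝓘(ℝ, EX) γ y (b y)) n v) (φ n)
        - G (γ n) (md 𝓘(ℝ, EN) 𝓘(ℝ, EX) γ n (b n)) (md 𝓘(ℝ, EN) 𝓘(ℝ, EX) φ n v)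
        - G (γ n) (md 𝓘(ℝ, EN) 𝓘(ℝ, EX) γ n v) (md 𝓘(ℝ, EN) 𝓘(ℝ, EX) φ n (b n)
          - G (γ n) (md 𝓘(ℝ, EN) 𝓘(ℝ, EX) γ n (b n)) (φ n)) := by
    intro b v hb
    obtain ⟨c, hc, hc0, hcv⟩ := exists_curve (E := EN) n v
    have hcm := hc.mdifferentiableAt (n := ∞) (by simp)
    have hct := hc.continuousAt.tendsto
    rw [hc0] at hct
    have hs := C.smoothSec_cov hξ hb
    have h1 := C.tc_cov hs v hpn
    have d0 := hasDerivAt_comp_curve (c := c) (t := 0)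
      (φ := fun y => tc EX p (P.top.unit (f y)) (C.cov f ξ y (b y)))
      (by rw [hc0]; exact (hs.smooth.fiber hpn).mdifferentiableAt (by simp)) hcm
    have d1 := hasDerivAt_comp_curve (c := c) (t := 0)
      (φ := fun y => md 𝓘(ℝ, EN) 𝓘(ℝ, EX) φ y (b y))
      (by rw [hc0]; exact (contMDiffAt_md_apply hφs hb).mdifferentiableAt (by simp)) hcm
    have d2 := hasDerivAt_comp_curve (c := c) (t := 0)
      (φ := fun y => md 𝓘(ℝ, EN) 𝓘(ℝ, EX) γ y (b y))
      (by rw [hc0]; exact (contMDiffAt_md_apply hγs hb).mdifferentiableAt (by simp)) hcm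
    have d3 := hasDerivAt_comp_curve (c := c) (t := 0) (φ := φ)
      (by rw [hc0]; exact hφs.self_of_nhds.mdifferentiableAt (by simp)) hcm
    have d4 := hasDerivAt_comp_curve (c := c) (t := 0) (φ := γ)
      (by rw [hc0]; exact hγs.self_of_nhds.mdifferentiableAt (by simp)) hcm
    have d6 := d1.sub (hasDerivAt_bilinear_comp hGd (by rw [hc0]) d4 d2 d3)
    have d7 := d0.unique (d6.congr_of_eventuallyEq (by
      filter_upwards [hct.eventually hξ, hct.eventually hmem] with s h1 h2
      exact C.tc_cov h1 (b (c s)) h2))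
    simp only [hc0, hcv] at d7
    rw [← hp, tc_self] at h1
    refine h1.trans ?_
    rw [d7, ContinuousLinearMap.id_apply, hcov (b n)]
    change _ - G (γ n) (md 𝓘(ℝ, EN) 𝓘(ℝ, EX) γ n v) _ = _
    abel
  -- The iterated derivatives of φ and γ cancel against the bracket term. What is left contains the
  -- two fields only through the differential of γ at the point.
  rw [key _ hh₂, key _ hh₁, hcov, md_br hφs hh₁ hh₂, md_br hγs hh₁ hh₂]
  simp only [chartRiem, ← hγ0, ← hγv, ← hφ0, map_sub, sub_apply]
  abel

end Connection

end LieGrpdExt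

/-! ### The connection form on a bracket with a vertical field -/

namespace LieGrpdExt

variable {EX : Type*} [NormedAddCommGroup EX] [NormedSpace ℝ EX] [FiniteDimensional ℝ EX]
  {EY : Type*} [NormedAddCommGroup EY] [NormedSpace ℝ EY]
  {EM : Type*} [NormedAddCommGroup EM] [NormedSpace ℝ EM]
  {X : Type*} [TopologicalSpace X] [ChartedSpace EX X] [IsManifold 𝓘(ℝ, EX) ∞ X]
  {Y : Type*} [TopologicalSpace Y] [ChartedSpace EY Y] [IsManifold 𝓘(ℝ, EY) ∞ Y]
  {M : Type*} [TopologicalSpace M] [ChartedSpace EM M] [IsManifold 𝓘(ℝ, EM) ∞ M]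
  {P : LieGrpdExt (EX := EX) (EY := EY) (EM := EM) X Y M}
  {EN : Type*} [NormedAddCommGroup EN] [NormedSpace ℝ EN]
  {N : Type*} [TopologicalSpace N] [ChartedSpace EN N] [IsManifold 𝓘(ℝ, EN) ∞ N]

namespace Connection

variable (C : P.Connection)

/-- The covariant derivative in the direction of a curve in a fibre of `f` is the ordinary
derivative. -/
theorem hasDerivAt_fibre_curve {f : N → M} {σ : N → EX} {n : N} (h : SmoothSec EN P f σ n)
    {c : ℝ → N} (hc : MDifferentiableAt 𝓘(ℝ, ℝ) 𝓘(ℝ, EN) c 0) (hc0 : c 0 = n)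
    (hf : ∀ᶠ s in 𝓝 (0 : ℝ), f (c s) = f n) :
    HasDerivAt (fun s => σ (c s)) (C.cov f σ n (vel 𝓘(ℝ, EN) c 0)) 0 := by
  have h1 := hasDerivAt_comp_curve (c := c) (t := 0)
    (by rw [hc0]; exact mdifferentiableAt_tc h) hc
  have h2 := vel_comp (g := fun y => P.top.unit (f y)) (c := c) (t := 0)
    (by rw [hc0]; exact h.smooth.base.mdifferentiableAt (by simp)) hc
  have h3 : vel 𝓘(ℝ, EX) (fun s => P.top.unit (f (c s))) 0 = 0 := by
    rw [← vel_const (I := 𝓘(ℝ, EX)) (P.top.unit (f n)) (0 : ℝ)]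
    apply vel_congr
    filter_upwards [hf] with s hs
    rw [hs]
  rw [h3, hc0] at h2
  rw [hc0] at h1
  unfold cov
  -- Along a fibre of `f` the unit does not move, so the correction term vanishes.
  rw [← h2, chartCurv_eq, map_zero, zero_apply, sub_zero]
  refine h1.congr_of_eventuallyEq ?_
  filter_upwards [hf] with s hs
  rw [hs, tc_self]
  rfl

/-- The value of the connection form on the bracket of a vector field with a vertical vector
field. -/
theorem fm_br_lam {U η : X → EX} {x : X} (hU : SmoothAlong 𝓘(ℝ, EX) (fun y => y) U x)
    (hη : SmoothSec EX P P.top.tgt η x) :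
    C.fm x (br U (fun y => P.lam y (η y)) x) =
      C.cov P.top.tgt η x (U x) - C.cov P.top.tgt (fun y => C.fm y (U y)) x (P.lam x (η x))
        - P.brkL (P.top.tgt x) (C.fm x (U x)) (η x) := by
  -- The proof studies the surface F(s, t) = y(t) · k_s(y(t)), where y is a curve with velocity U x.
  -- Its ∂_s at s = 0 is η^▷ along y, and its ∂_t at s = 0, t = 0 is U x.
  obtain ⟨k, hk⟩ := exists_isFamily hη
  obtain ⟨y, hy, hy0, hyv⟩ := exists_curve (E := EX) x (U x)
  have hym := hy.mdifferentiableAt (n := ∞) (by simp)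
  have hyt := hy.continuousAt.tendsto
  rw [hy0] at hyt
  have hηx := hη.vert.self_of_nhds
  have hZ : SmoothAlong 𝓘(ℝ, EX) (fun y => y) (fun y => P.lam y (η y)) x :=
    P.smoothAlong_lam contMDiffAt_id hη.smooth hη.vert
  have hσ : SmoothSec EX P P.top.tgt (fun y => C.fm y (U y)) x :=
    ⟨C.smoothAlong_fm hU, .of_forall fun y => C.dproj_fm y _⟩
  have hfst : ContMDiffAt 𝓘(ℝ, ℝ × ℝ) 𝓘(ℝ, ℝ) ∞ (fun q : ℝ × ℝ => q.1) (0, 0) :=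
    ContDiffAt.contMDiffAt (by fun_prop)
  have hsnd : ContMDiffAt 𝓘(ℝ, ℝ × ℝ) 𝓘(ℝ, ℝ) ∞ (fun q : ℝ × ℝ => q.2) (0, 0) :=
    ContDiffAt.contMDiffAt (by fun_prop)
  have hy2 : ContMDiffAt 𝓘(ℝ, ℝ × ℝ) 𝓘(ℝ, EX) ∞ (fun q : ℝ × ℝ => y q.2) (0, 0) :=
    ContMDiffAt.comp (f := fun q : ℝ × ℝ => q.2) ((0 : ℝ), (0 : ℝ)) hy hsnd
  have hpair := hfst.prodMk hy2
  have hpt := hpair.continuousAt.tendsto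
  simp only [hy0] at hpt
  have hk2 : ContMDiffAt 𝓘(ℝ, ℝ × ℝ) 𝓘(ℝ, EX) ∞ (fun q : ℝ × ℝ => k q.1 (y q.2)) (0, 0) := by
    refine ContMDiffAt.comp (g := fun p : ℝ × X => k p.1 p.2)
      (f := fun q : ℝ × ℝ => (q.1, y q.2)) ((0 : ℝ), (0 : ℝ)) ?_ hpair
    change ContMDiffAt _ _ _ _ ((0 : ℝ), y 0)
    rw [hy0]
    exact hk.contMDiffAt
  have hker : ∀ᶠ q : ℝ × ℝ in 𝓝 (0, 0), k q.1 (y q.2) ∈ P.ker (P.top.tgt (y q.2)) :=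
    hpt.eventually hk.mem_ker
  have hcomp : ∀ᶠ q : ℝ × ℝ in 𝓝 (0, 0), P.top.tgt (y q.2) = P.top.src (k q.1 (y q.2)) := by
    filter_upwards [hker] with q hq
    exact (P.src_of_mem_ker hq).symm
  have hF := P.top.contMDiffAt_mul hy2 hk2 hcomp
  have hk0 : k 0 x = P.top.unit (P.top.tgt x) := hk.eq_unit.self_of_nhds
  have hF00 : P.top.mul (y 0) (k 0 (y 0)) = x := by rw [hy0, hk0, P.top.mul_unit]
  obtain ⟨m, hm1, hm2⟩ := exists_mixed_derivative (p := x) hF (by simp [hF00])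
  simp only at hm1 hm2
  -- the curve `c s = x * k s x`
  set c : ℝ → X := fun s => P.top.mul (y 0) (k s (y 0)) with hc
  have hl : ContMDiffAt 𝓘(ℝ, ℝ) 𝓘(ℝ, ℝ × ℝ) ∞ (fun s : ℝ => ((s, 0) : ℝ × ℝ)) 0 :=
    ContDiffAt.contMDiffAt (by fun_prop)
  have hlt : Tendsto (fun s : ℝ => ((s, 0) : ℝ × ℝ)) (𝓝 0) (𝓝 (0, 0)) :=
    (continuous_id.prodMk continuous_const).tendsto _
  have hcs : ContMDiffAt 𝓘(ℝ, ℝ) 𝓘(ℝ, EX) ∞ c 0 :=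
    ContMDiffAt.comp (g := fun q : ℝ × ℝ => P.top.mul (y q.2) (k q.1 (y q.2)))
      (f := fun s : ℝ => ((s, 0) : ℝ × ℝ)) (0 : ℝ) hF hl
  have hkx : ContMDiffAt 𝓘(ℝ, ℝ) 𝓘(ℝ, EX) ∞ (fun s => k s x) 0 := by
    have h2 : ContMDiffAt 𝓘(ℝ, ℝ) 𝓘(ℝ, EX) ∞ (fun s => k s (y 0)) 0 :=
      ContMDiffAt.comp (g := fun q : ℝ × ℝ => k q.1 (y q.2))
        (f := fun s : ℝ => ((s, 0) : ℝ × ℝ)) (0 : ℝ) hk2 hl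
    rwa [hy0] at h2
  have hkxm := hkx.mdifferentiableAt (n := ∞) (by simp)
  have hkk : ∀ᶠ s in 𝓝 (0 : ℝ), k s x ∈ P.ker (P.top.tgt x) := by
    have := hlt.eventually hker
    simpa only [hy0] using this
  have hkv : vel 𝓘(ℝ, EX) (fun s => k s x) 0 = η x := hk.velocity.self_of_nhds
  have hcm := hcs.mdifferentiableAt (n := ∞) (by simp)
  have hc0 : c 0 = x := hF00
  have hctgt : ∀ᶠ s in 𝓝 (0 : ℝ), P.top.tgt (c s) = P.top.tgt x := by
    filter_upwards [hkk] with s hs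
    rw [hc, hy0]
    simp only
    rw [P.top.tgt_mul _ _ (P.src_of_mem_ker hs).symm, P.tgt_of_mem_ker hs]
  have hcv : vel 𝓘(ℝ, EX) c 0 = P.lam x (η x) := by
    have := (P.lam_curve (x := x) hkxm hkk hk0).2
    rw [hkv] at this
    rw [← this, hc, hy0]
  -- the mixed derivative
  have hmU : m = md 𝓘(ℝ, EX) 𝓘(ℝ, EX) (fun y => tc EX x y (P.lam y (η y))) x (U x) := by
    have e := hasDerivAt_comp_curve (c := y) (t := 0) (φ := fun y => tc EX x y (P.lam y (η y)))
      (by rw [hy0]; exact (hZ.fiber (by simp)).mdifferentiableAt (by simp)) hym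
    rw [hy0, hyv] at e
    refine hm2.unique (e.congr_of_eventuallyEq ?_)
    have hrt : Tendsto (fun s : ℝ => ((0, s) : ℝ × ℝ)) (𝓝 0) (𝓝 (0, 0)) :=
      (continuous_const.prodMk continuous_id).tendsto _
    have hcur : ∀ᶠ t in 𝓝 (0 : ℝ), ∀ᶠ s in 𝓝 (0 : ℝ), k s (y t) ∈ P.ker (P.top.tgt (y t)) := by
      have hsw : Tendsto (fun q : ℝ × ℝ => (q.2, q.1)) (𝓝 (0, 0)) (𝓝 (0, 0)) :=
        continuous_swap.tendsto _
      exact (hsw.eventually hker).curry_nhds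
    have hkd : ∀ᶠ t in 𝓝 (0 : ℝ), MDifferentiableAt 𝓘(ℝ, ℝ) 𝓘(ℝ, EX) (fun s => k s (y t)) 0 := by
      filter_upwards [hrt.eventually (eventually_mdifferentiableAt hk2)] with t ht
      refine MDifferentiableAt.comp (g := fun q : ℝ × ℝ => k q.1 (y q.2))
        (f := fun s => ((s, t) : ℝ × ℝ)) (0 : ℝ) ht ?_
      exact (ContDiffAt.contMDiffAt (n := ∞) (by fun_prop)).mdifferentiableAt (by simp)
    filter_upwards [hyt.eventually hk.eq_unit, hyt.eventually hk.velocity, hcur, hkd]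
      with t h1 h2 h3 h4
    have h5 := (P.lam_curve h4 h3 h1).2
    change vel 𝓘(ℝ, EX) (fun s => k s (y t)) 0 = η (y t) at h2
    rw [h5, h2, h1, P.top.mul_unit]
  -- the velocities in the second variable
  have hcur : ∀ᶠ s in 𝓝 (0 : ℝ), ∀ᶠ t in 𝓝 (0 : ℝ), P.top.tgt (y t) = P.top.src (k s (y t)) :=
    hcomp.curry_nhds
  have hkt : ∀ᶠ s in 𝓝 (0 : ℝ), MDifferentiableAt 𝓘(ℝ, EX) 𝓘(ℝ, EX) (k s) x := by
    have h2 : Tendsto (fun s : ℝ => (s, x)) (𝓝 0) (𝓝 (0, x)) :=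
      (continuous_id.prodMk continuous_const).tendsto _
    filter_upwards [h2.eventually (eventually_mdifferentiableAt hk.contMDiffAt)] with s hs
    exact MDifferentiableAt.comp (g := fun p : ℝ × X => k p.1 p.2) (f := fun y => (s, y)) x hs
      (mdifferentiableAt_const.prodMk mdifferentiableAt_id)
  -- Multiplicativity of the connection form applied to the product y · k_s(y); this is the place
  -- where the subgroupoid property of `H` enters.
  have hFt : ∀ᶠ s in 𝓝 (0 : ℝ),
      C.fm (c s) (vel 𝓘(ℝ, EX) (fun t => P.top.mul (y t) (k s (y t))) 0) =
        P.AdL (P.top.inv (k s x)) (C.fm x (U x))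
          + C.fm (k s x) (md 𝓘(ℝ, EX) 𝓘(ℝ, EX) (k s) x (U x)) := by
    filter_upwards [hcur, hkt] with s h1 h2
    have h3 : MDifferentiableAt 𝓘(ℝ, ℝ) 𝓘(ℝ, EX) (fun t => k s (y t)) 0 :=
      MDifferentiableAt.comp (g := k s) (0 : ℝ) (by rwa [hy0]) hym
    have h4 := (P.top.vel_mul hym h3 h1).2
    have h5 := P.top.md_tgt_vel_eq hym h3 h1
    have h6 := h1.self_of_nhds
    have h7 : vel 𝓘(ℝ, EX) (fun t => k s (y t)) 0 = md 𝓘(ℝ, EX) 𝓘(ℝ, EX) (k s) x (U x) := by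
      rw [vel_comp (g := k s) (by rwa [hy0]) hym, hy0, hyv]
    have h8 := C.fm_tmL h6 h5
    rw [← h4, h7, hyv, hy0] at h8
    rw [← h8, hc, hy0]
  have hFt0 : vel 𝓘(ℝ, EX) (fun t => P.top.mul (y t) (k 0 (y t))) 0 = U x := by
    rw [← hyv]
    apply vel_congr
    filter_upwards [hyt.eventually hk.eq_unit] with t ht
    rw [ht, P.top.mul_unit]
  -- The difference of ∂_t F and U along the curve `c` vanishes at s = 0. By equality of mixed
  -- derivatives, its derivative there is the coordinate formula for the bracket.
  set w : ℝ → EX := fun s =>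
    vel 𝓘(ℝ, EX) (fun t => P.top.mul (y t) (k s (y t))) 0 - U (c s) with hw
  have hw0 : w 0 = 0 := by
    simp only [hw, hFt0, hc0, sub_self]
  have hUc := hasDerivAt_comp_curve (c := c) (t := 0) (φ := fun y => tc EX x y (U y))
    (by rw [hc0]; exact (hU.fiber (by simp)).mdifferentiableAt (by simp)) hcm
  rw [hc0, hcv] at hUc
  have hwd : HasDerivAt (fun s => tc EX (c 0) (c s) (w s))
      (br U (fun y => P.lam y (η y)) x) 0 := by
    rw [hc0, br_eq hU hZ, ← hmU]
    have := hm1.sub hUc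
    refine this.congr_of_eventuallyEq (.of_forall fun s => ?_)
    simp only [hw, map_sub]
    rfl
  have h1 := C.hasDerivAt_fm_of_vanishing hcs hw0 hwd
  rw [hc0] at h1
  -- The three contributions: conjugation by the inverse gives minus the bracket, the family `k`
  -- gives ∇_U η, and U along `c`, which stays in a target fibre, gives the derivative of α(U).
  have d1 := P.hasDerivAt_AdL_inv (C.dproj_fm x (U x)) hkxm hkk hk0 hkv
  have d2 := (C.exists_cov hη (U x) hk).1
  have d3 := C.hasDerivAt_fibre_curve hσ hcm hc0 hctgt
  rw [hcv] at d3
  have h2 := h1.unique (((d1.add d2).sub d3).congr_of_eventuallyEq (by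
    filter_upwards [hctgt, hFt] with s h3 h4
    simp only [hw, h3, tc_self, map_sub, h4]
    rfl))
  rw [h2]
  abel

end Connection

end LieGrpdExt

/-! ### Brackets of fields smooth near a point -/

namespace PlainDeriv

variable {E : Type*} [NormedAddCommGroup E] [NormedSpace ℝ E] [FiniteDimensional ℝ E]
  {N : Type*} [TopologicalSpace N] [ChartedSpace E N] [IsManifold 𝓘(ℝ, E) ∞ N]

/-- Smoothness of a vector field near a point. -/
def SmoothNear (U : N → E) (n : N) : Prop :=
  ∀ᶠ y in 𝓝 n, SmoothAlong 𝓘(ℝ, E) (fun y => y) U y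

variable {U V W : N → E} {n : N}

theorem SmoothNear.smoothAlong (h : SmoothNear U n) : SmoothAlong 𝓘(ℝ, E) (fun y => y) U n :=
  h.self_of_nhds

theorem SmoothNear.add (hU : SmoothNear U n) (hV : SmoothNear V n) :
    SmoothNear (fun y => U y + V y) n := by
  filter_upwards [hU, hV] with y h1 h2
  exact h1.add h2

theorem SmoothNear.sub (hU : SmoothNear U n) (hV : SmoothNear V n) :
    SmoothNear (fun y => U y - V y) n := by
  filter_upwards [hU, hV] with y h1 h2
  exact h1.sub h2

theorem SmoothAlong.br (hU : SmoothAlong 𝓘(ℝ, E) (fun y => y) U n)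
    (hV : SmoothAlong 𝓘(ℝ, E) (fun y => y) V n) :
    SmoothAlong 𝓘(ℝ, E) (fun y => y) (PlainDeriv.br U V) n := by
  have : CompleteSpace E := FiniteDimensional.complete ℝ E
  have : IsManifold 𝓘(ℝ, E) (((⊤ : ℕ∞) : WithTop ℕ∞) + 1) N :=
    (inferInstance : IsManifold 𝓘(ℝ, E) ∞ N)
  have : IsManifold 𝓘(ℝ, E) (minSmoothness ℝ 2) N := by
    rw [minSmoothness_of_isRCLikeNormedField]
    infer_instance
  exact ContMDiffAt.mlieBracket_vectorField (I := 𝓘(ℝ, E)) (m := ⊤) (n := ⊤)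
    (U := fun y => (U y : TangentSpace 𝓘(ℝ, E) y)) (V := fun y => (V y : TangentSpace 𝓘(ℝ, E) y))
    hU hV (by simp)

theorem SmoothNear.br (hU : SmoothNear U n) (hV : SmoothNear V n) :
    SmoothNear (PlainDeriv.br U V) n := by
  filter_upwards [hU, hV] with y h1 h2
  exact h1.br h2

theorem br_add_left (hU : SmoothNear U n) (hV : SmoothNear V n) (W : N → E) :
    br (fun y => U y + V y) W n = br U W n + br V W n :=
  VectorField.mlieBracket_add_left (I := 𝓘(ℝ, E))
    (V := fun y => (U y : TangentSpace 𝓘(ℝ, E) y)) (V₁ := fun y => (V y : TangentSpace 𝓘(ℝ, E) y))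
    (W := fun y => (W y : TangentSpace 𝓘(ℝ, E) y))
    (ContMDiffAt.mdifferentiableAt (n := ∞) hU.smoothAlong (by simp))
    (ContMDiffAt.mdifferentiableAt (n := ∞) hV.smoothAlong (by simp))

theorem br_add_right (hU : SmoothNear U n) (hV : SmoothNear V n) (W : N → E) :
    br W (fun y => U y + V y) n = br W U n + br W V n := by
  rw [br_swap, br_add_left hU hV, br_swap W U, br_swap W V]
  abel

theorem br_jacobi (hU : SmoothNear U n) (hV : SmoothNear V n) (hW : SmoothNear W n) :
    br U (br V W) n = br (br U V) W n + br V (br U W) n := by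
  have : CompleteSpace E := FiniteDimensional.complete ℝ E
  have : IsManifold 𝓘(ℝ, E) (minSmoothness ℝ 3) N := by
    rw [minSmoothness_of_isRCLikeNormedField]
    infer_instance
  have h2 : minSmoothness ℝ 2 ≤ (∞ : WithTop ℕ∞) := by
    rw [minSmoothness_of_isRCLikeNormedField]
    exact two_le_infty
  exact VectorField.leibniz_identity_mlieBracket_apply (I := 𝓘(ℝ, E))
    (U := fun y => (U y : TangentSpace 𝓘(ℝ, E) y)) (V := fun y => (V y : TangentSpace 𝓘(ℝ, E) y))
    (W := fun y => (W y : TangentSpace 𝓘(ℝ, E) y))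
    (ContMDiffAt.of_le hU.smoothAlong h2) (ContMDiffAt.of_le hV.smoothAlong h2)
    (ContMDiffAt.of_le hW.smoothAlong h2)

theorem smoothNear_extend (v : E) :
    SmoothNear (fun y => (FiberBundle.extend E (E := (TangentSpace 𝓘(ℝ, E) : N → Type _))
      (x := n) v y : E)) n := by
  obtain ⟨s, hs, h⟩ := FiberBundle.exists_contMDiffOn_extend (k := ∞) 𝓘(ℝ, E) E
    (V := (TangentSpace 𝓘(ℝ, E) : N → Type _)) (x₀ := n) v
  filter_upwards [eventually_mem_nhds_iff.2 hs] with y hy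
  exact (h y (mem_of_mem_nhds hy)).contMDiffAt hy

omit [FiniteDimensional ℝ E] in
theorem extend_self (v : E) :
    (FiberBundle.extend E (E := (TangentSpace 𝓘(ℝ, E) : N → Type _)) (x := n) v n : E) = v :=
  FiberBundle.extend_apply_self (E := (TangentSpace 𝓘(ℝ, E) : N → Type _)) E (x := n) v

end PlainDeriv

/-! ### The Ehresmann curvature as a tensor -/

namespace LieGrpdExt

variable {EX : Type*} [NormedAddCommGroup EX] [NormedSpace ℝ EX] [FiniteDimensional ℝ EX]
  {EY : Type*} [NormedAddCommGroup EY] [NormedSpace ℝ EY]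
  {EM : Type*} [NormedAddCommGroup EM] [NormedSpace ℝ EM]
  {X : Type*} [TopologicalSpace X] [ChartedSpace EX X] [IsManifold 𝓘(ℝ, EX) ∞ X]
  {Y : Type*} [TopologicalSpace Y] [ChartedSpace EY Y] [IsManifold 𝓘(ℝ, EY) ∞ Y]
  {M : Type*} [TopologicalSpace M] [ChartedSpace EM M] [IsManifold 𝓘(ℝ, EM) ∞ M]
  {P : LieGrpdExt (EX := EX) (EY := EY) (EM := EM) X Y M}

namespace Connection

variable (C : P.Connection)

/-- The Ehresmann curvature in terms of the differential of the vertical projection in the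
preferred chart. -/
def om (x : X) (u v : EX) : EX :=
  C.fm x (chartCurvL C.vr x (extChartAt 𝓘(ℝ, EX) x x) (u - C.vr x u) (v - C.vr x v))

theorem om_add_left (x : X) (u u' v : EX) : C.om x (u + u') v = C.om x u v + C.om x u' v := by
  have h : u + u' - C.vr x (u + u') = (u - C.vr x u) + (u' - C.vr x u') := by
    rw [map_add]; abel
  unfold om
  rw [h, map_add, add_apply, map_add]

theorem om_swap (x : X) (u v : EX) : C.om x u v = -C.om x v u := by
  unfold om
  rw [← map_neg, ← chartCurv_eq, ← chartCurv_eq, chartCurv_swap]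

theorem om_add_right (x : X) (u v v' : EX) : C.om x u (v + v') = C.om x u v + C.om x u v' := by
  rw [om_swap, om_add_left, om_swap C x u v, om_swap C x u v', neg_add]

theorem om_of_vert_left {x : X} {u v : EX} (h : C.vr x u = u) : C.om x u v = 0 := by
  unfold om
  rw [h, sub_self, map_zero, zero_apply, map_zero]

theorem om_neg_right (x : X) (u v : EX) : C.om x u (-v) = -C.om x u v := by
  have h := C.om_add_right x u v (-v)
  rw [add_neg_cancel, om_swap, C.om_of_vert_left (map_zero _), neg_zero] at h
  exact (neg_eq_of_add_eq_zero_right h.symm).symm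

variable {x : X} {U V a b c : X → EX} {ξ : X → EX}

/-- The curvature on horizontal vector fields. -/
theorem om_of_horizontal (ha : SmoothNear a x) (hb : SmoothNear b x)
    (ha0 : ∀ᶠ y in 𝓝 x, C.vr y (a y) = 0) (hb0 : ∀ᶠ y in 𝓝 x, C.vr y (b y) = 0) :
    C.om x (a x) (b x) = -C.fm x (br a b x) := by
  -- Differentiating A(b) = 0 along a curve with velocity v gives A(db(v)) = -dA(v)(b), so the
  -- coordinate bracket is converted into derivatives of A.
  have key : ∀ {b : X → EX}, SmoothNear b x → (∀ᶠ y in 𝓝 x, C.vr y (b y) = 0) → ∀ v,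
      C.vr x (md 𝓘(ℝ, EX) 𝓘(ℝ, EX) (fun y => tc EX x y (b y)) x v) =
        -fderiv ℝ (chartEnd C.vr x) (extChartAt 𝓘(ℝ, EX) x x) v (b x) := by
    intro b hb hb0 v
    obtain ⟨c, hc, hc0, hcv⟩ := exists_curve (E := EX) x v
    have hcm := hc.mdifferentiableAt (n := ∞) (by simp)
    have hct := hc.continuousAt.tendsto
    rw [hc0] at hct
    have d1 := hasDerivAt_comp_curve (c := c) (t := 0) (φ := fun y => tc EX x y (b y))
      (by rw [hc0]; exact (hb.smoothAlong.fiber (by simp)).mdifferentiableAt (by simp)) hcm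
    have d2 := C.smoothEnd_vr.hasDerivAt hc (p := x) (w := fun s => b (c s))
      (by rw [hc0]; simp) d1
    have d3 := d2.unique ((hasDerivAt_const (0 : ℝ) (0 : EX)).congr_of_eventuallyEq (by
      filter_upwards [hct.eventually hb0] with s hs
      rw [hs, map_zero]))
    have h2 := fun w => chartEnd_apply C.vr (p := x) (y := x) (by simp) w
    simp only [tc_self, ContinuousLinearMap.id_apply] at h2
    simp only [hc0, hcv, tc_self, ContinuousLinearMap.id_apply, h2] at d3
    exact (neg_eq_of_add_eq_zero_right d3).symm
  rw [← C.fm_vr, br_eq ha.smoothAlong hb.smoothAlong, map_sub, key hb hb0, key ha ha0]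
  unfold om
  rw [ha0.self_of_nhds, hb0.self_of_nhds, ← map_neg, sub_zero, sub_zero, ← chartCurv_eq]
  congr 1
  unfold chartCurv
  abel

theorem smoothNear_horizontal (hU : SmoothNear U x) : SmoothNear (fun y => U y - C.vr y (U y)) x := by
  filter_upwards [hU] with y h
  exact h.sub (C.smoothEnd_vr.along h)

theorem smoothNear_lam (hξ : ∀ᶠ y in 𝓝 x, SmoothSec EX P P.top.tgt ξ y) :
    SmoothNear (fun y => P.lam y (ξ y)) x := by
  filter_upwards [hξ] with y h
  exact P.smoothAlong_lam contMDiffAt_id h.smooth h.vert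

theorem smoothSec_fm (hU : SmoothNear U x) :
    ∀ᶠ y in 𝓝 x, SmoothSec EX P P.top.tgt (fun y => C.fm y (U y)) y := by
  filter_upwards [hU] with y h
  exact ⟨C.smoothAlong_fm h, .of_forall fun z => C.dproj_fm z _⟩

/-- `om` uses only the values of the two vectors at `x`. Applying `om_of_horizontal` to the
horizontal parts of the chosen extensions removes those extensions from the curvature. -/
theorem curv_eq (x : X) (u v : EX) : C.curv x u v = C.om x u v := by
  set eu : X → EX := fun y => FiberBundle.extend EX (E := (TangentSpace 𝓘(ℝ, EX) : X → Type _))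
      (x := x) u y with heu
  set ev : X → EX := fun y => FiberBundle.extend EX (E := (TangentSpace 𝓘(ℝ, EX) : X → Type _))
      (x := x) v y with hev
  have hu : SmoothNear eu x := smoothNear_extend u
  have hv : SmoothNear ev x := smoothNear_extend v
  have hux : eu x = u := extend_self u
  have hvx : ev x = v := extend_self v
  have h := C.om_of_horizontal (C.smoothNear_horizontal hu) (C.smoothNear_horizontal hv)
    (.of_forall fun y => C.vr_sub_vr _ _) (.of_forall fun y => C.vr_sub_vr _ _)
  have h2 : C.curv x u v = -C.fm x (br (fun y => eu y - C.vr y (eu y))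
    (fun y => ev y - C.vr y (ev y)) x) := rfl
  rw [h2, ← h, hux, hvx]
  unfold om
  rw [C.vr_sub_vr, C.vr_sub_vr, sub_zero, sub_zero]

end Connection

end LieGrpdExt

/-! ### The Bianchi identity on horizontal and vertical fields -/

namespace LieGrpdExt

variable {EX : Type*} [NormedAddCommGroup EX] [NormedSpace ℝ EX] [FiniteDimensional ℝ EX]
  {EY : Type*} [NormedAddCommGroup EY] [NormedSpace ℝ EY]
  {EM : Type*} [NormedAddCommGroup EM] [NormedSpace ℝ EM]
  {X : Type*} [TopologicalSpace X] [ChartedSpace EX X] [IsManifold 𝓘(ℝ, EX) ∞ X]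
  {Y : Type*} [TopologicalSpace Y] [ChartedSpace EY Y] [IsManifold 𝓘(ℝ, EY) ∞ Y]
  {M : Type*} [TopologicalSpace M] [ChartedSpace EM M] [IsManifold 𝓘(ℝ, EM) ∞ M]
  {P : LieGrpdExt (EX := EX) (EY := EY) (EM := EM) X Y M}

namespace Connection

variable (C : P.Connection) {x : X} {U V a b c : X → EX} {ξ : X → EX}

/-- Near `x` the curvature is minus the connection form on the bracket of the horizontal parts, and
smoothness is read off from that expression. -/
theorem smoothSec_om (hU : SmoothNear U x) (hV : SmoothNear V x) :
    ∀ᶠ y in 𝓝 x, SmoothSec EX P P.top.tgt (fun y => C.om y (U y) (V y)) y := by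
  have hU' := C.smoothNear_horizontal hU
  have hV' := C.smoothNear_horizontal hV
  have h1 := C.smoothSec_fm (hU'.br hV')
  have h2 : ∀ᶠ y in 𝓝 x, C.om y (U y) (V y) =
      -C.fm y (br (fun y => U y - C.vr y (U y)) (fun y => V y - C.vr y (V y)) y) := by
    filter_upwards [hU'.eventually_nhds, hV'.eventually_nhds] with y h1 h2
    rw [← C.om_of_horizontal h1 h2 (.of_forall fun y => C.vr_sub_vr _ _)
      (.of_forall fun y => C.vr_sub_vr _ _)]
    unfold om
    rw [C.vr_sub_vr, C.vr_sub_vr, sub_zero, sub_zero]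
  filter_upwards [h1, h2.eventually_nhds] with y h3 h4
  refine h3.neg.congr ?_
  filter_upwards [h4] with z hz
  exact hz.symm

theorem eventually_om (ha : SmoothNear a x) (hb : SmoothNear b x)
    (ha0 : ∀ᶠ y in 𝓝 x, C.vr y (a y) = 0) (hb0 : ∀ᶠ y in 𝓝 x, C.vr y (b y) = 0) :
    ∀ᶠ y in 𝓝 x, C.om y (a y) (b y) = -C.fm y (br a b y) := by
  filter_upwards [ha.eventually_nhds, hb.eventually_nhds, ha0.eventually_nhds,
    hb0.eventually_nhds] with y h1 h2 h3 h4
  exact C.om_of_horizontal h1 h2 h3 h4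

/-- The covariant derivative in a horizontal direction is a bracket. -/
theorem fm_br_horizontal_lam (ha : SmoothNear a x) (ha0 : ∀ᶠ y in 𝓝 x, C.vr y (a y) = 0)
    (hξ : ∀ᶠ y in 𝓝 x, SmoothSec EX P P.top.tgt ξ y) :
    C.fm x (br a (fun y => P.lam y (ξ y)) x) = C.cov P.top.tgt ξ x (a x) := by
  have hξ0 := hξ.self_of_nhds
  have h1 := C.fm_br_lam ha.smoothAlong hξ0
  -- The section vanishes near `x`, hence equals its own double; additivity then forces its
  -- covariant derivative to be zero.
  have h2 : (fun y => C.fm y (a y)) =ᶠ[𝓝 x] fun y => (fun y => C.fm y (a y)) y + C.fm y (a y) := by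
    filter_upwards [ha0] with y hy
    simp only [C.fm_of_vr_eq_zero hy, add_zero]
  have hf := (C.smoothSec_fm ha).self_of_nhds
  have h3 := C.cov_congr (f := P.top.tgt) h2 (P.lam x (ξ x))
  rw [C.cov_add hf hf] at h3
  rw [h1, left_eq_add.1 h3, C.fm_of_vr_eq_zero ha0.self_of_nhds, P.brkL_zero hξ0.vert.self_of_nhds,
    sub_zero, sub_zero]

/-- The curvature on a horizontal and an arbitrary vector field. -/
theorem om_horizontal_left (ha : SmoothNear a x) (ha0 : ∀ᶠ y in 𝓝 x, C.vr y (a y) = 0)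
    (hV : SmoothNear V x) :
    C.om x (a x) (V x) =
      -C.fm x (br a V x) + C.cov P.top.tgt (fun y => C.fm y (V y)) x (a x) := by
  have hV' := C.smoothNear_horizontal hV
  have hσ := C.smoothSec_fm hV
  have hZ := smoothNear_lam hσ
  have h1 := C.om_of_horizontal ha hV' ha0 (.of_forall fun y => C.vr_sub_vr _ _)
  have h2 : C.om x (a x) (V x - C.vr x (V x)) = C.om x (a x) (V x) := by
    unfold om
    rw [C.vr_sub_vr, sub_zero]
  -- V is split into its horizontal part and the fundamental field of α(V). The first yields the
  -- curvature, the second the covariant derivative of α(V).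
  have h3 := br_add_right hV' hZ a
  have h4 : (fun y => V y - C.vr y (V y) + P.lam y (C.fm y (V y))) = V := by
    funext y
    rw [C.lam_fm, sub_add_cancel]
  rw [h4] at h3
  rw [← h2, h1, h3, map_add, C.fm_br_horizontal_lam ha ha0 hσ]
  abel

/-- Both terms on the left contain ∇_c α([a, b]), once from ω(a, b) = -α([a, b]) and once from ω(c,
[a, b]). These cancel and leave a double bracket. -/
theorem cov_om_horizontal (ha : SmoothNear a x) (hb : SmoothNear b x)
    (hc : SmoothNear c x) (ha0 : ∀ᶠ y in 𝓝 x, C.vr y (a y) = 0)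
    (hb0 : ∀ᶠ y in 𝓝 x, C.vr y (b y) = 0) (hc0 : ∀ᶠ y in 𝓝 x, C.vr y (c y) = 0) :
    C.cov P.top.tgt (fun y => C.om y (a y) (b y)) x (c x) - C.om x (br a b x) (c x) =
      -C.fm x (br c (br a b) x) := by
  have h1 := C.om_horizontal_left hc hc0 (ha.br hb)
  have h2 := C.cov_congr (f := P.top.tgt) (C.eventually_om ha hb ha0 hb0) (c x)
  rw [C.cov_neg (C.smoothSec_fm (ha.br hb)).self_of_nhds] at h2
  rw [C.om_swap, h1, h2]
  abel

/-- The Bianchi identity on horizontal vector fields. -/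
theorem bianchi_horizontal (ha : SmoothNear a x) (hb : SmoothNear b x)
    (hc : SmoothNear c x) (ha0 : ∀ᶠ y in 𝓝 x, C.vr y (a y) = 0)
    (hb0 : ∀ᶠ y in 𝓝 x, C.vr y (b y) = 0) (hc0 : ∀ᶠ y in 𝓝 x, C.vr y (c y) = 0) :
    C.cov P.top.tgt (fun y => C.om y (b y) (c y)) x (a x)
      - C.cov P.top.tgt (fun y => C.om y (a y) (c y)) x (b x)
      + C.cov P.top.tgt (fun y => C.om y (a y) (b y)) x (c x)
      - C.om x (br a b x) (c x) + C.om x (br a c x) (b x) - C.om x (br b c x) (a x) = 0 := by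
  have h1 := C.cov_om_horizontal hb hc ha hb0 hc0 ha0
  have h2 := C.cov_om_horizontal ha hc hb ha0 hc0 hb0
  have h3 := C.cov_om_horizontal ha hb hc ha0 hb0 hc0
  have h4 := congrArg (C.fm x) (br_jacobi ha hb hc)
  rw [map_add, br_swap (br a b) c, map_neg] at h4
  rw [sub_eq_iff_eq_add] at h1 h2 h3
  rw [h1, h2, h3, h4]
  abel

/-- The Bianchi identity on two horizontal and one vertical vector field. -/
theorem bianchi_vertical (ha : SmoothNear a x) (hb : SmoothNear b x)
    (ha0 : ∀ᶠ y in 𝓝 x, C.vr y (a y) = 0) (hb0 : ∀ᶠ y in 𝓝 x, C.vr y (b y) = 0)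
    (hξ : ∀ᶠ y in 𝓝 x, SmoothSec EX P P.top.tgt ξ y) :
    C.cov P.top.tgt (fun y => C.om y (a y) (b y)) x (P.lam x (ξ x))
      + P.brkL (P.top.tgt x) (C.om x (a x) (b x)) (ξ x)
      + C.om x (a x) (br b (fun y => P.lam y (ξ y)) x)
      - C.om x (b x) (br a (fun y => P.lam y (ξ y)) x) =
    chartRiem C.vr (P.top.unit (P.top.tgt x))
      (md 𝓘(ℝ, EX) 𝓘(ℝ, EX) (fun y => P.top.unit (P.top.tgt y)) x (a x))
      (md 𝓘(ℝ, EX) 𝓘(ℝ, EX) (fun y => P.top.unit (P.top.tgt y)) x (b x)) (ξ x) := by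
  have hZ := smoothNear_lam hξ
  have hξ0 := hξ.self_of_nhds
  have hab := ha.br hb
  -- As α([b, ξ^▷]) = ∇_b ξ near `x`, the curvature on a and [b, ξ^▷] is a double bracket plus an
  -- iterated covariant derivative of ξ.
  have key : ∀ {a b : X → EX}, SmoothNear a x → SmoothNear b x →
      (∀ᶠ y in 𝓝 x, C.vr y (a y) = 0) → (∀ᶠ y in 𝓝 x, C.vr y (b y) = 0) →
      C.om x (a x) (br b (fun y => P.lam y (ξ y)) x) =
        -C.fm x (br a (br b (fun y => P.lam y (ξ y))) x)
          + C.cov P.top.tgt (fun y => C.cov P.top.tgt ξ y (b y)) x (a x) := by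
    intro a b ha hb ha0 hb0
    have h1 := C.om_horizontal_left ha ha0 (hb.br hZ)
    have h2 : (fun y => C.fm y (br b (fun y => P.lam y (ξ y)) y)) =ᶠ[𝓝 x]
        fun y => C.cov P.top.tgt ξ y (b y) := by
      filter_upwards [hb.eventually_nhds, hb0.eventually_nhds, hξ.eventually_nhds] with y h1 h2 h3
      exact C.fm_br_horizontal_lam h1 h2 h3
    rw [h1, C.cov_congr h2]
  have h1 := C.fm_br_lam hab.smoothAlong hξ0
  have h2 := C.cov_congr (f := P.top.tgt) (C.eventually_om ha hb ha0 hb0) (P.lam x (ξ x))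
  rw [C.cov_neg (C.smoothSec_fm hab).self_of_nhds] at h2
  have h3 := C.om_of_horizontal ha hb ha0 hb0
  -- In the Jacobi identity the term α([[a, b], ξ^▷]) is evaluated by `fm_br_lam`. It brings in
  -- ∇_{[a, b]} ξ and, through α([a, b]) = -ω(a, b), the covariant derivative and the bracket of the
  -- curvature.
  have h4 := congrArg (C.fm x) (br_jacobi ha hb hZ)
  rw [map_add, h1] at h4
  rw [← C.cov_commutator hξ ha.smoothAlong hb.smoothAlong, key ha hb ha0 hb0, key hb ha hb0 ha0,
    h2, h3, P.brkL_neg hξ0.vert.self_of_nhds (C.dproj_fm x _), h4]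
  abel

/-- The bracket of vertical vector fields is vertical. -/
theorem vr_br_vertical (hU : SmoothNear U x) (hV : SmoothNear V x)
    (hU0 : ∀ᶠ y in 𝓝 x, P.dproj y (U y) = 0) (hV0 : ∀ᶠ y in 𝓝 x, P.dproj y (V y) = 0) :
    C.vr x (br U V x) = br U V x := by
  set φ : X → EY := fun y => extChartAt 𝓘(ℝ, EY) (P.proj x) (P.proj y) with hφ
  have hsrc : ∀ᶠ y in 𝓝 x, P.proj y ∈ (extChartAt 𝓘(ℝ, EY) (P.proj x)).source :=
    P.proj_submersion.contMDiff.continuous.continuousAt.eventually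
      (extChartAt_source_mem_nhds (P.proj x))
  have hφs : ∀ᶠ y in 𝓝 x, ContMDiffAt 𝓘(ℝ, EX) 𝓘(ℝ, EY) ∞ φ y := by
    filter_upwards [hsrc] with y hy
    exact ContMDiffAt.comp (g := extChartAt 𝓘(ℝ, EY) (P.proj x)) y (contMDiffAt_chart hy)
      P.proj_submersion.contMDiff.contMDiffAt
  have hφd : ∀ᶠ y in 𝓝 x, ∀ v, md 𝓘(ℝ, EX) 𝓘(ℝ, EY) φ y v =
      tc EY (P.proj x) (P.proj y) (P.dproj y v) := by
    filter_upwards [hsrc] with y hy v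
    exact md_comp_apply (mdifferentiableAt_chart hy) (P.mdifferentiableAt_proj y) v
  have h0 : ∀ {W : X → EX}, (∀ᶠ y in 𝓝 x, P.dproj y (W y) = 0) → ∀ v,
      md 𝓘(ℝ, EX) 𝓘(ℝ, EY) (fun y => md 𝓘(ℝ, EX) 𝓘(ℝ, EY) φ y (W y)) x v = 0 := by
    intro W hW v
    have h1 : (fun y => md 𝓘(ℝ, EX) 𝓘(ℝ, EY) φ y (W y)) =ᶠ[𝓝 x] fun _ => (0 : EY) := by
      filter_upwards [hφd, hW] with y h1 h2
      rw [h1, h2, map_zero]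
    rw [md_congr h1, md_const, zero_apply]
  -- The coordinates of the projection are annihilated by both fields, hence by their bracket.
  have h1 := md_br hφs hU.smoothAlong hV.smoothAlong
  rw [h0 hV0, h0 hU0, sub_zero, hφd.self_of_nhds, tc_self] at h1
  exact C.vr_of_vert h1

end Connection

end LieGrpdExt

/-! ### Assembling the first Bianchi identity -/

namespace LieGrpdExt

variable {EX : Type*} [NormedAddCommGroup EX] [NormedSpace ℝ EX] [FiniteDimensional ℝ EX]
  {EY : Type*} [NormedAddCommGroup EY] [NormedSpace ℝ EY]
  {EM : Type*} [NormedAddCommGroup EM] [NormedSpace ℝ EM]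
  {X : Type*} [TopologicalSpace X] [ChartedSpace EX X] [IsManifold 𝓘(ℝ, EX) ∞ X]
  {Y : Type*} [TopologicalSpace Y] [ChartedSpace EY Y] [IsManifold 𝓘(ℝ, EY) ∞ Y]
  {M : Type*} [TopologicalSpace M] [ChartedSpace EM M] [IsManifold 𝓘(ℝ, EM) ∞ M]
  {P : LieGrpdExt (EX := EX) (EY := EY) (EM := EM) X Y M}

namespace Connection

variable (C : P.Connection)

theorem covDeriv_eq_of_eventuallyEq {EN : Type*} [NormedAddCommGroup EN] [NormedSpace ℝ EN]
    {N : Type*} [TopologicalSpace N] [ChartedSpace EN N] [IsManifold 𝓘(ℝ, EN) ∞ N]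
    {f : N → M} {σ σ' : N → EX} {n : N} (h : SmoothSec EN P f σ n) (h' : σ' =ᶠ[𝓝 n] σ) (v : EN) :
    C.covDeriv f σ' n v = C.cov f σ n v :=
  (C.covDeriv_eq (h.congr h'.symm) v).trans (C.cov_congr h' v)

/-- The general commutator formula for the identity map of `M`. The result depends only on the
values at `m`, so the chosen extensions disappear. -/
theorem curvLie_eq [FiniteDimensional ℝ EM] (m : M) (u v : EM) {ξ : EX}
    (hξ : P.dproj (P.top.unit m) ξ = 0) :
    C.curvLie m u v ξ = chartRiem C.vr (P.top.unit m)
      (md 𝓘(ℝ, EM) 𝓘(ℝ, EX) P.top.unit m u) (md 𝓘(ℝ, EM) 𝓘(ℝ, EX) P.top.unit m v) ξ := by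
  set eu : M → EM := fun y => FiberBundle.extend EM (E := (TangentSpace 𝓘(ℝ, EM) : M → Type _))
      (x := m) u y with heu
  set ev : M → EM := fun y => FiberBundle.extend EM (E := (TangentSpace 𝓘(ℝ, EM) : M → Type _))
      (x := m) v y with hev
  set eξ : X → EX := fun y => FiberBundle.extend EX (E := (TangentSpace 𝓘(ℝ, EX) : X → Type _))
      (x := P.top.unit m) ξ y with heξ
  have hu : SmoothNear eu m := smoothNear_extend u
  have hv : SmoothNear ev m := smoothNear_extend v
  have hux : eu m = u := extend_self u
  have hvx : ev m = v := extend_self v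
  have hξn : SmoothNear eξ (P.top.unit m) := smoothNear_extend ξ
  have hξx : eξ (P.top.unit m) = ξ := extend_self ξ
  set s : M → EX := fun m' => C.vr (P.top.unit m') (eξ (P.top.unit m')) with hs
  have hsx : s m = ξ := by
    rw [hs]
    simp only [hξx]
    exact C.vr_of_vert hξ
  have hsec : ∀ᶠ m' in 𝓝 m, SmoothSec EM P (fun y => y) s m' := by
    filter_upwards [P.top.contMDiff_unit.continuous.continuousAt.eventually hξn] with m' hm'
    refine ⟨C.smoothEnd_vr.along
      (SmoothAlong.comp (g := P.top.unit) hm' P.top.contMDiff_unit.contMDiffAt), ?_⟩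
    exact .of_forall fun y => C.dproj_vr _ _
  -- The extended section is known to be smooth only near `m`, so the inner derivatives are
  -- identified only there; the outer derivative is local.
  have hcov : ∀ {w : M → EM}, (fun m' => C.covDeriv (fun y => y) s m' (w m')) =ᶠ[𝓝 m]
      fun m' => C.cov (fun y => y) s m' (w m') := by
    intro w
    filter_upwards [hsec] with y hy
    exact C.covDeriv_eq hy _
  have h1 : C.curvLie m u v ξ =
      C.covDeriv (fun y : M => y) (fun m' => C.covDeriv (fun y => y) s m' (ev m')) m u
      - C.covDeriv (fun y : M => y) (fun m' => C.covDeriv (fun y => y) s m' (eu m')) m v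
      - C.covDeriv (fun y => y) s m (br (E := EM) eu ev m) := rfl
  rw [h1, C.covDeriv_eq hsec.self_of_nhds,
    C.covDeriv_eq_of_eventuallyEq (C.smoothSec_cov hsec hv.smoothAlong) hcov,
    C.covDeriv_eq_of_eventuallyEq (C.smoothSec_cov hsec hu.smoothAlong) hcov]
  have h2 := C.cov_commutator hsec hu.smoothAlong hv.smoothAlong
  rw [hux, hvx, hsx] at h2
  exact h2

/-- Of the four brackets of horizontal and vertical parts, the one of two vertical fields is
vertical and killed by the curvature. The mixed ones are put in the form in which they occur in
`bianchi_vertical`. -/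
theorem om_br_left {x : X} {U V : X → EX} (hU : SmoothNear U x) (hV : SmoothNear V x) (w : EX) :
    C.om x (br U V x) w =
      C.om x (br (fun y => U y - C.vr y (U y)) (fun y => V y - C.vr y (V y)) x) w
      - C.om x w (br (fun y => U y - C.vr y (U y)) (fun y => P.lam y (C.fm y (V y))) x)
      + C.om x w (br (fun y => V y - C.vr y (V y)) (fun y => P.lam y (C.fm y (U y))) x) := by
  have hU' := C.smoothNear_horizontal hU
  have hV' := C.smoothNear_horizontal hV
  have hZU := smoothNear_lam (C.smoothSec_fm hU)
  have hZV := smoothNear_lam (C.smoothSec_fm hV)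
  have hs : ∀ W : X → EX, (fun y => W y - C.vr y (W y) + P.lam y (C.fm y (W y))) = W := by
    intro W
    funext y
    rw [C.lam_fm, sub_add_cancel]
  have hd : ∀ (W : X → EX), ∀ᶠ y in 𝓝 x, P.dproj y (P.lam y (C.fm y (W y))) = 0 :=
    fun W => .of_forall fun y => P.dproj_lam (C.dproj_fm y _)
  have h1 := br_add_left hU' hZU V
  have h2 := fun A : X → EX => br_add_right hV' hZV A
  rw [hs U] at h1
  simp only [hs V] at h2
  rw [h1, h2, h2, om_add_left, om_add_left, om_add_left,
    C.om_of_vert_left (C.vr_br_vertical hZU hZV (hd U) (hd V)), add_zero,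
    C.om_swap x (br (fun y => U y - C.vr y (U y)) (fun y => P.lam y (C.fm y (V y))) x),
    br_swap (fun y => P.lam y (C.fm y (U y))), C.om_swap x (-_), om_neg_right, neg_neg,
    sub_eq_add_neg]

/-- Splitting each field into horizontal and vertical parts leaves one identity on three horizontal
fields and three with exactly one vertical field. Every other component is zero. -/
theorem bianchi [FiniteDimensional ℝ EM] {U V W : X → EX} {x : X} (hU : SmoothNear U x)
    (hV : SmoothNear V x) (hW : SmoothNear W x) :
    C.extCovDeriv C.curv U V W x + gradedBracket P C.form C.curv x (U x) (V x) (W x) =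
      C.curvPairing C.form x (U x) (V x) (W x) := by
  have hU' := C.smoothNear_horizontal hU
  have hV' := C.smoothNear_horizontal hV
  have hW' := C.smoothNear_horizontal hW
  have hv : ∀ T : X → EX, ∀ᶠ y in 𝓝 x, C.vr y (T y - C.vr y (T y)) = 0 :=
    fun T => .of_forall fun y => C.vr_sub_vr _ _
  have h0 := C.bianchi_horizontal hU' hV' hW' (hv U) (hv V) (hv W)
  have h1 := C.bianchi_vertical hV' hW' (hv V) (hv W) (C.smoothSec_fm hU)
  have h2 := C.bianchi_vertical hU' hW' (hv U) (hv W) (C.smoothSec_fm hV)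
  have h3 := C.bianchi_vertical hU' hV' (hv U) (hv V) (C.smoothSec_fm hW)
  have hom : ∀ (y : X) (u v : EX),
      C.om y u v = C.om y (u - C.vr y u) (v - C.vr y v) := by
    intro y u v
    unfold om
    rw [C.vr_sub_vr, C.vr_sub_vr, sub_zero, sub_zero]
  have hsplit : ∀ T : X → EX, T x = (T x - C.vr x (T x)) + P.lam x (C.fm x (T x)) := by
    intro T
    rw [C.lam_fm, sub_add_cancel]
  have homr : ∀ (u v : EX), C.om x u v = C.om x u (v - C.vr x v) := by
    intro u v
    unfold om
    rw [C.vr_sub_vr, sub_zero]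
  have hnab : ∀ {A B : X → EX}, SmoothNear A x → SmoothNear B x → ∀ T : X → EX,
      C.nablaT (fun y => C.curv y (A y) (B y)) x (T x) =
        C.cov P.top.tgt (fun y => C.om y (A y - C.vr y (A y)) (B y - C.vr y (B y))) x
          (T x - C.vr x (T x)) +
        C.cov P.top.tgt (fun y => C.om y (A y - C.vr y (A y)) (B y - C.vr y (B y))) x
          (P.lam x (C.fm x (T x))) := by
    intro A B hA hB T
    rw [← cov_add_vec, ← hsplit]
    refine C.covDeriv_eq_of_eventuallyEq (C.smoothSec_om (C.smoothNear_horizontal hA)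
      (C.smoothNear_horizontal hB)).self_of_nhds (.of_forall fun y => ?_) _
    exact (C.curv_eq y _ _).trans (hom y _ _)
  have hbr : ∀ {A B : X → EX}, SmoothNear A x → SmoothNear B x → ∀ T : X → EX,
      C.curv x (VectorField.mlieBracket 𝓘(ℝ, EX) A B x) (T x) =
      C.om x (br (fun y => A y - C.vr y (A y)) (fun y => B y - C.vr y (B y)) x)
        (T x - C.vr x (T x))
      - C.om x (T x - C.vr x (T x))
        (br (fun y => A y - C.vr y (A y)) (fun y => P.lam y (C.fm y (B y))) x)
      + C.om x (T x - C.vr x (T x))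
        (br (fun y => B y - C.vr y (B y)) (fun y => P.lam y (C.fm y (A y))) x) := by
    intro A B hA hB T
    rw [← C.om_br_left hA hB]
    exact (C.curv_eq x _ _).trans (homr _ _)
  have hbk : ∀ A B T : X → EX,
      P.bracket (P.top.tgt x) (C.form x (T x)) (C.curv x (A x) (B x)) =
      P.brkL (P.top.tgt x) (C.om x (A x - C.vr x (A x)) (B x - C.vr x (B x))) (C.fm x (T x)) := by
    intro A B T
    rw [← hom, ← curv_eq]
    rfl
  -- The target annihilates vertical vectors, so only the horizontal parts of the first two fields
  -- matter. This matches the pulled back curvature with the one in `bianchi_vertical`.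
  have hR : ∀ A B T : X → EX,
      C.curvLie (P.top.tgt x) (mfderiv 𝓘(ℝ, EX) 𝓘(ℝ, EM) P.top.tgt x (A x))
        (mfderiv 𝓘(ℝ, EX) 𝓘(ℝ, EM) P.top.tgt x (B x)) (C.form x (T x)) =
      chartRiem C.vr (P.top.unit (P.top.tgt x))
        (md 𝓘(ℝ, EX) 𝓘(ℝ, EX) (fun y => P.top.unit (P.top.tgt y)) x (A x - C.vr x (A x)))
        (md 𝓘(ℝ, EX) 𝓘(ℝ, EX) (fun y => P.top.unit (P.top.tgt y)) x (B x - C.vr x (B x)))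
        (C.fm x (T x)) := by
    intro A B T
    have e1 : ∀ v : EX, md 𝓘(ℝ, EX) 𝓘(ℝ, EX) (fun y => P.top.unit (P.top.tgt y)) x
        (v - C.vr x v) = md 𝓘(ℝ, EM) 𝓘(ℝ, EX) P.top.unit (P.top.tgt x)
          (md 𝓘(ℝ, EX) 𝓘(ℝ, EM) P.top.tgt x v) := by
      intro v
      rw [md_comp_apply (g := P.top.unit) (P.top.mdifferentiableAt_unit _)
        (P.top.mdifferentiableAt_tgt x), map_sub (md 𝓘(ℝ, EX) 𝓘(ℝ, EM) P.top.tgt x),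
        P.md_tgt_of_vert (C.dproj_vr x v), sub_zero]
    rw [e1, e1]
    exact C.curvLie_eq _ _ _ (C.dproj_fm x _)
  unfold extCovDeriv gradedBracket curvPairing
  change ((_ : EX) - _ + _ - _ + _ - _) + (_ - _ + _) = (_ - _ + _ : EX)
  rw [hnab hV hW, hnab hU hW, hnab hU hV, hbr hU hV, hbr hU hW, hbr hV hW, hbk V W U, hbk U W V,
    hbk U V W, hR U V W, hR U W V, hR V W U, ← h1, ← h2, ← h3]
  -- With the curvature of the bundle replaced by the three vertical identities, the difference of
  -- the two sides is exactly the horizontal sum.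
  refine sub_eq_zero.1 (Eq.trans ?_ h0)
  abel

end Connection

end LieGrpdExt

/-! ### Multiplicativity of the curvature -/

namespace PlainDeriv

variable {E : Type*} [NormedAddCommGroup E] [NormedSpace ℝ E]
  {N : Type*} [TopologicalSpace N] [ChartedSpace E N] [IsManifold 𝓘(ℝ, E) ∞ N]

/-- Two tangent vectors are the velocities of a smooth two-parameter family of points. -/
theorem exists_surface (n : N) (u v : E) :
    ∃ a : ℝ × ℝ → N, ContMDiffAt 𝓘(ℝ, ℝ × ℝ) 𝓘(ℝ, E) ∞ a (0, 0) ∧ a (0, 0) = n ∧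
      vel 𝓘(ℝ, E) (fun s => a (s, 0)) 0 = u ∧ vel 𝓘(ℝ, E) (fun t => a (0, t)) 0 = v := by
  set e := extChartAt 𝓘(ℝ, E) n
  have hL : ContMDiffAt 𝓘(ℝ, ℝ × ℝ) 𝓘(ℝ, E) ∞
      (fun q : ℝ × ℝ => e n + q.1 • u + q.2 • v) (0, 0) :=
    ContDiffAt.contMDiffAt (by fun_prop)
  have h0 : e n + (0 : ℝ) • u + (0 : ℝ) • v = e n := by simp
  have hs : ContMDiffAt 𝓘(ℝ, E) 𝓘(ℝ, E) ∞ e.symm (e n + (0 : ℝ) • u + (0 : ℝ) • v) := by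
    rw [h0]
    exact contMDiffAt_chart_symm (mem_extChartAt_target n)
  have ha : ContMDiffAt 𝓘(ℝ, ℝ × ℝ) 𝓘(ℝ, E) ∞
      (fun q : ℝ × ℝ => e.symm (e n + q.1 • u + q.2 • v)) (0, 0) :=
    ContMDiffAt.comp ((0 : ℝ), (0 : ℝ)) hs hL
  have ha0 : e.symm (e n + (0 : ℝ) • u + (0 : ℝ) • v) = n := by
    rw [h0]; simp [e]
  have key : ∀ {l : ℝ → ℝ × ℝ} {w : E}, ContMDiffAt 𝓘(ℝ, ℝ) 𝓘(ℝ, ℝ × ℝ) ∞ l 0 → l 0 = (0, 0) →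
      HasDerivAt (fun s => e n + (l s).1 • u + (l s).2 • v) w 0 →
      vel 𝓘(ℝ, E) (fun s => e.symm (e n + (l s).1 • u + (l s).2 • v)) 0 = w := by
    intro l w hl hl0 hw
    have hc : MDifferentiableAt 𝓘(ℝ, ℝ) 𝓘(ℝ, E)
        (fun s => e.symm (e n + (l s).1 • u + (l s).2 • v)) 0 := by
      refine (ContMDiffAt.comp (g := fun q : ℝ × ℝ => e.symm (e n + q.1 • u + q.2 • v))
        (0 : ℝ) ?_ hl).mdifferentiableAt (n := ∞) (by simp)
      rw [hl0]; exact ha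
    have hc0 : e.symm (e n + (l 0).1 • u + (l 0).2 • v) = n := by rw [hl0]; exact ha0
    have h1 := deriv_chart_comp (p := n) (t := 0) (by rw [hc0]; simp) hc
    rw [hc0, tc_self] at h1
    refine h1.unique (hw.congr_of_eventuallyEq ?_)
    have h2 := hw.continuousAt.eventually ((isOpen_extChartAt_target n).mem_nhds (by
      change e n + (l 0).1 • u + (l 0).2 • v ∈ _
      rw [hl0, h0]
      exact mem_extChartAt_target n))
    filter_upwards [h2] with s hs
    exact e.right_inv hs
  refine ⟨_, ha, ha0, key (l := fun s => (s, 0)) ?_ rfl ?_, key (l := fun s => (0, s)) ?_ rfl ?_⟩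
  · exact ContDiffAt.contMDiffAt (by fun_prop)
  · simpa using (((hasDerivAt_id (0 : ℝ)).smul_const u).const_add (e n))
  · exact ContDiffAt.contMDiffAt (by fun_prop)
  · simpa using (((hasDerivAt_id (0 : ℝ)).smul_const v).const_add (e n))

end PlainDeriv

namespace LieGrpdExt

variable {EX : Type*} [NormedAddCommGroup EX] [NormedSpace ℝ EX] [FiniteDimensional ℝ EX]
  {EY : Type*} [NormedAddCommGroup EY] [NormedSpace ℝ EY]
  {EM : Type*} [NormedAddCommGroup EM] [NormedSpace ℝ EM]
  {X : Type*} [TopologicalSpace X] [ChartedSpace EX X] [IsManifold 𝓘(ℝ, EX) ∞ X]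
  {Y : Type*} [TopologicalSpace Y] [ChartedSpace EY Y] [IsManifold 𝓘(ℝ, EY) ∞ Y]
  {M : Type*} [TopologicalSpace M] [ChartedSpace EM M] [IsManifold 𝓘(ℝ, EM) ∞ M]
  {P : LieGrpdExt (EX := EX) (EY := EY) (EM := EM) X Y M}

/-- The derivative of a vertical field along a curve that vanishes at the origin is vertical. -/
theorem dproj_of_hasDerivAt {c : ℝ → X} {w : ℝ → EX} {w' : EX}
    (hc : ContMDiffAt 𝓘(ℝ, ℝ) 𝓘(ℝ, EX) ∞ c 0) (hw0 : w 0 = 0)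
    (hw : HasDerivAt (fun s => tc EX (c 0) (c s) (w s)) w' 0)
    (hv : ∀ s, P.dproj (c s) (w s) = 0) : P.dproj (c 0) w' = 0 := by
  have h1 := hasDerivAt_md_of_vanishing (f := fun _ : ℝ => P.proj)
    (ContMDiffAt.comp (g := P.proj) (f := Prod.snd) ((0 : ℝ), c 0)
      P.proj_submersion.contMDiff.contMDiffAt contMDiffAt_snd) hc hw0 hw
  refine h1.unique ((hasDerivAt_const (0 : ℝ) (0 : EY)).congr_of_eventuallyEq
    (.of_forall fun s => ?_))
  have h2 : md 𝓘(ℝ, EX) 𝓘(ℝ, EY) P.proj (c s) (w s) = 0 := hv s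
  simp only [h2, map_zero]

namespace Connection

variable (C : P.Connection)

/-- The derivative of the vertical part of a product of tangent vectors along a curve. -/
theorem hasDerivAt_vr_tmL {a b : ℝ → X} {wa wb : ℝ → EX} {da db : EX}
    (ha : ContMDiffAt 𝓘(ℝ, ℝ) 𝓘(ℝ, EX) ∞ a 0) (hb : ContMDiffAt 𝓘(ℝ, ℝ) 𝓘(ℝ, EX) ∞ b 0)
    (hc : ∀ᶠ s in 𝓝 (0 : ℝ), P.top.tgt (a s) = P.top.src (b s))
    (hw : ∀ᶠ s in 𝓝 (0 : ℝ), md 𝓘(ℝ, EX) 𝓘(ℝ, EM) P.top.tgt (a s) (wa s) =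
      md 𝓘(ℝ, EX) 𝓘(ℝ, EM) P.top.src (b s) (wb s))
    (ha0 : C.vr (a 0) (wa 0) = 0) (hb0 : C.vr (b 0) (wb 0) = 0)
    (hda : HasDerivAt (fun s => tc EX (a 0) (a s) (C.vr (a s) (wa s))) da 0)
    (hdb : HasDerivAt (fun s => tc EX (b 0) (b s) (C.vr (b s) (wb s))) db 0) :
    HasDerivAt (fun s => tc EX (P.top.mul (a 0) (b 0)) (P.top.mul (a s) (b s))
      (C.vr (P.top.mul (a s) (b s)) (P.top.tmL (a s) (b s) (wa s, wb s))))
      (P.top.tmL (a 0) (b 0) (da, db)) 0 ∧ P.dproj (a 0) da = 0 ∧ P.dproj (b 0) db = 0 := by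
  have hva := dproj_of_hasDerivAt ha ha0 hda fun s => C.dproj_vr _ _
  have hvb := dproj_of_hasDerivAt hb hb0 hdb fun s => C.dproj_vr _ _
  refine ⟨?_, hva, hvb⟩
  have h1 := P.top.hasDerivAt_tmL_left ha hb hc (.of_forall fun s => P.md_tgt_of_vert
    (C.dproj_vr _ _)) ha0 hda (P.md_tgt_of_vert hva)
  have h2 := P.top.hasDerivAt_tmL_right ha hb hc (.of_forall fun s => P.md_src_of_vert
    (C.dproj_vr _ _)) hb0 hdb (P.md_src_of_vert hvb)
  -- The vertical part of the product is the product of the vertical parts. Splitting it gives two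
  -- products with a zero vector, each differentiated separately.
  have hsum : ∀ p q : EX, ((p, q) : EX × EX) = (p, 0) + (0, q) := fun p q => by simp
  rw [hsum, map_add]
  refine (h1.add h2).congr_of_eventuallyEq ?_
  filter_upwards [hc, hw] with s h3 h4
  rw [C.vr_tmL h3 h4, hsum, map_add, map_add]
  rfl

/-- On horizontal vectors the curvature is α of the exterior derivative of A over any surface with
these velocities. For a product of composable surfaces that derivative is the tangent product of the
two factors' derivatives. -/
theorem om_tmL_horizontal {x y : X} (h : P.top.tgt x = P.top.src y) {u₁ v₁ u₂ v₂ : EX}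
    (hu : md 𝓘(ℝ, EX) 𝓘(ℝ, EM) P.top.tgt x u₁ = md 𝓘(ℝ, EX) 𝓘(ℝ, EM) P.top.src y u₂)
    (hv : md 𝓘(ℝ, EX) 𝓘(ℝ, EM) P.top.tgt x v₁ = md 𝓘(ℝ, EX) 𝓘(ℝ, EM) P.top.src y v₂)
    (hu₁ : C.vr x u₁ = 0) (hv₁ : C.vr x v₁ = 0) (hu₂ : C.vr y u₂ = 0) (hv₂ : C.vr y v₂ = 0) :
    C.om (P.top.mul x y) (P.top.tmL x y (u₁, u₂)) (P.top.tmL x y (v₁, v₂)) =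
      P.AdL (P.top.inv y) (C.om x u₁ v₁) + C.om y u₂ v₂ := by
  obtain ⟨a, ha, ha0, hau, hav⟩ := exists_surface x u₁ v₁
  obtain ⟨d, hd, hd0, hdu, hdv⟩ := exists_surface y u₂ v₂
  obtain ⟨ρ, hρ, hρ1, hρ2⟩ := exists_fibre_retraction P.top.src_submersion y
  have hta : ContMDiffAt 𝓘(ℝ, ℝ × ℝ) 𝓘(ℝ, EM) ∞ (fun q => P.top.tgt (a q)) (0, 0) :=
    ContMDiffAt.comp (g := P.top.tgt) ((0 : ℝ), (0 : ℝ)) P.top.contMDiff_tgt.contMDiffAt ha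
  have hpair := hta.prodMk hd
  have hp0 : (P.top.tgt (a (0, 0)), d (0, 0)) = (P.top.src y, y) := by rw [ha0, hd0, h]
  have hpt := hpair.continuousAt.tendsto
  rw [hp0] at hpt
  -- The second surface is moved into the source fibres over the targets of the first. Composability
  -- of the tangent vectors ensures that its velocities at the origin are preserved.
  set b : ℝ × ℝ → X := fun q => ρ (P.top.tgt (a q), d q) with hbdef
  have hb : ContMDiffAt 𝓘(ℝ, ℝ × ℝ) 𝓘(ℝ, EX) ∞ b (0, 0) := by
    refine ContMDiffAt.comp (g := ρ) ((0 : ℝ), (0 : ℝ)) ?_ hpair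
    rw [hp0]; exact hρ
  have hb0 : b (0, 0) = y := by
    simp only [hbdef]
    rw [hp0]
    exact hρ2.self_of_nhds
  have hcomp : ∀ᶠ q in 𝓝 ((0 : ℝ), (0 : ℝ)), P.top.tgt (a q) = P.top.src (b q) := by
    filter_upwards [hpt.eventually hρ1] with q hq
    exact hq.symm
  have hF := P.top.contMDiffAt_mul ha hb hcomp
  -- coordinate lines
  have hline : ∀ q : ℝ × ℝ, ContMDiffAt 𝓘(ℝ, ℝ) 𝓘(ℝ, ℝ × ℝ) ∞ (fun s : ℝ => (s, q.2)) q.1 ∧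
      ContMDiffAt 𝓘(ℝ, ℝ) 𝓘(ℝ, ℝ × ℝ) ∞ (fun t : ℝ => (q.1, t)) q.2 :=
    fun q => ⟨ContDiffAt.contMDiffAt (by fun_prop), ContDiffAt.contMDiffAt (by fun_prop)⟩
  have hl1 := (hline (0, 0)).1
  have hl2 := (hline (0, 0)).2
  have ht1 : Tendsto (fun s : ℝ => ((s, 0) : ℝ × ℝ)) (𝓝 0) (𝓝 (0, 0)) :=
    (continuous_id.prodMk continuous_const).tendsto _
  have ht2 : Tendsto (fun s : ℝ => ((0, s) : ℝ × ℝ)) (𝓝 0) (𝓝 (0, 0)) :=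
    (continuous_const.prodMk continuous_id).tendsto _
  have hsw : Tendsto (fun q : ℝ × ℝ => (q.2, q.1)) (𝓝 (0, 0)) (𝓝 (0, 0)) :=
    continuous_swap.tendsto _
  have hs : ∀ {c : ℝ × ℝ → X}, ContMDiffAt 𝓘(ℝ, ℝ × ℝ) 𝓘(ℝ, EX) ∞ c (0, 0) →
      ContMDiffAt 𝓘(ℝ, ℝ) 𝓘(ℝ, EX) ∞ (fun s => c (s, 0)) 0 ∧
      ContMDiffAt 𝓘(ℝ, ℝ) 𝓘(ℝ, EX) ∞ (fun t => c (0, t)) 0 ∧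
      (∀ᶠ s in 𝓝 (0 : ℝ), MDifferentiableAt 𝓘(ℝ, ℝ) 𝓘(ℝ, EX) (fun t => c (s, t)) 0) ∧
      ∀ᶠ t in 𝓝 (0 : ℝ), MDifferentiableAt 𝓘(ℝ, ℝ) 𝓘(ℝ, EX) (fun s => c (s, t)) 0 := by
    intro c hc
    refine ⟨ContMDiffAt.comp (g := c) (0 : ℝ) hc hl1, ContMDiffAt.comp (g := c) (0 : ℝ) hc hl2,
      ?_, ?_⟩
    · filter_upwards [ht1.eventually (eventually_mdifferentiableAt hc)] with s h
      exact MDifferentiableAt.comp (g := c) (0 : ℝ) h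
        ((hline (s, 0)).2.mdifferentiableAt (by simp))
    · filter_upwards [ht2.eventually (eventually_mdifferentiableAt hc)] with s h
      exact MDifferentiableAt.comp (g := c) (0 : ℝ) h
        ((hline (0, s)).1.mdifferentiableAt (by simp))
  obtain ⟨ha1, ha2, ha3, ha4⟩ := hs ha
  obtain ⟨hb1, hb2, hb3, hb4⟩ := hs hb
  obtain ⟨hd1, hd2, -, -⟩ := hs hd
  have ham1 := ha1.mdifferentiableAt (n := ∞) (by simp)
  have ham2 := ha2.mdifferentiableAt (n := ∞) (by simp)
  have hbu : vel 𝓘(ℝ, EX) (fun s => b (s, 0)) 0 = u₂ := by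
    rw [← hdu]
    refine vel_retraction (f := P.top.src) (x := y) (a := fun s => P.top.tgt (a (s, 0)))
      (d := fun s => d (s, 0))
      (P.top.mdifferentiableAt_src y) (hρ.mdifferentiableAt (by simp)) hρ2
      (MDifferentiableAt.comp (g := P.top.tgt) (0 : ℝ) (P.top.mdifferentiableAt_tgt _) ham1)
      (hd1.mdifferentiableAt (by simp)) (by rw [ha0, h]) hd0 ?_
    rw [vel_comp (g := P.top.tgt) (P.top.mdifferentiableAt_tgt _) ham1, ha0, hau, hdu, hu]
  have hbv : vel 𝓘(ℝ, EX) (fun s => b (0, s)) 0 = v₂ := by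
    rw [← hdv]
    refine vel_retraction (f := P.top.src) (x := y) (a := fun s => P.top.tgt (a (0, s)))
      (d := fun s => d (0, s))
      (P.top.mdifferentiableAt_src y) (hρ.mdifferentiableAt (by simp)) hρ2
      (MDifferentiableAt.comp (g := P.top.tgt) (0 : ℝ) (P.top.mdifferentiableAt_tgt _) ham2)
      (hd2.mdifferentiableAt (by simp)) (by rw [ha0, h]) hd0 ?_
    rw [vel_comp (g := P.top.tgt) (P.top.mdifferentiableAt_tgt _) ham2, ha0, hav, hdv, hv]
  have hbm1 := hb1.mdifferentiableAt (n := ∞) (by simp)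
  have hbm2 := hb2.mdifferentiableAt (n := ∞) (by simp)
  have hFu := (P.top.vel_mul ham1 hbm1 (ht1.eventually hcomp)).2
  have hFv := (P.top.vel_mul ham2 hbm2 (ht2.eventually hcomp)).2
  rw [hau, hbu, ha0, hb0] at hFu
  rw [hav, hbv, ha0, hb0] at hFv
  obtain ⟨a₁, a₂, A1, A2, A3⟩ := C.smoothEnd_vr.exists_curv_family (p := x) ha (by simp [ha0])
  obtain ⟨b₁, b₂, B1, B2, B3⟩ := C.smoothEnd_vr.exists_curv_family (p := y) hb (by simp [hb0])
  obtain ⟨f₁, f₂, F1, F2, F3⟩ := C.smoothEnd_vr.exists_curv_family (p := P.top.mul x y) hF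
    (by simp [ha0, hb0])
  rw [hau, hav, ha0, tc_self] at A3
  rw [hbu, hbv, hb0, tc_self] at B3
  simp only [ha0, hb0, hFu, hFv, tc_self] at F3
  have hc1 : ∀ᶠ s in 𝓝 (0 : ℝ), ∀ᶠ t in 𝓝 (0 : ℝ), P.top.tgt (a (s, t)) = P.top.src (b (s, t)) :=
    hcomp.curry_nhds
  have hc2 : ∀ᶠ t in 𝓝 (0 : ℝ), ∀ᶠ s in 𝓝 (0 : ℝ), P.top.tgt (a (s, t)) = P.top.src (b (s, t)) :=
    (hsw.eventually hcomp).curry_nhds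
  obtain ⟨G1, va₁, vb₁⟩ := C.hasDerivAt_vr_tmL (a := fun s => a (s, 0)) (b := fun s => b (s, 0))
    (wa := fun s => vel 𝓘(ℝ, EX) (fun t => a (s, t)) 0)
    (wb := fun s => vel 𝓘(ℝ, EX) (fun t => b (s, t)) 0) (da := a₁) (db := b₁) ha1 hb1
    (ht1.eventually hcomp) (by
      filter_upwards [hc1, ha3, hb3] with s h1 h2 h3
      exact P.top.md_tgt_vel_eq h2 h3 h1) (by rw [ha0, hav, hv₁]) (by rw [hb0, hbv, hv₂])
    (by rw [ha0]; exact A1) (by rw [hb0]; exact B1)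
  obtain ⟨G2, va₂, vb₂⟩ := C.hasDerivAt_vr_tmL (a := fun s => a (0, s)) (b := fun s => b (0, s))
    (wa := fun t => vel 𝓘(ℝ, EX) (fun s => a (s, t)) 0)
    (wb := fun t => vel 𝓘(ℝ, EX) (fun s => b (s, t)) 0) (da := a₂) (db := b₂) ha2 hb2
    (ht2.eventually hcomp) (by
      filter_upwards [hc2, ha4, hb4] with s h1 h2 h3
      exact P.top.md_tgt_vel_eq h2 h3 h1) (by rw [ha0, hau, hu₁]) (by rw [hb0, hbu, hu₂])
    (by rw [ha0]; exact A2) (by rw [hb0]; exact B2)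
  simp only [ha0, hb0] at G1 G2 va₁ vb₁ va₂ vb₂
  -- The velocities at the origin are horizontal, so the vertical parts vanish there and the
  -- derivative of their product is the product of their derivatives.
  have e1 : f₁ = P.top.tmL x y (a₁, b₁) := by
    refine F1.unique (G1.congr_of_eventuallyEq ?_)
    filter_upwards [hc1, ha3, hb3] with s h1 h2 h3
    rw [(P.top.vel_mul h2 h3 h1).2]
  have e2 : f₂ = P.top.tmL x y (a₂, b₂) := by
    refine F2.unique (G2.congr_of_eventuallyEq ?_)
    filter_upwards [hc2, ha4, hb4] with s h1 h2 h3
    rw [(P.top.vel_mul h2 h3 h1).2]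
  have hsub : ∀ p q p' q' : EX, ((p, q) : EX × EX) - (p', q') = (p - p', q - q') :=
    fun p q p' q' => rfl
  rw [e1, e2, ← map_sub, hsub] at F3
  have va : P.dproj x (a₁ - a₂) = 0 := by rw [map_sub, va₁, va₂, sub_zero]
  have vb : P.dproj y (b₁ - b₂) = 0 := by rw [map_sub, vb₁, vb₂, sub_zero]
  have hz : ∀ p q : EX, C.vr x p = 0 → C.vr y q = 0 →
      md 𝓘(ℝ, EX) 𝓘(ℝ, EM) P.top.tgt x p = md 𝓘(ℝ, EX) 𝓘(ℝ, EM) P.top.src y q →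
      C.vr (P.top.mul x y) (P.top.tmL x y (p, q)) = 0 := by
    intro p q hp hq hpq
    rw [C.vr_tmL h hpq, hp, hq]
    exact map_zero _
  unfold om
  rw [hz _ _ hu₁ hu₂ hu, hz _ _ hv₁ hv₂ hv, hu₁, hv₁, hu₂, hv₂]
  simp only [sub_zero, ← chartCurv_eq]
  simp only [ContinuousLinearMap.id_apply] at A3 B3 F3
  rw [A3, B3, F3]
  -- The two exterior derivatives are vertical, hence composable, and the multiplicativity of the
  -- connection form supplies the adjoint factor.
  exact C.fm_tmL h (by rw [P.md_tgt_of_vert va, P.md_src_of_vert vb])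

/-- The curvature is multiplicative. -/
theorem om_tmL {x y : X} (h : P.top.tgt x = P.top.src y) {u₁ v₁ u₂ v₂ : EX}
    (hu : md 𝓘(ℝ, EX) 𝓘(ℝ, EM) P.top.tgt x u₁ = md 𝓘(ℝ, EX) 𝓘(ℝ, EM) P.top.src y u₂)
    (hv : md 𝓘(ℝ, EX) 𝓘(ℝ, EM) P.top.tgt x v₁ = md 𝓘(ℝ, EX) 𝓘(ℝ, EM) P.top.src y v₂) :
    C.om (P.top.mul x y) (P.top.tmL x y (u₁, u₂)) (P.top.tmL x y (v₁, v₂)) =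
      P.AdL (P.top.inv y) (C.om x u₁ v₁) + C.om y u₂ v₂ := by
  have hom : ∀ (z : X) (u v : EX),
      C.om z u v = C.om z (u - C.vr z u) (v - C.vr z v) := by
    intro z u v
    unfold om
    rw [C.vr_sub_vr, C.vr_sub_vr, sub_zero, sub_zero]
  have ht : ∀ v, md 𝓘(ℝ, EX) 𝓘(ℝ, EM) P.top.tgt x (v - C.vr x v) =
      md 𝓘(ℝ, EX) 𝓘(ℝ, EM) P.top.tgt x v := by
    intro v
    rw [map_sub, P.md_tgt_of_vert (C.dproj_vr x v), sub_zero]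
  have hs : ∀ v, md 𝓘(ℝ, EX) 𝓘(ℝ, EM) P.top.src y (v - C.vr y v) =
      md 𝓘(ℝ, EX) 𝓘(ℝ, EM) P.top.src y v := by
    intro v
    rw [map_sub, P.md_src_of_vert (C.dproj_vr y v), sub_zero]
  have hsub : ∀ p q p' q' : EX, ((p, q) : EX × EX) - (p', q') = (p - p', q - q') :=
    fun p q p' q' => rfl
  -- The curvature sees only horizontal parts, and the horizontal part of a product is the product
  -- of the horizontal parts.
  rw [hom, C.vr_tmL h hu, C.vr_tmL h hv, ← map_sub, ← map_sub, hsub, hsub,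
    C.om_tmL_horizontal h (by rw [ht, hs, hu]) (by rw [ht, hs, hv]) (C.vr_sub_vr _ _)
      (C.vr_sub_vr _ _) (C.vr_sub_vr _ _) (C.vr_sub_vr _ _), ← hom, ← hom]

theorem deltaR_curv {x y : X} (h : P.top.tgt x = P.top.src y) {u₁ v₁ u₂ v₂ : EX}
    (hu : P.top.TComposable x y u₁ u₂) (hv : P.top.TComposable x y v₁ v₂) :
    deltaR P C.curv x y u₁ v₁ u₂ v₂ = 0 := by
  have h1 := C.om_tmL h (u₁ := u₁) (v₁ := v₁) (u₂ := u₂) (v₂ := v₂) hu hv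
  rw [← curv_eq, ← curv_eq, ← curv_eq] at h1
  have h2 : ∀ p q r : EX, p = P.AdL (P.top.inv y) q + r → r - p + P.AdL (P.top.inv y) q = 0 := by
    rintro p q r rfl
    abel
  exact h2 _ _ _ h1

end Connection

end LieGrpdExt

theorem theorem4p26
    {EX : Type*} [NormedAddCommGroup EX] [NormedSpace ℝ EX] [FiniteDimensional ℝ EX]
    {EY : Type*} [NormedAddCommGroup EY] [NormedSpace ℝ EY] [FiniteDimensional ℝ EY]
    {EM : Type*} [NormedAddCommGroup EM] [NormedSpace ℝ EM] [FiniteDimensional ℝ EM]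
    {X : Type*} [TopologicalSpace X] [ChartedSpace EX X] [IsManifold 𝓘(ℝ, EX) ∞ X] [T2Space X]
    {Y : Type*} [TopologicalSpace Y] [ChartedSpace EY Y] [IsManifold 𝓘(ℝ, EY) ∞ Y] [T2Space Y]
    {M : Type*} [TopologicalSpace M] [ChartedSpace EM M] [IsManifold 𝓘(ℝ, EM) ∞ M] [T2Space M]
    (P : LieGrpdExt (EX := EX) (EY := EY) (EM := EM) X Y M) (C : P.Connection) :
    -- the first identity, tested on all smooth vector fields at all points
    (∀ U V W : ∀ x : X, TangentSpace 𝓘(ℝ, EX) x,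
      ContMDiff 𝓘(ℝ, EX) 𝓘(ℝ, EX).tangent ∞ (fun x => (⟨x, U x⟩ : TangentBundle 𝓘(ℝ, EX) X)) →
      ContMDiff 𝓘(ℝ, EX) 𝓘(ℝ, EX).tangent ∞ (fun x => (⟨x, V x⟩ : TangentBundle 𝓘(ℝ, EX) X)) →
      ContMDiff 𝓘(ℝ, EX) 𝓘(ℝ, EX).tangent ∞ (fun x => (⟨x, W x⟩ : TangentBundle 𝓘(ℝ, EX) X)) →
      ∀ x : X,
        C.extCovDeriv C.curv U V W x
            + LieGrpdExt.Connection.gradedBracket P C.form C.curv x (U x) (V x) (W x)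
          = C.curvPairing C.form x (U x) (V x) (W x)) ∧
    -- the second identity, tested on all pairs of tangent vectors to the composable pairs
    (∀ x₁ x₂ : X, P.top.tgt x₁ = P.top.src x₂ →
      ∀ (u₁ v₁ : TangentSpace 𝓘(ℝ, EX) x₁) (u₂ v₂ : TangentSpace 𝓘(ℝ, EX) x₂),
        P.top.TComposable x₁ x₂ u₁ u₂ → P.top.TComposable x₁ x₂ v₁ v₂ →
        LieGrpdExt.Connection.deltaR P C.curv x₁ x₂ u₁ v₁ u₂ v₂ = 0) := by
  refine ⟨fun U V W hU hV hW x => ?_, fun x₁ x₂ h u₁ v₁ u₂ v₂ hu hv => C.deltaR_curv h hu hv⟩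
  exact C.bianchi (.of_forall fun y => hU y) (.of_forall fun y => hV y) (.of_forall fun y => hW y)

end
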